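/- Let $A$ be a real $n\times d$ matrix whose rows $A_1,\dots,A_n$ are points of $\mathbb R^d$, divided into $k$ nonempty clusters $T_1,\dots,T_k$ with sizes $n_r=|T_r|$ and pairwise distinct means $\mu_1,\dots,\mu_k$. Let $C$ be the $n\times d$ matrix with $C_i=\mu_r$ for $i\in T_r$, let $\|\cdot\|$ be the spectral norm, and for $c>0$ put $$\Delta_{rs}=\Big(\frac{ck}{\sqrt{n_r}}+\frac{ck}{\sqrt{n_s}}\Big)\|A-C\| .$$ A point $A_i\in T_r$ is *good* if for every $s\ne r$ its projection onto the line through $\mu_r$ and $\mu_s$ is at least $\Delta_{rs}$ closer to $\mu_r$ than to $\mu_s$; $G$ is the set of good points. Say that a labelling of the points by $1,\dots,k$ *recovers* the clusters with constant $K$ if, up to a permutation of the labels, * for every real $\varepsilon$: if $|G|\ge(1-\varepsilon)n$ and $|\mu_r-\mu_s|\ge\Delta_{rs}$ for all $r\ne s$, then all but at most $K k^2\varepsilon n$ points are labelled by their own cluster; * if all points are good, then all points are labelled by their own cluster. (The separation $|\mu_r-\mu_s|\ge\Delta_{rs}$ holds automatically as soon as $T_r\cup T_s$ contains a good point.) Algorithm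 Cluster, with approximation factor $\varphi\ge1$ and $\ell$ iterations: (1) let $\hat A_i$ be the projection of $A_i$ onto the subspace $V$ spanned by $k$ top right singular vectors of $A$, and let $\nu_1,\dots,\nu_k$ be any centers whose $k$-means cost for $\hat A_1,\dots,\hat A_n$ is at most $\varphi$ times the optimum; (2) repeat $\ell$ times: assign each $A_i$ to a closest center and replace each center by the mean of the points assigned to it (a center with no points stays). Finally label each $A_i$ by a closest center. Ties are broken arbitrarily. In the $\theta$-approximate version, $\theta\ge1$, $V$ is any subspace of dimension at most $k$ for which the spectral norm of $A-\hat A$ is at most $\theta$ times the one given by the exact singular value decomposition. **Theorem.** There is an absolute constant $K$ such that the following hold. 1. For every $\varphi\ge1$ there are constants $c_0,L>0$ such that for every $c\ge c_0$, every $n,d,k,A$ and every clustering as above, each outcome of Cluster with factor $\varphi$ and any number $\ell\ge L(1+\log n)$ of iterations recovers the clusters with constant $K$. 2. There are constants $\theta,\varphi\ge1$, $c_0>0$, a polynomial $p$ and a program $P$ for a real random access machine (exact arithmetic $+,-,\times,/$ and comparisons on reals, rational constants, unit cost per operation) such that for all $n,d,k$ with $1\le k\le n$ and every real $n\times d$ matrix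 $A$, the program $P$ on input $(n,d,k,A)$ halts within $p(n+d+k)$ steps, and its output is an outcome of the $\theta$-approximate version of Cluster with factor $\varphi$ (for some number of iterations), and recovers with constant $K$ every clustering of $A$ as above, for every $c\ge c_0$. -/

import Mathlib

open scoped Matrix Matrix.Norms.L2Operator

noncomputable section

namespace SpectralClustering

/-! ### Data points, clusters, the proximity condition

The data matrix `A` is an `n × d` real matrix whose rows are the points; `‖·‖` on matrices is the
spectral norm (the operator norm for the Euclidean norms). A division into `k` clusters is a map
`T : Fin n → Fin k`, the cluster `T_r` being the fibre over `r`. -/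

/-- Points of `ℝ^d` with the Euclidean norm. -/
abbrev Pt (d : ℕ) := EuclideanSpace ℝ (Fin d)

/-- The `i`-th row of a matrix, as a point of `ℝ^d`. -/
def row {n d : ℕ} (A : Matrix (Fin n) (Fin d) ℝ) (i : Fin n) : Pt d := WithLp.toLp 2 (A i)

/-- The matrix with prescribed rows. -/
def ofRows {n d : ℕ} (p : Fin n → Pt d) : Matrix (Fin n) (Fin d) ℝ :=
  Matrix.of fun i j => p i j

/-- The set of indices that `T` puts into part `r`. -/
def part {n k : ℕ} (T : Fin n → Fin k) (r : Fin k) : Finset (Fin n) :=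
  Finset.univ.filter fun i => T i = r

/-- The mean of the points with indices in `S` (meaningful for nonempty `S`). -/
def mean {n d : ℕ} (p : Fin n → Pt d) (S : Finset (Fin n)) : Pt d :=
  (S.card : ℝ)⁻¹ • ∑ i ∈ S, p i

/-- The mean `μ_r` of cluster `r`. -/
def clusterMean {n d k : ℕ} (A : Matrix (Fin n) (Fin d) ℝ) (T : Fin n → Fin k) (r : Fin k) :
    Pt d :=
  mean (row A) (part T r)

/-- The matrix `C` whose `i`-th row is the mean of the cluster of point `i`. -/
def centerMatrix {n d k : ℕ} (A : Matrix (Fin n) (Fin d) ℝ) (T : Fin n → Fin k) :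
    Matrix (Fin n) (Fin d) ℝ :=
  ofRows fun i => clusterMean A T (T i)

/-- `T` divides the points into `k` nonempty clusters with pairwise distinct means (so that there
is a line through any two of the means). -/
structure IsClustering {n d k : ℕ} (A : Matrix (Fin n) (Fin d) ℝ) (T : Fin n → Fin k) :
    Prop where
  nonempty : ∀ r, (part T r).Nonempty
  means_injective : Function.Injective (clusterMean A T)

/-- `Δ_rs = (c k / √n_r + c k / √n_s) ‖A - C‖`. -/
def separation {n d k : ℕ} (c : ℝ) (A : Matrix (Fin n) (Fin d) ℝ) (T : Fin n → Fin k)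
    (r s : Fin k) : ℝ :=
  (c * k / √((part T r).card : ℝ) + c * k / √((part T s).card : ℝ)) * ‖A - centerMatrix A T‖

/-- The orthogonal projection of a point onto the line through `a` and `b`. -/
def lineProj {d : ℕ} (a b x : Pt d) : Pt d :=
  EuclideanGeometry.orthogonalProjection line[ℝ, a, b] x

/-- Point `i` satisfies the proximity condition: for every `s` other than its own cluster `r`, its
projection onto the line through `μ_r` and `μ_s` is at least `Δ_rs` closer to `μ_r` than to
`μ_s`. -/
def Proximity {n d k : ℕ} (c : ℝ) (A : Matrix (Fin n) (Fin d) ℝ) (T : Fin n → Fin k)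
    (i : Fin n) : Prop :=
  ∀ s, s ≠ T i →
    dist (lineProj (clusterMean A T (T i)) (clusterMean A T s) (row A i)) (clusterMean A T (T i))
        + separation c A T (T i) s
      ≤ dist (lineProj (clusterMean A T (T i)) (clusterMean A T s) (row A i)) (clusterMean A T s)

open Classical in
/-- The set `G` of good points: those that satisfy the proximity condition. -/
def good {n d k : ℕ} (c : ℝ) (A : Matrix (Fin n) (Fin d) ℝ) (T : Fin n → Fin k) :
    Finset (Fin n) :=
  Finset.univ.filter fun i => Proximity c A T i

/-- Any two cluster means are at distance at least `Δ_rs`. -/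
def MeansSeparated {n d k : ℕ} (c : ℝ) (A : Matrix (Fin n) (Fin d) ℝ) (T : Fin n → Fin k) :
    Prop :=
  ∀ r s, r ≠ s → separation c A T r s ≤ dist (clusterMean A T r) (clusterMean A T s)

/-- Up to renaming the labels, `label` agrees with `T` on all but at most `m` points. -/
def CorrectUpTo {n k : ℕ} (m : ℝ) (T label : Fin n → Fin k) : Prop :=
  ∃ π : Equiv.Perm (Fin k), ((Finset.univ.filter fun i => π (T i) ≠ label i).card : ℝ) ≤ m

/-- `label` classifies correctly all but `K k² ε n` points whenever a fraction at least `1 - ε` of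
the points is good, and every point when all of them are good. -/
def Recovers {n d k : ℕ} (K c : ℝ) (A : Matrix (Fin n) (Fin d) ℝ) (T label : Fin n → Fin k) :
    Prop :=
  (∀ ε : ℝ, MeansSeparated c A T → (1 - ε) * n ≤ (good c A T).card →
    CorrectUpTo (K * k ^ 2 * ε * n) T label) ∧
  ((∀ i, Proximity c A T i) → CorrectUpTo 0 T label)

/-! ### The algorithm Cluster -/

/-- `V` is spanned by `k` top right singular vectors of `A` (all of them if `d ≤ k`): the best
`k`-dimensional subspace given by a singular value decomposition. -/
def IsTopSingularSubspace {n d : ℕ} (k : ℕ) (A : Matrix (Fin n) (Fin d) ℝ)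
    (V : Submodule ℝ (Pt d)) : Prop :=
  ∃ (v : OrthonormalBasis (Fin d) ℝ (Pt d)) (σ : Fin d → ℝ),
    Antitone σ ∧ (∀ j, 0 ≤ σ j) ∧
    (∀ j, Matrix.toEuclideanLin (Aᵀ * A) (v j) = (σ j) ^ 2 • v j) ∧
    V = Submodule.span ℝ (v '' {j | (j : ℕ) < k})

/-- The projections `Â_i` of the points onto `V`. -/
def projPts {n d : ℕ} (A : Matrix (Fin n) (Fin d) ℝ) (V : Submodule ℝ (Pt d)) (i : Fin n) :
    Pt d :=
  V.starProjection (row A i)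

/-- `V` is, up to the factor `θ` in the spectral norm of the residual `A - Â`, as good as the
subspace given by an exact singular value decomposition. -/
def IsNearTopSubspace {n d : ℕ} (θ : ℝ) (k : ℕ) (A : Matrix (Fin n) (Fin d) ℝ)
    (V : Submodule ℝ (Pt d)) : Prop :=
  Module.finrank ℝ V ≤ k ∧ ∃ V', IsTopSingularSubspace k A V' ∧
    ‖A - ofRows (projPts A V)‖ ≤ θ * ‖A - ofRows (projPts A V')‖

/-- The `k`-means cost of the centers `ν`: the sum of the squared distances of the points to
their nearest centers. -/
def kmeansCost {n d k : ℕ} (p : Fin n → Pt d) (ν : Fin k → Pt d) : ℝ :=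
  ∑ i, ⨅ r, ‖p i - ν r‖ ^ 2

/-- The centers `ν` are a `φ`-approximate solution of the `k`-means problem for the points `p`. -/
def IsApproxKMeans {n d k : ℕ} (φ : ℝ) (p : Fin n → Pt d) (ν : Fin k → Pt d) : Prop :=
  ∀ ν' : Fin k → Pt d, kmeansCost p ν ≤ φ * kmeansCost p ν'

/-- `S` assigns every point to a closest center (ties are broken arbitrarily). -/
def IsNearestAssignment {n d k : ℕ} (p : Fin n → Pt d) (ν : Fin k → Pt d) (S : Fin n → Fin k) :
    Prop :=
  ∀ i r, ‖p i - ν (S i)‖ ≤ ‖p i - ν r‖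

open Classical in
/-- The new centers: the means of the points assigned to the old ones. A center to which no point
is assigned stays where it is. -/
def recenter {n d k : ℕ} (p : Fin n → Pt d) (ν : Fin k → Pt d) (S : Fin n → Fin k) :
    Fin k → Pt d :=
  fun r => if (part S r).Nonempty then mean p (part S r) else ν r

/-- `label` is a possible outcome of Cluster on `A` with projection subspace `V`: start with
`φ`-approximate `k`-means centers of the projected points, update the centers `ℓ` times
by Lloyd steps on the points themselves, and assign each point to a closest resulting center. -/
def IsClusterOutput {n d k : ℕ} (φ : ℝ) (ℓ : ℕ) (A : Matrix (Fin n) (Fin d) ℝ)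
    (V : Submodule ℝ (Pt d)) (label : Fin n → Fin k) : Prop :=
  ∃ (ν : ℕ → Fin k → Pt d) (S : ℕ → Fin n → Fin k),
    IsApproxKMeans φ (projPts A V) (ν 0) ∧
    (∀ t ≤ ℓ, IsNearestAssignment (row A) (ν t) (S t)) ∧
    (∀ t < ℓ, ν (t + 1) = recenter (row A) (ν t) (S t)) ∧
    label = S ℓ

end SpectralClustering

/-! ### A real random access machine with a step count

Memory consists of arrays of natural numbers (for counters, addresses, labels) and arrays of real
numbers, all with two indices and indirect addressing. Reals allow exact `+ - * /` and comparison,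
with rational constants only; there are no roots, no rounding and no other primitive. Natural
numbers allow `+`, truncated `-` and comparison. Programs are finite, fixed independently of the
input, and every elementary operation, memory access and test costs one step. Loops are bounded by
the value of an expression on entry, so every program halts. -/

namespace RealRAM

/-- The memory: `N a i j` and `R a i j` are the entries `(i, j)` of the array named `a`. -/
structure State where
  N : ℕ → ℕ → ℕ → ℕ
  R : ℕ → ℕ → ℕ → ℝ

/-- Natural number expressions. -/
inductive NExp where
  | const (m : ℕ)
  | get (a : ℕ) (i j : NExp)
  | add (x y : NExp)
  | sub (x y : NExp)

def NExp.eval (s : State) : NExp → ℕ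
  | .const m => m
  | .get a i j => s.N a (i.eval s) (j.eval s)
  | .add x y => x.eval s + y.eval s
  | .sub x y => x.eval s - y.eval s

def NExp.cost : NExp → ℕ
  | .const _ => 1
  | .get _ i j => i.cost + j.cost + 1
  | .add x y => x.cost + y.cost + 1
  | .sub x y => x.cost + y.cost + 1

/-- Real number expressions; the value of `x / 0` is `0`. -/
inductive RExp where
  | const (q : ℚ)
  | ofNat (x : NExp)
  | get (a : ℕ) (i j : NExp)
  | add (x y : RExp)
  | sub (x y : RExp)
  | mul (x y : RExp)
  | div (x y : RExp)

def RExp.eval (s : State) : RExp → ℝ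
  | .const q => (q : ℝ)
  | .ofNat x => (x.eval s : ℝ)
  | .get a i j => s.R a (i.eval s) (j.eval s)
  | .add x y => x.eval s + y.eval s
  | .sub x y => x.eval s - y.eval s
  | .mul x y => x.eval s * y.eval s
  | .div x y => x.eval s / y.eval s

def RExp.cost : RExp → ℕ
  | .const _ => 1
  | .ofNat x => x.cost + 1
  | .get _ i j => i.cost + j.cost + 1
  | .add x y => x.cost + y.cost + 1
  | .sub x y => x.cost + y.cost + 1
  | .mul x y => x.cost + y.cost + 1
  | .div x y => x.cost + y.cost + 1

/-- Tests. -/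
inductive BExp where
  | nlt (x y : NExp)
  | rlt (x y : RExp)
  | not (b : BExp)
  | and (b b' : BExp)

def BExp.eval (s : State) : BExp → Prop
  | .nlt x y => x.eval s < y.eval s
  | .rlt x y => x.eval s < y.eval s
  | .not b => ¬ b.eval s
  | .and b b' => b.eval s ∧ b'.eval s

def BExp.cost : BExp → ℕ
  | .nlt x y => x.cost + y.cost + 1
  | .rlt x y => x.cost + y.cost + 1
  | .not b => b.cost + 1
  | .and b b' => b.cost + b'.cost + 1

/-- Programs. `loop a e c` evaluates `e` once, and then runs `c` that many times, with the number
of the current round, counted from `0`, stored in `N a 0 0` before each round. -/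
inductive Prog where
  | skip
  | setN (a : ℕ) (i j e : NExp)
  | setR (a : ℕ) (i j : NExp) (e : RExp)
  | seq (c c' : Prog)
  | ite (b : BExp) (c c' : Prog)
  | loop (a : ℕ) (e : NExp) (c : Prog)

def State.writeN (s : State) (a i j v : ℕ) : State :=
  { s with N := fun a' i' j' => if a' = a ∧ i' = i ∧ j' = j then v else s.N a' i' j' }

def State.writeR (s : State) (a i j : ℕ) (v : ℝ) : State :=
  { s with R := fun a' i' j' => if a' = a ∧ i' = i ∧ j' = j then v else s.R a' i' j' }

/-- The state after `m` rounds of a loop with counter `a` and body `f`. -/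
def rounds (a : ℕ) (f : State → State) (s : State) : ℕ → State
  | 0 => s
  | m + 1 => f ((rounds a f s m).writeN a 0 0 m)

open Classical in
/-- The state in which a program halts. -/
def Prog.exec : Prog → State → State
  | .skip, s => s
  | .setN a i j e, s => s.writeN a (i.eval s) (j.eval s) (e.eval s)
  | .setR a i j e, s => s.writeR a (i.eval s) (j.eval s) (e.eval s)
  | .seq c c', s => c'.exec (c.exec s)
  | .ite b c c', s => if b.eval s then c.exec s else c'.exec s
  | .loop a e c, s => rounds a c.exec s (e.eval s)

open Classical in
/-- The number of steps a program takes. -/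
def Prog.time : Prog → State → ℕ
  | .skip, _ => 1
  | .setN _ i j e, _ => i.cost + j.cost + e.cost + 1
  | .setR _ i j e, _ => i.cost + j.cost + e.cost + 1
  | .seq c c', s => c.time s + c'.time (c.exec s)
  | .ite b c c', s => b.cost + 1 + (if b.eval s then c.time s else c'.time s)
  | .loop a e c, s => e.cost + 1 +
      ∑ m ∈ Finset.range (e.eval s), (c.time ((rounds a c.exec s m).writeN a 0 0 m) + 2)

/-- The initial memory: `n, d, k` in `N 0 0 0`, `N 0 0 1`, `N 0 0 2`, the matrix `A` in `R 0`, and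
zeros everywhere else. -/
def input {n d : ℕ} (A : Matrix (Fin n) (Fin d) ℝ) (k : ℕ) : State where
  N := fun a i j =>
    if a = 0 ∧ i = 0 then (if j = 0 then n else if j = 1 then d else if j = 2 then k else 0) else 0
  R := fun a i j =>
    if h : a = 0 ∧ i < n ∧ j < d then A ⟨i, h.2.1⟩ ⟨j, h.2.2⟩ else 0

/-- The memory `s` holds the labelling `label` in the cells `N 1 0 i`, `i < n`. -/
def HoldsOutput {n k : ℕ} (s : State) (label : Fin n → Fin k) : Prop :=
  ∀ i : Fin n, s.N 1 0 i = label i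

end RealRAM

end

/-!
Both halves of the theorem come from testing `A - C`, of spectral norm `σ`, against vectors adapted to
small sets of points: the sum of the rows of `A - C` in a set `Y` has norm at most `σ √|Y|`, and if
these rows all have a component at least `τ` along a unit vector, then `√|Y| τ ≤ σ`.

*Lloyd steps.* Let the centers be within `c k σ / (16 √n_r)` of the means `μ_r`. A point of `T_s`
assigned to the center of `T_r` sticks out from `μ_s` in the direction of `μ_r`, so there are few of
them, and the first estimate shows that the new centers are again that close. A good point can only
be misassigned because of the errors of the two centers involved, so the number of misassigned good
points is controlled by these errors. Hence a Lloyd step halves the transient part of the error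
(`ErrorBound.recenter`), leaving a part that comes from the bad points. After `log n` steps the
transient part accounts for less than one misclassified point, and the total number of misclassified
points is at most twice the number of bad points (`card_misclassified_lloyd_le`). This gives `K = 2`.

*Initial centers.* `Â - C` has rank at most `2k`, so its squared Frobenius norm is at most `2k` times
its squared spectral norm. Hence the `μ_r` are cheap centers for the projected points, and an
approximate solution of the `k`-means problem has a center within a multiple of `√k σ / √n_r` of each
`μ_r`, since otherwise `T_r` alone would cost too much. The separation makes these centers distinct,
which gives the permutation of the labels (`exists_perm_inBasin`).

*The program.* Singular vectors are not computable by field operations, but an approximation is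
enough. The power of `AᵀA` with exponent `2 ^ d` is obtained by repeated squaring, and `k` rounds of
Gram–Schmidt with greedy pivoting on its columns, without normalization and so without roots, span a
subspace with `θ = 2`: the exponential loss of greedy pivoting disappears in the root
(`IsPivotedGramSchmidt.isNearTopSubspace`). For the `k`-means problem, farthest-first traversal of
the projected points gives an approximation factor of order `n`, and `n k` best swaps of a single
center reduce it to a constant (`isApproxKMeans_of_localSearch`). Then `n` Lloyd steps are made. The
program is verified with frame conditions and loop invariants; all its loops are bounded by `n`, `d`
or `k`, so its running time is polynomial (`Prog.time_le`).
-/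

namespace SpectralClustering

variable {n d k : ℕ}

/-! ### Spectral norm estimates for the rows of a matrix -/

@[simp] lemma row_ofRows (p : Fin n → Pt d) (i : Fin n) : row (ofRows p) i = p i := rfl

lemma row_sub (M N : Matrix (Fin n) (Fin d) ℝ) (i : Fin n) : row (M - N) i = row M i - row N i :=
  rfl

lemma row_centerMatrix (A : Matrix (Fin n) (Fin d) ℝ) (T : Fin n → Fin k) (i : Fin n) :
    row (centerMatrix A T) i = clusterMean A T (T i) := rfl

lemma toEuclideanLin_apply_eq_inner (M : Matrix (Fin n) (Fin d) ℝ) (v : Pt d) (i : Fin n) :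
    Matrix.toEuclideanLin M v i = inner ℝ (row M i) v := by
  simp [row, Matrix.toLpLin_apply, Matrix.mulVec, dotProduct, PiLp.inner_apply, mul_comm]

lemma norm_toEuclideanLin_sq (M : Matrix (Fin n) (Fin d) ℝ) (v : Pt d) :
    ‖Matrix.toEuclideanLin M v‖ ^ 2 = ∑ i, (inner ℝ (row M i) v) ^ 2 := by
  simp [EuclideanSpace.norm_sq_eq, toEuclideanLin_apply_eq_inner]

lemma norm_toEuclideanLin_le (M : Matrix (Fin n) (Fin d) ℝ) (v : Pt d) :
    ‖Matrix.toEuclideanLin M v‖ ≤ ‖M‖ * ‖v‖ :=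
  Matrix.l2_opNorm_mulVec M v

lemma norm_le_of_toEuclideanLin_le (M : Matrix (Fin n) (Fin d) ℝ) {b : ℝ} (hb : 0 ≤ b)
    (h : ∀ v : Pt d, ‖Matrix.toEuclideanLin M v‖ ≤ b * ‖v‖) : ‖M‖ ≤ b := by
  rw [Matrix.l2_opNorm_def]
  exact ContinuousLinearMap.opNorm_le_bound _ hb h

lemma sum_inner_row_sq_le (M : Matrix (Fin n) (Fin d) ℝ) (v : Pt d) :
    ∑ i, (inner ℝ (row M i) v) ^ 2 ≤ ‖M‖ ^ 2 * ‖v‖ ^ 2 := by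
  rw [← norm_toEuclideanLin_sq, ← mul_pow]
  exact pow_le_pow_left₀ (norm_nonneg _) (norm_toEuclideanLin_le M v) 2

/-- The sum of the rows in a set `Y` has norm at most `‖M‖ √|Y|`: test it against itself. -/
lemma norm_sum_row_le (M : Matrix (Fin n) (Fin d) ℝ) (Y : Finset (Fin n)) :
    ‖∑ i ∈ Y, row M i‖ ≤ ‖M‖ * √(Y.card : ℝ) := by
  set w := ∑ i ∈ Y, row M i with hw
  have h1 : ‖w‖ ^ 2 = ∑ i ∈ Y, inner ℝ (row M i) w := by
    rw [← sum_inner, ← hw, real_inner_self_eq_norm_sq]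
  have h2 : (∑ i ∈ Y, inner ℝ (row M i) w) ^ 2 ≤ Y.card * ∑ i ∈ Y, (inner ℝ (row M i) w) ^ 2 :=
    sq_sum_le_card_mul_sum_sq
  have h3 : ∑ i ∈ Y, (inner ℝ (row M i) w) ^ 2 ≤ ‖M‖ ^ 2 * ‖w‖ ^ 2 :=
    (Finset.sum_le_univ_sum_of_nonneg fun i => sq_nonneg _).trans (sum_inner_row_sq_le M w)
  have h4 : (‖w‖ ^ 2) ^ 2 ≤ Y.card * (‖M‖ ^ 2 * ‖w‖ ^ 2) := by
    calc (‖w‖ ^ 2) ^ 2 = (∑ i ∈ Y, inner ℝ (row M i) w) ^ 2 := by rw [h1]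
      _ ≤ _ := h2.trans (mul_le_mul_of_nonneg_left h3 (by positivity))
  rcases (norm_nonneg w).eq_or_lt with h0 | h0
  · rw [← h0]; positivity
  · have h5 : ‖w‖ ^ 2 ≤ (‖M‖ * √(Y.card : ℝ)) ^ 2 := by
      rw [mul_pow, Real.sq_sqrt (by positivity)]
      have : 0 < ‖w‖ ^ 2 := by positivity
      nlinarith
    exact (pow_le_pow_iff_left₀ (norm_nonneg _) (by positivity) two_ne_zero).1 h5

/-- If all rows in `Y` have a component at least `τ` along `w`, then `Y` is small. -/
lemma sqrt_card_mul_le (M : Matrix (Fin n) (Fin d) ℝ) (Y : Finset (Fin n)) (w : Pt d) {τ : ℝ}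
    (hτ : 0 ≤ τ) (h : ∀ i ∈ Y, τ ≤ inner ℝ (row M i) w) :
    √(Y.card : ℝ) * τ ≤ ‖M‖ * ‖w‖ := by
  have h1 : (Y.card : ℝ) * τ ^ 2 ≤ ‖M‖ ^ 2 * ‖w‖ ^ 2 := by
    calc (Y.card : ℝ) * τ ^ 2 = ∑ i ∈ Y, τ ^ 2 := by simp
      _ ≤ ∑ i ∈ Y, (inner ℝ (row M i) w) ^ 2 :=
        Finset.sum_le_sum fun i hi => pow_le_pow_left₀ hτ (h i hi) 2
      _ ≤ ∑ i, (inner ℝ (row M i) w) ^ 2 := Finset.sum_le_univ_sum_of_nonneg fun i => sq_nonneg _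
      _ ≤ _ := sum_inner_row_sq_le M w
  rw [← pow_le_pow_iff_left₀ (by positivity) (by positivity) two_ne_zero, mul_pow, mul_pow,
    Real.sq_sqrt (by positivity)]
  exact h1

/-! ### Good points -/

lemma separation_nonneg {c : ℝ} (hc : 0 ≤ c) (A : Matrix (Fin n) (Fin d) ℝ) (T : Fin n → Fin k)
    (r s : Fin k) : 0 ≤ separation c A T r s := by
  unfold separation; positivity

lemma separation_comm (c : ℝ) (A : Matrix (Fin n) (Fin d) ℝ) (T : Fin n → Fin k)
    (r s : Fin k) : separation c A T r s = separation c A T s r := by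
  unfold separation; ring

/-- The distances of a point and of its projection onto a line to two points of the line have the
same difference of squares. -/
lemma dist_sq_sub_dist_sq_lineProj (a b x : Pt d) :
    dist x b ^ 2 - dist x a ^ 2
      = dist (lineProj a b x) b ^ 2 - dist (lineProj a b x) a ^ 2 := by
  have ha := EuclideanGeometry.dist_sq_eq_dist_orthogonalProjection_sq_add_dist_orthogonalProjection_sq
    (s := line[ℝ, a, b]) x (left_mem_affineSpan_pair ℝ a b)
  have hb := EuclideanGeometry.dist_sq_eq_dist_orthogonalProjection_sq_add_dist_orthogonalProjection_sq
    (s := line[ℝ, a, b]) x (right_mem_affineSpan_pair ℝ a b)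
  unfold lineProj
  rw [dist_comm a, dist_comm a] at ha
  rw [dist_comm b, dist_comm b] at hb
  nlinarith

lemma Proximity.separation_le_dist {c : ℝ} {A : Matrix (Fin n) (Fin d) ℝ}
    {T : Fin n → Fin k} {i : Fin n} (h : Proximity c A T i) {s : Fin k} (hs : s ≠ T i) :
    separation c A T (T i) s ≤ dist (clusterMean A T (T i)) (clusterMean A T s) := by
  have := h s hs
  have h2 := dist_triangle (lineProj (clusterMean A T (T i)) (clusterMean A T s) (row A i))
    (clusterMean A T (T i)) (clusterMean A T s)
  linarith

lemma Proximity.mul_le_sub {c : ℝ} (hc : 0 ≤ c) {A : Matrix (Fin n) (Fin d) ℝ}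
    {T : Fin n → Fin k} {i : Fin n} (h : Proximity c A T i) {s : Fin k} (hs : s ≠ T i) :
    dist (clusterMean A T (T i)) (clusterMean A T s) * separation c A T (T i) s
      ≤ dist (row A i) (clusterMean A T s) ^ 2 - dist (row A i) (clusterMean A T (T i)) ^ 2 := by
  have h1 := h s hs
  have h2 := dist_triangle_left (clusterMean A T (T i)) (clusterMean A T s)
    (lineProj (clusterMean A T (T i)) (clusterMean A T s) (row A i))
  rw [dist_sq_sub_dist_sq_lineProj (clusterMean A T (T i))]
  have h3 := separation_nonneg hc A T (T i) s
  have h4 : 0 ≤ dist (clusterMean A T (T i)) (clusterMean A T s) := dist_nonneg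
  nlinarith

lemma meansSeparated_of_proximity {c : ℝ} {A : Matrix (Fin n) (Fin d) ℝ}
    {T : Fin n → Fin k} (hT : IsClustering A T) (h : ∀ i, Proximity c A T i) :
    MeansSeparated c A T := by
  intro r s hrs
  obtain ⟨i, hi⟩ := hT.nonempty r
  have : T i = r := by simpa [part] using hi
  subst this
  exact (h i).separation_le_dist hrs.symm

/-! ### One Lloyd step -/

/-- The points of cluster `s` that are assigned to center `r`. -/
def cell (T S : Fin n → Fin k) (s r : Fin k) : Finset (Fin n) :=
  Finset.univ.filter fun i => T i = s ∧ S i = r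

lemma mem_cell {T S : Fin n → Fin k} {s r : Fin k} {i : Fin n} :
    i ∈ cell T S s r ↔ T i = s ∧ S i = r := by simp [cell]

lemma mem_part {T : Fin n → Fin k} {r : Fin k} {i : Fin n} : i ∈ part T r ↔ T i = r := by
  simp [part]

/-- The centers are much closer to the means they belong to than the means are to each other. -/
def CentersClose (A : Matrix (Fin n) (Fin d) ℝ) (T : Fin n → Fin k) (ν : Fin k → Pt d) : Prop :=
  ∀ r s, r ≠ s → ‖ν r - clusterMean A T r‖
    ≤ dist (clusterMean A T r) (clusterMean A T s) / 16

/-- Points of cluster `s` that are closer to another center `r` stick out in the direction of that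
center, so there are few of them. This needs no goodness. -/
lemma sqrt_card_cell_mul_dist_le {A : Matrix (Fin n) (Fin d) ℝ} {T S : Fin n → Fin k}
    {ν : Fin k → Pt d} (hT : IsClustering A T) (hν : CentersClose A T ν)
    (hS : IsNearestAssignment (row A) ν S) {s r : Fin k} (hsr : s ≠ r) :
    √((cell T S s r).card : ℝ) * dist (clusterMean A T s) (clusterMean A T r)
      ≤ 5 * ‖A - centerMatrix A T‖ := by
  set μ := clusterMean A T with hμ
  set D := dist (μ s) (μ r) with hD
  have hDpos : 0 < D := dist_pos.2 fun h => hsr (hT.means_injective h)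
  have hes : ‖ν s - μ s‖ ≤ D / 16 := hν s r hsr
  have her : ‖ν r - μ r‖ ≤ D / 16 := by rw [hD, dist_comm]; exact hν r s hsr.symm
  have hDn : D = ‖μ r - μ s‖ := by rw [hD, dist_comm, dist_eq_norm]
  have hup : ‖ν r - ν s‖ ≤ 9 / 8 * D := by
    have : ν r - ν s = (ν r - μ r) + (μ r - μ s) - (ν s - μ s) := by abel
    rw [this]
    have h1 := norm_sub_le ((ν r - μ r) + (μ r - μ s)) (ν s - μ s)
    have h2 := norm_add_le (ν r - μ r) (μ r - μ s)
    linarith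
  have hlow : 15 / 16 * D ≤ ‖ν r - μ s‖ := by
    have : μ r - μ s = (ν r - μ s) - (ν r - μ r) := by abel
    have h1 := norm_sub_le (ν r - μ s) (ν r - μ r)
    rw [← this] at h1
    linarith
  have key : ∀ i ∈ cell T S s r,
      7 / 16 * D ^ 2 ≤ inner ℝ (row (A - centerMatrix A T) i) (ν r - ν s) := by
    intro i hi
    obtain ⟨h1, h2⟩ := mem_cell.1 hi
    have h3 := hS i s
    rw [h2] at h3
    rw [row_sub, row_centerMatrix, h1]
    have e1 : row A i - ν r = (row A i - μ s) - (ν r - μ s) := by abel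
    have e2 : row A i - ν s = (row A i - μ s) - (ν s - μ s) := by abel
    have e3 : ν r - ν s = (ν r - μ s) - (ν s - μ s) := by abel
    have h4 : ‖row A i - ν r‖ ^ 2 ≤ ‖row A i - ν s‖ ^ 2 :=
      pow_le_pow_left₀ (norm_nonneg _) h3 2
    rw [e1, e2, norm_sub_sq_real (row A i - μ s) (ν r - μ s),
      norm_sub_sq_real (row A i - μ s) (ν s - μ s)] at h4
    rw [e3, inner_sub_right]
    change _ ≤ inner ℝ (row A i - μ s) _ - inner ℝ (row A i - μ s) _
    have h5 : ‖ν s - μ s‖ ^ 2 ≤ (D / 16) ^ 2 := pow_le_pow_left₀ (norm_nonneg _) hes 2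
    have h6 : (15 / 16 * D) ^ 2 ≤ ‖ν r - μ s‖ ^ 2 :=
      pow_le_pow_left₀ (by positivity) hlow 2
    nlinarith
  have h7 := sqrt_card_mul_le (A - centerMatrix A T) _ _ (by positivity) key
  have h8 : ‖A - centerMatrix A T‖ * ‖ν r - ν s‖ ≤ ‖A - centerMatrix A T‖ * (9 / 8 * D) :=
    mul_le_mul_of_nonneg_left hup (norm_nonneg _)
  have h9 : 0 ≤ ‖A - centerMatrix A T‖ := norm_nonneg _
  have h10 : 0 ≤ √((cell T S s r).card : ℝ) := Real.sqrt_nonneg _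
  have h11 : (√((cell T S s r).card : ℝ) * D) * D ≤ (5 * ‖A - centerMatrix A T‖) * D := by
    nlinarith
  exact le_of_mul_le_mul_right h11 hDpos

/-- Good points of cluster `s` that are closer to another center `r` stick out in the direction of
the difference of the errors of the two centers, so their number is controlled by these errors. -/
lemma sqrt_card_good_mul_le {A : Matrix (Fin n) (Fin d) ℝ} {T S : Fin n → Fin k}
    {ν : Fin k → Pt d} {c : ℝ} (hc : 0 ≤ c) (hS : IsNearestAssignment (row A) ν S)
    {s r : Fin k} (hsr : s ≠ r)
    (hsep : separation c A T s r ≤ dist (clusterMean A T s) (clusterMean A T r))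
    (hes : ‖ν s - clusterMean A T s‖ ≤ separation c A T s r / 16)
    (her : ‖ν r - clusterMean A T r‖ ≤ separation c A T s r / 16) :
    √((cell T S s r ∩ good c A T).card : ℝ) *
        (dist (clusterMean A T s) (clusterMean A T r) * separation c A T s r)
      ≤ 4 * ‖A - centerMatrix A T‖
        * (‖ν s - clusterMean A T s‖ + ‖ν r - clusterMean A T r‖) := by
  set μ := clusterMean A T with hμ
  set D := dist (μ s) (μ r) with hD
  set Δ := separation c A T s r with hΔ
  have hΔ0 : 0 ≤ Δ := separation_nonneg hc A T s r
  have hDn : D = ‖μ r - μ s‖ := by rw [hD, dist_comm, dist_eq_norm]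
  have key : ∀ i ∈ cell T S s r ∩ good c A T,
      D * Δ / 4 ≤ inner ℝ (row (A - centerMatrix A T) i) ((ν r - μ r) - (ν s - μ s)) := by
    intro i hi
    rw [Finset.mem_inter] at hi
    obtain ⟨h1, h2⟩ := mem_cell.1 hi.1
    have hg : Proximity c A T i := by simpa [good] using hi.2
    have h0 := hg.mul_le_sub hc (s := r) (by rw [h1]; exact hsr.symm)
    rw [h1] at h0
    have h3 := hS i s
    rw [h2] at h3
    have h4 : ‖row A i - ν r‖ ^ 2 ≤ ‖row A i - ν s‖ ^ 2 :=
      pow_le_pow_left₀ (norm_nonneg _) h3 2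
    rw [row_sub, row_centerMatrix, h1]
    have e1 : row A i - ν r = (row A i - μ r) - (ν r - μ r) := by abel
    have e2 : row A i - ν s = (row A i - μ s) - (ν s - μ s) := by abel
    have e3 : inner ℝ (row A i - μ r) (ν r - μ r)
        = inner ℝ (row A i - μ s) (ν r - μ r) - inner ℝ (μ r - μ s) (ν r - μ r) := by
      rw [← inner_sub_left]; congr 1; abel
    rw [e1, e2, norm_sub_sq_real (row A i - μ r) (ν r - μ r),
      norm_sub_sq_real (row A i - μ s) (ν s - μ s), e3] at h4
    change D * Δ ≤ _ at h0
    rw [dist_eq_norm, dist_eq_norm] at h0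
    change D * Δ ≤ ‖row A i - μ r‖ ^ 2 - ‖row A i - μ s‖ ^ 2 at h0
    rw [inner_sub_right]
    have h5 : |inner ℝ (μ r - μ s) (ν r - μ r)| ≤ D * (Δ / 16) := by
      refine (abs_real_inner_le_norm _ _).trans ?_
      rw [← hDn]
      exact mul_le_mul_of_nonneg_left her dist_nonneg
    have h6 := (abs_le.1 h5).1
    have h7 : ‖ν s - μ s‖ ^ 2 ≤ (Δ / 16) ^ 2 := pow_le_pow_left₀ (norm_nonneg _) hes 2
    have h8 : Δ * Δ ≤ D * Δ := mul_le_mul_of_nonneg_right hsep hΔ0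
    have h9 : 0 ≤ ‖ν r - μ r‖ ^ 2 := sq_nonneg _
    change D * Δ / 4 ≤ inner ℝ (row A i - μ s) _ - inner ℝ (row A i - μ s) _
    nlinarith
  have h7 := sqrt_card_mul_le (A - centerMatrix A T) _ _
    (by have : 0 ≤ D := dist_nonneg
        positivity) key
  have h8 := mul_le_mul_of_nonneg_left (norm_sub_le (ν r - μ r) (ν s - μ s))
    (norm_nonneg (A - centerMatrix A T))
  nlinarith

lemma part_eq_biUnion_cell_left (T S : Fin n → Fin k) (r : Fin k) {E : Type*} [AddCommMonoid E]
    (f : Fin n → E) : ∑ i ∈ part S r, f i = ∑ s, ∑ i ∈ cell T S s r, f i := by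
  rw [← Finset.sum_fiberwise (part S r) T f]
  refine Finset.sum_congr rfl fun s _ => Finset.sum_congr ?_ fun _ _ => rfl
  ext i; simp [mem_cell, mem_part, and_comm]

lemma part_eq_biUnion_cell_right (T S : Fin n → Fin k) (s : Fin k) {E : Type*} [AddCommMonoid E]
    (f : Fin n → E) : ∑ i ∈ part T s, f i = ∑ r, ∑ i ∈ cell T S s r, f i := by
  rw [← Finset.sum_fiberwise (part T s) S f]
  refine Finset.sum_congr rfl fun s _ => Finset.sum_congr ?_ fun _ _ => rfl
  ext i; simp [mem_cell, mem_part]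

lemma sum_sub_mean_eq_zero (p : Fin n → Pt d) {Y : Finset (Fin n)} (hY : Y.Nonempty) :
    ∑ i ∈ Y, (p i - mean p Y) = 0 := by
  have : (Y.card : ℝ) ≠ 0 := by exact_mod_cast hY.card_pos.ne'
  rw [Finset.sum_sub_distrib, Finset.sum_const, mean, ← Nat.cast_smul_eq_nsmul ℝ,
    smul_inv_smul₀ this, sub_self]

lemma card_smul_mean_sub (p : Fin n → Pt d) {Y : Finset (Fin n)} (hY : Y.Nonempty) (m : Pt d) :
    (Y.card : ℝ) • (mean p Y - m) = ∑ i ∈ Y, (p i - m) := by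
  have : (Y.card : ℝ) ≠ 0 := by exact_mod_cast hY.card_pos.ne'
  rw [Finset.sum_sub_distrib, Finset.sum_const, smul_sub, mean, smul_inv_smul₀ this,
    Nat.cast_smul_eq_nsmul]

/-- The error of the mean of the points assigned to center `r`. Points missing from cluster `r`
contribute like their deviations, and so do the intruders from cluster `s`, which are the fewer
the farther `s` is away. -/
lemma norm_sum_part_sub_le {A : Matrix (Fin n) (Fin d) ℝ} {T S : Fin n → Fin k}
    {ν : Fin k → Pt d} (hT : IsClustering A T) (hν : CentersClose A T ν)
    (hS : IsNearestAssignment (row A) ν S) (r : Fin k) :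
    ‖∑ i ∈ part S r, (row A i - clusterMean A T r)‖
      ≤ ‖A - centerMatrix A T‖ * ∑ s ∈ Finset.univ.erase r,
        (√((cell T S r s).card : ℝ) + 6 * √((cell T S s r).card : ℝ)) := by
  set μ := clusterMean A T with hμ
  set X := ‖A - centerMatrix A T‖ with hX
  have h0 : ∑ s, ∑ i ∈ cell T S r s, (row A i - μ r) = 0 := by
    rw [← part_eq_biUnion_cell_right]
    exact sum_sub_mean_eq_zero (row A) (hT.nonempty r)
  have hrow : ∀ i, row A i - μ (T i) = row (A - centerMatrix A T) i := fun i => rfl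
  have hcell : ∀ s t, ‖∑ i ∈ cell T S s t, (row A i - μ s)‖ ≤ X * √((cell T S s t).card : ℝ) := by
    intro s t
    have : ∑ i ∈ cell T S s t, (row A i - μ s)
        = ∑ i ∈ cell T S s t, row (A - centerMatrix A T) i := by
      refine Finset.sum_congr rfl fun i hi => ?_
      rw [← hrow, (mem_cell.1 hi).1]
    rw [this]; exact norm_sum_row_le _ _
  rw [← Finset.add_sum_erase _ _ (Finset.mem_univ r)] at h0
  rw [part_eq_biUnion_cell_left T S r, ← Finset.add_sum_erase _ _ (Finset.mem_univ r),
    eq_neg_of_add_eq_zero_left h0, neg_add_eq_sub, ← Finset.sum_sub_distrib, Finset.mul_sum]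
  refine (norm_sum_le _ _).trans (Finset.sum_le_sum fun s hs => ?_)
  have hsr : s ≠ r := Finset.ne_of_mem_erase hs
  refine (norm_sub_le _ _).trans ?_
  have h1 := hcell r s
  have h2 : ‖∑ i ∈ cell T S s r, (row A i - μ r)‖ ≤ X * (6 * √((cell T S s r).card : ℝ)) := by
    have e : ∑ i ∈ cell T S s r, (row A i - μ r)
        = ∑ i ∈ cell T S s r, (row A i - μ s) + ((cell T S s r).card : ℝ) • (μ s - μ r) := by
      rw [Nat.cast_smul_eq_nsmul, ← Finset.sum_const, ← Finset.sum_add_distrib]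
      exact Finset.sum_congr rfl fun i _ => by abel
    rw [e]
    refine (norm_add_le _ _).trans ?_
    rw [norm_smul, ← dist_eq_norm, Real.norm_of_nonneg (by positivity)]
    have h3 := sqrt_card_cell_mul_dist_le hT hν hS hsr
    have h4 := hcell s r
    have h5 : ((cell T S s r).card : ℝ) = √((cell T S s r).card : ℝ) * √((cell T S s r).card : ℝ) :=
      (Real.mul_self_sqrt (by positivity)).symm
    have h6 : 0 ≤ √((cell T S s r).card : ℝ) := Real.sqrt_nonneg _
    have h7 := mul_le_mul_of_nonneg_left h3 h6
    change √((cell T S s r).card : ℝ) * (√((cell T S s r).card : ℝ) * dist (μ s) (μ r)) ≤ _ at h7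
    rw [← mul_assoc, ← h5] at h7
    linarith
  linarith

/-! ### Convergence of the Lloyd iteration -/

/-- The square root of the size of a cluster. -/
noncomputable def sqrtSize (T : Fin n → Fin k) (r : Fin k) : ℝ := √((part T r).card : ℝ)

/-- The number of points that are not good. -/
noncomputable def numBad (c : ℝ) (A : Matrix (Fin n) (Fin d) ℝ) (T : Fin n → Fin k) : ℕ :=
  (good c A T)ᶜ.card

lemma IsClustering.sqrtSize_pos {A : Matrix (Fin n) (Fin d) ℝ} {T : Fin n → Fin k}
    (hT : IsClustering A T) (r : Fin k) : 0 < sqrtSize T r :=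
  Real.sqrt_pos.2 (by exact_mod_cast (hT.nonempty r).card_pos)

lemma sqrtSize_sq (T : Fin n → Fin k) (r : Fin k) : sqrtSize T r ^ 2 = (part T r).card :=
  Real.sq_sqrt (by positivity)

lemma separation_eq (c : ℝ) (A : Matrix (Fin n) (Fin d) ℝ) (T : Fin n → Fin k) (r s : Fin k) :
    separation c A T r s = c * k * ((sqrtSize T r)⁻¹ + (sqrtSize T s)⁻¹)
      * ‖A - centerMatrix A T‖ := by
  unfold separation sqrtSize; ring

/-- The basin of attraction of the Lloyd iteration: every center `ν r` is within
`(c k / 16) ‖A - C‖ / √n_r` of `μ_r`. -/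
def InBasin (c : ℝ) (A : Matrix (Fin n) (Fin d) ℝ) (T : Fin n → Fin k) (ν : Fin k → Pt d) : Prop :=
  ∀ r, ‖ν r - clusterMean A T r‖ ≤ c * k / 16 * ‖A - centerMatrix A T‖ * (sqrtSize T r)⁻¹

/-- The finer error bound `‖A - C‖ (a / √n_r + 48 √(k b) / n_r)` with `b` the number of bad points:
the first term is halved by each Lloyd step, the second one persists. -/
def ErrorBound (c a : ℝ) (A : Matrix (Fin n) (Fin d) ℝ) (T : Fin n → Fin k) (ν : Fin k → Pt d) :
    Prop :=
  ∀ r, ‖ν r - clusterMean A T r‖ ≤ ‖A - centerMatrix A T‖ *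
    (a * (sqrtSize T r)⁻¹ + 48 * √(k * numBad c A T) * ((sqrtSize T r)⁻¹) ^ 2)

section Step

variable {A : Matrix (Fin n) (Fin d) ℝ} {T S : Fin n → Fin k} {ν : Fin k → Pt d} {c : ℝ}

lemma InBasin.le_separation (hc : 0 ≤ c) (h : InBasin c A T ν) (r s : Fin k) :
    ‖ν r - clusterMean A T r‖ ≤ separation c A T r s / 16 := by
  rw [separation_eq]
  have h1 := h r
  have h2 : 0 ≤ c * k * ‖A - centerMatrix A T‖ * (sqrtSize T s)⁻¹ := by
    unfold sqrtSize; positivity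
  linarith

lemma InBasin.centersClose (hc : 0 ≤ c) (h : InBasin c A T ν) (hsep : MeansSeparated c A T) :
    CentersClose A T ν := fun r s hrs => by
  have h1 := h.le_separation hc r s
  have h2 := hsep r s hrs
  linarith

lemma sqrt_card_cell_le (hc : 0 ≤ c) (hT : IsClustering A T) (hsep : MeansSeparated c A T)
    (hν : InBasin c A T ν) (hS : IsNearestAssignment (row A) ν S) {s r : Fin k} (hsr : s ≠ r) :
    √((cell T S s r).card : ℝ) * (c * k) ≤ 5 * sqrtSize T r ∧
      √((cell T S s r).card : ℝ) * (c * k) ≤ 5 * sqrtSize T s := by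
  have h1 := sqrt_card_cell_mul_dist_le hT (hν.centersClose hc hsep) hS hsr
  have h2 := hsep s r hsr
  have hD : 0 < dist (clusterMean A T s) (clusterMean A T r) :=
    dist_pos.2 fun h => hsr (hT.means_injective h)
  rw [separation_eq] at h2
  set q := √((cell T S s r).card : ℝ)
  have hq : 0 ≤ q := Real.sqrt_nonneg _
  set X := ‖A - centerMatrix A T‖
  have hX : 0 ≤ X := norm_nonneg _
  have hr := hT.sqrtSize_pos r
  have hs := hT.sqrtSize_pos s
  have hk : (0 : ℝ) ≤ c * k := by positivity
  rcases hX.eq_or_lt with h0 | h0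
  · have : q = 0 := by
      rw [← h0] at h1
      nlinarith
    rw [this]; constructor <;> nlinarith
  · have h3 : q * (c * k) * ((sqrtSize T s)⁻¹ + (sqrtSize T r)⁻¹) ≤ 5 := by
      have h4 := (mul_le_mul_of_nonneg_left h2 hq).trans h1
      refine le_of_mul_le_mul_right ?_ h0
      linarith
    have h5 : 0 ≤ q * (c * k) := by positivity
    have h6 : 0 < (sqrtSize T s)⁻¹ := by positivity
    have h7 : 0 < (sqrtSize T r)⁻¹ := by positivity
    constructor
    · have : q * (c * k) * (sqrtSize T r)⁻¹ ≤ 5 := by nlinarith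
      rwa [← div_eq_mul_inv, div_le_iff₀ hr] at this
    · have : q * (c * k) * (sqrtSize T s)⁻¹ ≤ 5 := by nlinarith
      rwa [← div_eq_mul_inv, div_le_iff₀ hs] at this

lemma sqrt_card_good_le (hc : 0 ≤ c) {a : ℝ} (ha : 0 ≤ a) (hT : IsClustering A T)
    (hsep : MeansSeparated c A T) (hν : InBasin c A T ν) (hν' : ErrorBound c a A T ν)
    (hS : IsNearestAssignment (row A) ν S) {s r : Fin k} (hsr : s ≠ r) :
    √((cell T S s r ∩ good c A T).card : ℝ) * (c * k) ^ 2
        ≤ 4 * (a * sqrtSize T r + 48 * √(k * numBad c A T)) ∧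
      √((cell T S s r ∩ good c A T).card : ℝ) * (c * k) ^ 2
        ≤ 4 * (a * sqrtSize T s + 48 * √(k * numBad c A T)) := by
  have hr := hT.sqrtSize_pos r
  have hs := hT.sqrtSize_pos s
  have h2 := hsep s r hsr
  have hes := hν.le_separation hc s r
  have her := hν.le_separation hc r s
  rw [separation_comm] at her
  have h1 := sqrt_card_good_mul_le hc hS hsr h2 hes her
  have h0 := (sqrt_card_cell_mul_dist_le hT (hν.centersClose hc hsep) hS hsr)
  have hD : 0 < dist (clusterMean A T s) (clusterMean A T r) :=
    dist_pos.2 fun h => hsr (hT.means_injective h)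
  have hsub : √((cell T S s r ∩ good c A T).card : ℝ) ≤ √((cell T S s r).card : ℝ) :=
    Real.sqrt_le_sqrt (by exact_mod_cast Finset.card_le_card Finset.inter_subset_left)
  have hs' := hν' s
  have hr' := hν' r
  have hΔ := separation_nonneg hc A T s r
  have hse := separation_eq c A T s r
  set q := √((cell T S s r ∩ good c A T).card : ℝ)
  have hq : 0 ≤ q := Real.sqrt_nonneg _
  set X := ‖A - centerMatrix A T‖
  set B := 48 * √(k * numBad c A T)
  have hB : 0 ≤ B := by positivity
  have hX : 0 ≤ X := norm_nonneg _
  have hk : (0 : ℝ) ≤ c * k := by positivity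
  set p' := (sqrtSize T s)⁻¹ with hp'
  set q' := (sqrtSize T r)⁻¹ with hq'
  have h6 : 0 < p' := by positivity
  have h7 : 0 < q' := by positivity
  rcases hX.eq_or_lt with hX0 | hX0
  · have : q = 0 := by
      rw [← hX0] at h0
      nlinarith
    rw [this]; constructor <;> simp only [zero_mul] <;> positivity
  · have h8 : q * (separation c A T s r * separation c A T s r)
        ≤ 4 * X * (X * (a * p' + B * p' ^ 2) + X * (a * q' + B * q' ^ 2)) := by
      refine le_trans (mul_le_mul_of_nonneg_left (mul_le_mul_of_nonneg_right h2 hΔ) hq)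
        (h1.trans ?_)
      exact mul_le_mul_of_nonneg_left (add_le_add hs' hr') (by positivity)
    rw [hse] at h8
    have h9 : q * (c * k) ^ 2 * (p' + q') ^ 2 ≤ 4 * (a * (p' + q') + B * (p' + q') ^ 2) := by
      have : (q * (c * k) ^ 2 * (p' + q') ^ 2) * X ^ 2
          ≤ (4 * (a * (p' + q') + B * (p' ^ 2 + q' ^ 2))) * X ^ 2 := by linarith
      refine (le_of_mul_le_mul_right this (by positivity)).trans ?_
      have : 0 ≤ B * (p' * q') := by positivity
      linarith
    have h10 : q * (c * k) ^ 2 * (p' + q') ≤ 4 * (a + B * (p' + q')) := by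
      refine le_of_mul_le_mul_right ?_ (add_pos h6 h7)
      linarith
    have h11 : q * (c * k) ^ 2 ≤ 4 * (a * (p' + q')⁻¹ + B) := by
      have h12 : 0 < p' + q' := add_pos h6 h7
      have := mul_le_mul_of_nonneg_right h10 (inv_pos.2 h12).le
      have e : (p' + q') * (p' + q')⁻¹ = 1 := mul_inv_cancel₀ h12.ne'
      calc q * (c * k) ^ 2 = q * (c * k) ^ 2 * ((p' + q') * (p' + q')⁻¹) := by rw [e, mul_one]
        _ ≤ 4 * (a * (p' + q')⁻¹ + B * ((p' + q') * (p' + q')⁻¹)) := by linarith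
        _ = _ := by rw [e, mul_one]
    have h13 : (p' + q')⁻¹ ≤ sqrtSize T r :=
      inv_le_of_inv_le₀ hr (by rw [← hq']; linarith)
    have h14 : (p' + q')⁻¹ ≤ sqrtSize T s :=
      inv_le_of_inv_le₀ hs (by rw [← hp']; linarith)
    constructor
    · have := mul_le_mul_of_nonneg_left h13 ha
      linarith
    · have := mul_le_mul_of_nonneg_left h14 ha
      linarith

lemma sum_sqrt_le_sqrt {ι : Type*} (s : Finset ι) (f : ι → ℕ) {K N : ℕ} (hK : s.card ≤ K)
    (hN : ∑ i ∈ s, f i ≤ N) : ∑ i ∈ s, √(f i : ℝ) ≤ √(K * N : ℝ) := by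
  refine Real.le_sqrt_of_sq_le ?_
  refine sq_sum_le_card_mul_sum_sq.trans ?_
  have : ∑ i ∈ s, √(f i : ℝ) ^ 2 = ((∑ i ∈ s, f i : ℕ) : ℝ) := by
    push_cast
    exact Finset.sum_congr rfl fun i _ => Real.sq_sqrt (by positivity)
  rw [this]
  have h1 : ((∑ i ∈ s, f i : ℕ) : ℝ) ≤ N := by exact_mod_cast hN
  have h2 : (s.card : ℝ) ≤ K := by exact_mod_cast hK
  exact mul_le_mul h2 h1 (by positivity) (by positivity)

lemma sum_card_bad_le {ι : Type*} [DecidableEq ι] (s : Finset ι) (f : ι → Finset (Fin n))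
    (hf : ∀ i j, i ≠ j → Disjoint (f i) (f j)) :
    ∑ i ∈ s, (f i \ good c A T).card ≤ numBad c A T := by
  rw [← Finset.card_biUnion fun i _ j _ hij =>
    (hf i j hij).mono Finset.sdiff_subset Finset.sdiff_subset]
  refine Finset.card_le_card fun x hx => ?_
  simp only [Finset.mem_biUnion, Finset.mem_sdiff] at hx
  obtain ⟨_, _, _, h⟩ := hx
  simpa using h

lemma sqrt_card_le_good_add_bad (Y : Finset (Fin n)) :
    √(Y.card : ℝ) ≤ √((Y ∩ good c A T).card : ℝ) + √((Y \ good c A T).card : ℝ) := by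
  rw [← Finset.card_inter_add_card_sdiff Y (good c A T)]
  push_cast
  refine Real.sqrt_le_iff.2 ⟨by positivity, ?_⟩
  have h1 := Real.sq_sqrt (Nat.cast_nonneg (α := ℝ) (Y ∩ good c A T).card)
  have h2 := Real.sq_sqrt (Nat.cast_nonneg (α := ℝ) (Y \ good c A T).card)
  have h3 : 0 ≤ √((Y ∩ good c A T).card : ℝ) * √((Y \ good c A T).card : ℝ) := by positivity
  nlinarith

lemma half_le_card_part (hc : 40 ≤ c) (hT : IsClustering A T)
    (hsep : MeansSeparated c A T) (hν : InBasin c A T ν)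
    (hS : IsNearestAssignment (row A) ν S) (r : Fin k) :
    sqrtSize T r ^ 2 / 2 ≤ (part S r).card := by
  have hk : (1 : ℝ) ≤ k := by exact_mod_cast (Fin.pos r)
  have h1 : ((part T r).card : ℝ) = ∑ s, ((cell T S r s).card : ℝ) := by
    have := part_eq_biUnion_cell_right T S r (fun _ => 1)
    simp only [Finset.sum_const, smul_eq_mul, mul_one] at this
    exact_mod_cast this
  have hw := hT.sqrtSize_pos r
  rw [← Finset.add_sum_erase _ _ (Finset.mem_univ r)] at h1
  have h2 : ∀ s ∈ Finset.univ.erase r, ((cell T S r s).card : ℝ)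
      ≤ 25 * sqrtSize T r ^ 2 / (c * k) ^ 2 := by
    intro s hs
    have h3 := (sqrt_card_cell_le (by linarith) hT hsep hν hS
      (Finset.ne_of_mem_erase hs).symm).2
    rw [le_div_iff₀ (by positivity)]
    have h4 := pow_le_pow_left₀ (by positivity) h3 2
    rw [mul_pow, Real.sq_sqrt (by positivity)] at h4
    linarith
  have h3 := Finset.sum_le_sum h2
  rw [Finset.sum_const, Finset.card_erase_of_mem (Finset.mem_univ r), Finset.card_univ,
    Fintype.card_fin, nsmul_eq_mul] at h3
  have h4 : ((k - 1 : ℕ) : ℝ) * (25 * sqrtSize T r ^ 2 / (c * k) ^ 2) ≤ sqrtSize T r ^ 2 / 2 := by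
    have h5 : ((k - 1 : ℕ) : ℝ) ≤ k := by exact_mod_cast Nat.sub_le k 1
    refine (mul_le_mul_of_nonneg_right h5 (by positivity)).trans ?_
    rw [mul_div_assoc', div_le_div_iff₀ (by positivity) (by positivity)]
    have h6 : 50 * (k : ℝ) ≤ (c * k) ^ 2 := by
      have : (40 * (k : ℝ)) ^ 2 ≤ (c * k) ^ 2 :=
        pow_le_pow_left₀ (by positivity) (mul_le_mul_of_nonneg_right hc (by positivity)) 2
      nlinarith
    have h7 := mul_le_mul_of_nonneg_left h6 (sq_nonneg (sqrtSize T r))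
    linarith
  have h5 : ((cell T S r r).card : ℝ) ≤ (part S r).card := by
    exact_mod_cast Finset.card_le_card fun i hi => mem_part.2 (mem_cell.1 hi).2
  rw [← sqrtSize_sq] at h1
  linarith

lemma norm_recenter_sub_le (hc : 40 ≤ c) (hT : IsClustering A T)
    (hsep : MeansSeparated c A T) (hν : InBasin c A T ν)
    (hS : IsNearestAssignment (row A) ν S) (r : Fin k) :
    sqrtSize T r ^ 2 / 2 * ‖recenter (row A) ν S r - clusterMean A T r‖
      ≤ ‖A - centerMatrix A T‖ * ∑ s ∈ Finset.univ.erase r,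
        (√((cell T S r s).card : ℝ) + 6 * √((cell T S s r).card : ℝ)) := by
  have h1 := half_le_card_part hc hT hsep hν hS r
  have h2 := hT.sqrtSize_pos r
  have h3 : (part S r).Nonempty := by
    rw [← Finset.card_pos]
    have : (0 : ℝ) < (part S r).card := by
      refine lt_of_lt_of_le ?_ h1
      positivity
    exact_mod_cast this
  have h4 := norm_sum_part_sub_le hT (hν.centersClose (by linarith) hsep) hS r
  rw [← card_smul_mean_sub (row A) h3, norm_smul, Real.norm_of_nonneg (by positivity)] at h4
  refine le_trans ?_ h4
  unfold recenter
  rw [if_pos h3]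
  exact mul_le_mul_of_nonneg_right h1 (norm_nonneg _)

/-- The basin is invariant under Lloyd steps (only the separation of the means matters). -/
lemma InBasin.recenter (hc : 40 ≤ c) (hT : IsClustering A T)
    (hsep : MeansSeparated c A T) (hν : InBasin c A T ν)
    (hS : IsNearestAssignment (row A) ν S) : InBasin c A T (recenter (row A) ν S) := by
  intro r
  have h1 := norm_recenter_sub_le hc hT hsep hν hS r
  have hk : (1 : ℝ) ≤ k := by exact_mod_cast (Fin.pos r)
  have hw := hT.sqrtSize_pos r
  set X := ‖A - centerMatrix A T‖
  have hX : 0 ≤ X := norm_nonneg _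
  set w := sqrtSize T r
  have hck : 0 < c * k := by positivity
  have h2 : ∑ s ∈ Finset.univ.erase r,
        (√((cell T S r s).card : ℝ) + 6 * √((cell T S s r).card : ℝ)) ≤ k * (35 * w / (c * k)) := by
    have : ∀ s ∈ Finset.univ.erase r,
        (√((cell T S r s).card : ℝ) + 6 * √((cell T S s r).card : ℝ)) ≤ 35 * w / (c * k) := by
      intro s hs
      have hsr := Finset.ne_of_mem_erase hs
      have h3 := (sqrt_card_cell_le (by linarith) hT hsep hν hS hsr.symm).2
      have h4 := (sqrt_card_cell_le (by linarith) hT hsep hν hS hsr).1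
      rw [le_div_iff₀ hck]
      linarith
    refine (Finset.sum_le_card_nsmul _ _ _ this).trans ?_
    rw [nsmul_eq_mul]
    refine mul_le_mul_of_nonneg_right ?_ (by positivity)
    rw [Finset.card_erase_of_mem (Finset.mem_univ r), Finset.card_univ, Fintype.card_fin]
    exact_mod_cast Nat.sub_le k 1
  have h3 := h1.trans (mul_le_mul_of_nonneg_left h2 hX)
  rw [← div_eq_mul_inv, le_div_iff₀ hw]
  set e := ‖SpectralClustering.recenter (row A) ν S r - clusterMean A T r‖
  have h4 : e * w * (w * (c * k)) ≤ 70 * k * X * w := by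
    have : k * (35 * w / (c * k)) * (c * k) = k * (35 * w) := by field_simp
    have h5 := mul_le_mul_of_nonneg_right h3 hck.le
    rw [mul_assoc X, this] at h5
    linarith
  have h5 : e * w * (c * k) ≤ 70 * k * X := by
    refine le_of_mul_le_mul_right ?_ hw
    linarith
  have h6 : e * w * c ≤ 70 * X := by
    refine le_of_mul_le_mul_right ?_ (lt_of_lt_of_le one_pos hk)
    linarith
  have h7 : 70 * X ≤ (c * k / 16 * X) * c := by
    have : 70 ≤ c * k / 16 * c := by nlinarith
    nlinarith
  refine le_of_mul_le_mul_right (h6.trans h7) (by linarith)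

/-- A Lloyd step halves the transient part of the error. -/
lemma ErrorBound.recenter (hc : 40 ≤ c) {a : ℝ} (ha : 0 ≤ a) (hT : IsClustering A T)
    (hsep : MeansSeparated c A T) (hν : InBasin c A T ν) (hν' : ErrorBound c a A T ν)
    (hS : IsNearestAssignment (row A) ν S) :
    ErrorBound c (a / 2) A T (recenter (row A) ν S) := by
  intro r
  have h1 := norm_recenter_sub_le hc hT hsep hν hS r
  have hk : (1 : ℝ) ≤ k := by exact_mod_cast (Fin.pos r)
  have hw := hT.sqrtSize_pos r
  set X := ‖A - centerMatrix A T‖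
  have hX : 0 ≤ X := norm_nonneg _
  set w := sqrtSize T r
  set u := √(k * numBad c A T : ℝ)
  have hu : 0 ≤ u := Real.sqrt_nonneg _
  have hck : 0 < c * k := by positivity
  have hcard : (Finset.univ.erase r).card ≤ k := by
    rw [Finset.card_erase_of_mem (Finset.mem_univ r), Finset.card_univ, Fintype.card_fin]
    exact Nat.sub_le k 1
  have b1 : ∑ s ∈ Finset.univ.erase r, √((cell T S r s \ good c A T).card : ℝ) ≤ u :=
    sum_sqrt_le_sqrt _ _ hcard (sum_card_bad_le _ (fun s => cell T S r s) fun i j hij =>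
      Finset.disjoint_left.2 fun x hx hy => hij ((mem_cell.1 hx).2.symm.trans (mem_cell.1 hy).2))
  have b2 : ∑ s ∈ Finset.univ.erase r, √((cell T S s r \ good c A T).card : ℝ) ≤ u :=
    sum_sqrt_le_sqrt _ _ hcard (sum_card_bad_le _ (fun s => cell T S s r) fun i j hij =>
      Finset.disjoint_left.2 fun x hx hy => hij ((mem_cell.1 hx).1.symm.trans (mem_cell.1 hy).1))
  set M := 4 * (a * w + 48 * u) / (c * k) ^ 2 with hM
  have hM0 : 0 ≤ M := by positivity
  have g1 : ∀ s ∈ Finset.univ.erase r, √((cell T S r s ∩ good c A T).card : ℝ) ≤ M := by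
    intro s hs
    rw [le_div_iff₀ (by positivity)]
    exact (sqrt_card_good_le (by linarith) ha hT hsep hν hν' hS
      (Finset.ne_of_mem_erase hs).symm).2
  have g2 : ∀ s ∈ Finset.univ.erase r, √((cell T S s r ∩ good c A T).card : ℝ) ≤ M := by
    intro s hs
    rw [le_div_iff₀ (by positivity)]
    exact (sqrt_card_good_le (by linarith) ha hT hsep hν hν' hS
      (Finset.ne_of_mem_erase hs)).1
  have h2 : ∑ s ∈ Finset.univ.erase r,
        (√((cell T S r s).card : ℝ) + 6 * √((cell T S s r).card : ℝ))
      ≤ 6 * (k * (2 * M) + 2 * u) := by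
    have : ∀ s ∈ Finset.univ.erase r,
        (√((cell T S r s).card : ℝ) + 6 * √((cell T S s r).card : ℝ)) ≤ 6 * (2 * M)
          + 6 * (√((cell T S r s \ good c A T).card : ℝ)
            + √((cell T S s r \ good c A T).card : ℝ)) := by
      intro s hs
      have h3 := sqrt_card_le_good_add_bad (c := c) (A := A) (T := T) (cell T S r s)
      have h4 := sqrt_card_le_good_add_bad (c := c) (A := A) (T := T) (cell T S s r)
      have h5 := g1 s hs
      have h6 := g2 s hs
      have h7 : 0 ≤ √((cell T S r s).card : ℝ) := Real.sqrt_nonneg _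
      linarith
    refine (Finset.sum_le_sum this).trans ?_
    rw [Finset.sum_add_distrib, Finset.sum_const, nsmul_eq_mul, ← Finset.mul_sum,
      Finset.sum_add_distrib]
    have h8 : ((Finset.univ.erase r).card : ℝ) * (6 * (2 * M)) ≤ k * (6 * (2 * M)) :=
      mul_le_mul_of_nonneg_right (by exact_mod_cast hcard) (by positivity)
    linarith
  have h3 := h1.trans (mul_le_mul_of_nonneg_left h2 hX)
  set e := ‖SpectralClustering.recenter (row A) ν S r - clusterMean A T r‖
  have h4 : k * M ≤ (a * w + 48 * u) / 400 := by
    rw [hM, mul_div_assoc', div_le_div_iff₀ (by positivity) (by positivity)]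
    have h5 : 1600 * (k : ℝ) ≤ (c * k) ^ 2 := by
      have : (40 * (k : ℝ)) ^ 2 ≤ (c * k) ^ 2 :=
        pow_le_pow_left₀ (by positivity) (mul_le_mul_of_nonneg_right hc (by positivity)) 2
      nlinarith
    have h6 : 0 ≤ a * w + 48 * u := by positivity
    nlinarith
  have h5 : w ^ 2 * e ≤ X * (a / 2 * w + 48 * u) := by
    have h6 : 12 * (k * (2 * M) + 2 * u) ≤ a / 2 * w + 48 * u := by
      have : 0 ≤ a * w := by positivity
      linarith
    have := mul_le_mul_of_nonneg_left h6 hX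
    linarith
  have h6 : X * (a / 2 * w⁻¹ + 48 * u * w⁻¹ ^ 2) = X * (a / 2 * w + 48 * u) / w ^ 2 := by
    field_simp
  rw [h6, le_div_iff₀ (by positivity)]
  linarith

end Step

/-- The number of misclassified good points after an assignment to centers with transient error
`a`. -/
lemma card_misclassified_le {A : Matrix (Fin n) (Fin d) ℝ} {T S : Fin n → Fin k} {ν : Fin k → Pt d}
    {c : ℝ} (hc : 40 ≤ c) {a : ℝ} (ha : 0 ≤ a) (hT : IsClustering A T)
    (hsep : MeansSeparated c A T) (hν : InBasin c A T ν) (hν' : ErrorBound c a A T ν)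
    (hS : IsNearestAssignment (row A) ν S) (haℓ : a ^ 2 * n ≤ (c * k) ^ 2 / 256) :
    (Finset.univ.filter fun i => T i ≠ S i).card ≤ 2 * numBad c A T := by
  rcases Nat.eq_zero_or_pos k with hk0 | hk0
  · subst hk0
    have : n = 0 := by
      by_contra h
      exact (T ⟨0, Nat.pos_of_ne_zero h⟩).elim0
    subst this
    simp
  have hk : (1 : ℝ) ≤ k := by exact_mod_cast hk0
  have hck : 0 < c * k := by positivity
  set W := Finset.univ.filter fun i => T i ≠ S i with hW
  set b := numBad c A T with hb
  have h1 : (W \ good c A T).card ≤ b := by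
    refine Finset.card_le_card fun x hx => ?_
    simp only [Finset.mem_sdiff] at hx
    simpa using hx.2
  have h2 : ((W ∩ good c A T).card : ℝ)
      = ∑ s, ∑ r ∈ Finset.univ.erase s, ((cell T S s r ∩ good c A T).card : ℝ) := by
    have : (W ∩ good c A T).card
        = ∑ s, ∑ r ∈ Finset.univ.erase s, (cell T S s r ∩ good c A T).card := by
      rw [Finset.card_eq_sum_card_fiberwise (f := T) (t := Finset.univ) (by simp)]
      refine Finset.sum_congr rfl fun s _ => ?_
      rw [Finset.card_eq_sum_card_fiberwise (f := S) (t := Finset.univ.erase s)]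
      · refine Finset.sum_congr rfl fun r hr => ?_
        congr 1
        ext i
        have := Finset.ne_of_mem_erase hr
        simp only [Finset.mem_filter, Finset.mem_inter, hW, mem_cell, Finset.mem_univ, true_and]
        constructor
        · rintro ⟨⟨⟨_, h⟩, h'⟩, h''⟩; exact ⟨⟨h', h''⟩, h⟩
        · rintro ⟨⟨h, h'⟩, h''⟩
          exact ⟨⟨⟨by rw [h, h']; exact this.symm, h''⟩, h⟩, h'⟩
      · intro i hi
        simp only [Finset.coe_filter, Set.mem_ofPred_eq, Finset.mem_inter, hW, Finset.mem_filter,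
          Finset.mem_univ, true_and] at hi
        simp only [Finset.coe_erase, Set.mem_sdiff, Set.mem_singleton_iff, Finset.mem_coe,
          Finset.mem_univ, true_and]
        intro h
        exact hi.1.1 (by rw [hi.2, h])
    exact_mod_cast this
  have h3 : ∀ s, ∀ r ∈ Finset.univ.erase s, ((cell T S s r ∩ good c A T).card : ℝ)
      ≤ 32 * (a ^ 2 * (part T s).card + 2304 * (k * b)) / (c * k) ^ 4 := by
    intro s r hr
    have h4 := (sqrt_card_good_le (by linarith) ha hT hsep hν hν' hS
      (Finset.ne_of_mem_erase hr).symm).2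
    rw [le_div_iff₀ (by positivity)]
    have h5 := pow_le_pow_left₀ (by positivity) h4 2
    rw [mul_pow, Real.sq_sqrt (by positivity)] at h5
    have h6 : √(k * b : ℝ) ^ 2 = k * b := Real.sq_sqrt (by positivity)
    rw [← hb] at h5
    rw [← sqrtSize_sq, ← h6]
    nlinarith [sq_nonneg (a * sqrtSize T s - 48 * √(k * b : ℝ))]
  have hsum : ∑ s, ((part T s).card : ℝ) = n := by
    have : ∑ s, (part T s).card = n := by
      have := Finset.card_eq_sum_card_fiberwise (f := T) (s := Finset.univ) (t := Finset.univ)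
        (by simp)
      rw [Finset.card_univ, Fintype.card_fin] at this
      exact this.symm
    exact_mod_cast this
  have h4 : ((W ∩ good c A T).card : ℝ)
      ≤ k * (32 * (a ^ 2 * n + k * (2304 * (k * b))) / (c * k) ^ 4) := by
    rw [h2]
    have h5 : ∀ s ∈ Finset.univ, ∑ r ∈ Finset.univ.erase s,
        ((cell T S s r ∩ good c A T).card : ℝ)
        ≤ k * (32 * (a ^ 2 * (part T s).card + 2304 * (k * b)) / (c * k) ^ 4) := by
      intro s _
      refine (Finset.sum_le_card_nsmul _ _ _ (h3 s)).trans ?_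
      rw [nsmul_eq_mul]
      refine mul_le_mul_of_nonneg_right ?_ (by positivity)
      rw [Finset.card_erase_of_mem (Finset.mem_univ s), Finset.card_univ, Fintype.card_fin]
      exact_mod_cast Nat.sub_le k 1
    refine (Finset.sum_le_sum h5).trans (le_of_eq ?_)
    rw [← Finset.mul_sum, ← Finset.sum_div, ← Finset.mul_sum, Finset.sum_add_distrib,
      ← Finset.mul_sum, hsum, Finset.sum_const, Finset.card_univ, Fintype.card_fin, nsmul_eq_mul]
  have h5 : k * (32 * (a ^ 2 * n + k * (2304 * (k * b))) / (c * k) ^ 4) ≤ 1 / 8 + (b : ℝ) / 2 := by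
    rw [mul_div_assoc', div_le_iff₀ (by positivity)]
    have h6 : 1600 * (k : ℝ) ^ 2 ≤ (c * k) ^ 2 := by
      have := pow_le_pow_left₀ (by positivity)
        (mul_le_mul_of_nonneg_right hc (by positivity : (0 : ℝ) ≤ k)) 2
      linarith
    set y := (c * k) ^ 2
    have e : (c * k) ^ 4 = y ^ 2 := by ring
    rw [e]
    have hy : 0 < y := by positivity
    have h7 : (k : ℝ) ≤ k ^ 2 := by nlinarith
    have h8 : (k : ℝ) * (a ^ 2 * n) ≤ y / 1600 * (y / 256) :=
      mul_le_mul (by linarith) haℓ (by positivity) (by positivity)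
    have h9 : (k : ℝ) ^ 3 ≤ (k ^ 2) ^ 2 := by
      have : (k : ℝ) ^ 2 * k ≤ k ^ 2 * k ^ 2 := mul_le_mul_of_nonneg_left h7 (by positivity)
      linarith
    have h10 : (1600 * (k : ℝ) ^ 2) ^ 2 ≤ y ^ 2 := pow_le_pow_left₀ (by positivity) h6 2
    have h11 : (k : ℝ) ^ 3 * b ≤ y ^ 2 / 2560000 * b :=
      mul_le_mul_of_nonneg_right (by linarith) (by positivity)
    have h12 : 0 ≤ y ^ 2 * (b : ℝ) := by positivity
    have h13 : 0 ≤ y ^ 2 := by positivity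
    linarith
  have h6 : (W ∩ good c A T).card ≤ b := by
    have h7 := h4.trans h5
    rcases Nat.eq_zero_or_pos b with h0 | h0
    · rw [h0] at h7 ⊢
      have : ((W ∩ good c A T).card : ℝ) < 1 := by
        refine h7.trans_lt ?_; norm_num
      have : (W ∩ good c A T).card < 1 := by exact_mod_cast this
      omega
    · have h1b : (1 : ℝ) ≤ b := by exact_mod_cast h0
      have : ((W ∩ good c A T).card : ℝ) ≤ b := by linarith
      exact_mod_cast this
  have := Finset.card_inter_add_card_sdiff W (good c A T)
  omega

/-- Starting in the basin, logarithmically many Lloyd steps leave at most twice as many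
misclassified points as there are bad points. -/
theorem card_misclassified_lloyd_le {A : Matrix (Fin n) (Fin d) ℝ} {T : Fin n → Fin k} {c : ℝ}
    (hc : 40 ≤ c) (hT : IsClustering A T) (hsep : MeansSeparated c A T)
    (ν : ℕ → Fin k → Pt d) (S : ℕ → Fin n → Fin k) {ℓ : ℕ} (hℓ : (n : ℝ) ≤ 4 ^ ℓ)
    (h0 : InBasin c A T (ν 0)) (hS : ∀ t ≤ ℓ, IsNearestAssignment (row A) (ν t) (S t))
    (hν : ∀ t < ℓ, ν (t + 1) = recenter (row A) (ν t) (S t)) :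
    (Finset.univ.filter fun i => T i ≠ S ℓ i).card ≤ 2 * numBad c A T := by
  have hck : 0 ≤ c * k := by positivity
  have key : ∀ t ≤ ℓ, InBasin c A T (ν t) ∧ ErrorBound c (c * k / 16 / 2 ^ t) A T (ν t) := by
    intro t
    induction t with
    | zero =>
      refine fun _ => ⟨h0, fun r => (h0 r).trans ?_⟩
      have h1 := hT.sqrtSize_pos r
      have : 0 ≤ ‖A - centerMatrix A T‖
          * (48 * √(k * numBad c A T) * ((sqrtSize T r)⁻¹) ^ 2) := by positivity
      rw [pow_zero, div_one]
      linarith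
    | succ t ih =>
      intro ht
      obtain ⟨h1, h2⟩ := ih (by omega)
      rw [hν t (by omega)]
      refine ⟨h1.recenter hc hT hsep (hS t (by omega)), ?_⟩
      have := h2.recenter hc (by positivity) hT hsep h1 (hS t (by omega))
      rwa [div_div _ _ (2 : ℝ), ← pow_succ] at this
  obtain ⟨h1, h2⟩ := key ℓ le_rfl
  refine card_misclassified_le hc (by positivity) hT hsep h1 h2 (hS ℓ le_rfl) ?_
  have e : (c * k / 16 / 2 ^ ℓ) ^ 2 * n = (c * k) ^ 2 / 256 * (n / 4 ^ ℓ) := by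
    rw [div_pow, div_pow, ← pow_mul, mul_comm ℓ, pow_mul]; norm_num; ring
  rw [e]
  refine mul_le_of_le_one_right (by positivity) ?_
  rw [div_le_one (by positivity)]
  exact hℓ

/-! ### Singular subspaces and residuals -/

/-- Among `k + 1` vectors and for a subspace of dimension at most `k` there is a nontrivial
combination of the vectors that is orthogonal to the subspace. -/
lemma exists_combination_mem_orthogonal {m : ℕ} (u : Fin m → Pt d) (W : Submodule ℝ (Pt d))
    (hW : Module.finrank ℝ W < m) :
    ∃ a : Fin m → ℝ, a ≠ 0 ∧ ∑ i, a i • u i ∈ Wᗮ := by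
  let f : (Fin m → ℝ) →ₗ[ℝ] W :=
    W.orthogonalProjectionOnto.toLinearMap ∘ₗ Fintype.linearCombination ℝ u
  have h : LinearMap.ker f ≠ ⊥ := LinearMap.ker_ne_bot_of_finrank_lt (by simpa using hW)
  obtain ⟨a, ha, ha0⟩ := (Submodule.ne_bot_iff _).1 h
  refine ⟨a, ha0, ?_⟩
  rw [← Submodule.orthogonalProjectionOnto_eq_zero_iff]
  have : f a = 0 := ha
  simpa [f, Fintype.linearCombination_apply] using this

lemma toEuclideanLin_sub_projPts (A : Matrix (Fin n) (Fin d) ℝ) (V : Submodule ℝ (Pt d))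
    (x : Pt d) : Matrix.toEuclideanLin (A - ofRows (projPts A V)) x
      = Matrix.toEuclideanLin A (x - V.starProjection x) := by
  ext i
  rw [toEuclideanLin_apply_eq_inner, toEuclideanLin_apply_eq_inner, row_sub, row_ofRows, projPts,
    inner_sub_left, inner_sub_right, Submodule.inner_starProjection_left_eq_right]

lemma norm_sub_projPts_le (A : Matrix (Fin n) (Fin d) ℝ) (V : Submodule ℝ (Pt d)) {t : ℝ}
    (ht : 0 ≤ t) (h : ∀ x ∈ Vᗮ, ‖Matrix.toEuclideanLin A x‖ ≤ t * ‖x‖) :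
    ‖A - ofRows (projPts A V)‖ ≤ t := by
  refine norm_le_of_toEuclideanLin_le _ ht fun x => ?_
  rw [toEuclideanLin_sub_projPts]
  refine (h _ (V.sub_starProjection_mem_orthogonal x)).trans (mul_le_mul_of_nonneg_left ?_ ht)
  have e : x - V.starProjection x = Vᗮ.starProjection x := by
    rw [Submodule.starProjection_orthogonal']; rfl
  rw [e]
  exact Submodule.norm_starProjection_apply_le _ _

lemma norm_toEuclideanLin_sq_eq_inner (A : Matrix (Fin n) (Fin d) ℝ) (x : Pt d) :
    ‖Matrix.toEuclideanLin A x‖ ^ 2 = inner ℝ x (Matrix.toEuclideanLin (Aᵀ * A) x) := by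
  rw [← real_inner_self_eq_norm_sq]
  simp only [Matrix.toLpLin_apply, EuclideanSpace.inner_eq_star_dotProduct, star_trivial,
    ← Matrix.mulVec_mulVec]
  rw [Matrix.mulVec_transpose, ← Matrix.dotProduct_mulVec]

/-- An orthonormal basis of right singular vectors with the singular values in decreasing order. -/
structure IsSingularBasis (A : Matrix (Fin n) (Fin d) ℝ) (v : OrthonormalBasis (Fin d) ℝ (Pt d))
    (σ : Fin d → ℝ) : Prop where
  antitone : Antitone σ
  nonneg : ∀ j, 0 ≤ σ j
  apply_eq : ∀ j, Matrix.toEuclideanLin (Aᵀ * A) (v j) = (σ j) ^ 2 • v j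

lemma exists_isSingularBasis (A : Matrix (Fin n) (Fin d) ℝ) :
    ∃ v σ, IsSingularBasis A v σ := by
  have hs : (Matrix.toEuclideanLin (Aᵀ * A)).IsSymmetric :=
    Matrix.isSymmetric_toEuclideanLin_iff.2 (by
      rw [← Matrix.conjTranspose_eq_transpose_of_trivial]
      exact Matrix.isHermitian_conjTranspose_mul_self A)
  have hn : Module.finrank ℝ (Pt d) = d := by simp
  have hpos : ∀ j, 0 ≤ hs.eigenvalues hn j := by
    intro j
    have h1 := norm_toEuclideanLin_sq_eq_inner A (hs.eigenvectorBasis hn j)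
    rw [hs.apply_eigenvectorBasis hn j] at h1
    have h2 : inner ℝ (hs.eigenvectorBasis hn j)
        ((hs.eigenvalues hn j : ℝ) • hs.eigenvectorBasis hn j) = hs.eigenvalues hn j := by
      rw [real_inner_smul_right, real_inner_self_eq_norm_sq, OrthonormalBasis.norm_eq_one]; simp
    have h3 : 0 ≤ ‖Matrix.toEuclideanLin A (hs.eigenvectorBasis hn j)‖ ^ 2 := sq_nonneg _
    rw [h1] at h3
    exact h2 ▸ h3
  refine ⟨hs.eigenvectorBasis hn, fun j => √(hs.eigenvalues hn j), fun i j hij =>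
    Real.sqrt_le_sqrt (hs.eigenvalues_antitone hn hij), fun j => Real.sqrt_nonneg _, fun j => ?_⟩
  rw [hs.apply_eigenvectorBasis hn j, Real.sq_sqrt (hpos j)]
  rfl

/-- The span of the first `k` vectors of a basis. -/
def topSpan (k : ℕ) (v : OrthonormalBasis (Fin d) ℝ (Pt d)) : Submodule ℝ (Pt d) :=
  Submodule.span ℝ (v '' {j | (j : ℕ) < k})

lemma finrank_topSpan_le (k : ℕ) (v : OrthonormalBasis (Fin d) ℝ (Pt d)) :
    Module.finrank ℝ (topSpan k v) ≤ k := by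
  classical
  have h1 : v '' {j | (j : ℕ) < k} =
      ((Finset.univ.filter fun j : Fin d => (j : ℕ) < k).image v : Finset (Pt d)) := by
    simp
  rw [topSpan, h1]
  refine (finrank_span_finset_le_card _).trans (Finset.card_image_le.trans ?_)
  have : ((Finset.univ.filter fun j : Fin d => (j : ℕ) < k).map Fin.valEmbedding).card
      ≤ (Finset.range k).card := Finset.card_le_card fun x hx => by
    simp only [Finset.mem_map, Finset.mem_filter, Finset.mem_univ, true_and] at hx
    obtain ⟨a, ha, rfl⟩ := hx
    simpa using ha
  simpa using this

lemma isTopSingularSubspace_iff {A : Matrix (Fin n) (Fin d) ℝ} {V : Submodule ℝ (Pt d)} :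
    IsTopSingularSubspace k A V ↔ ∃ v σ, IsSingularBasis A v σ ∧ V = topSpan k v :=
  ⟨fun ⟨v, σ, h1, h2, h3, h4⟩ => ⟨v, σ, ⟨h1, h2, h3⟩, h4⟩,
    fun ⟨v, σ, h, h4⟩ => ⟨v, σ, h.antitone, h.nonneg, h.apply_eq, h4⟩⟩

namespace IsSingularBasis

variable {A : Matrix (Fin n) (Fin d) ℝ} {v : OrthonormalBasis (Fin d) ℝ (Pt d)} {σ : Fin d → ℝ}

lemma norm_sq_eq (h : IsSingularBasis A v σ) (x : Pt d) :
    ‖Matrix.toEuclideanLin A x‖ ^ 2 = ∑ j, σ j ^ 2 * (inner ℝ (v j) x) ^ 2 := by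
  rw [norm_toEuclideanLin_sq_eq_inner]
  conv_lhs => rw [← v.sum_repr x]
  rw [map_sum, ← v.sum_inner_mul_inner]
  refine Finset.sum_congr rfl fun j _ => ?_
  simp only [map_smul, h.apply_eq, v.repr_apply_apply]
  have hrepr : ∑ i, inner ℝ (v i) x • v i = x := v.sum_repr' x
  rw [hrepr, inner_sum]
  simp only [real_inner_smul_right, v.inner_eq_ite]
  simp only [mul_ite, mul_one, mul_zero, Finset.sum_ite_eq, Finset.mem_univ, if_true]
  rw [real_inner_comm]; ring

/-- The residual of the top singular subspace is at most the next singular value. -/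
lemma norm_residual_le (h : IsSingularBasis A v σ) {t : ℝ} (ht : 0 ≤ t)
    (hσ : ∀ j : Fin d, k ≤ (j : ℕ) → σ j ≤ t) :
    ‖A - ofRows (projPts A (topSpan k v))‖ ≤ t := by
  refine norm_sub_projPts_le _ _ ht fun x hx => ?_
  rw [← pow_le_pow_iff_left₀ (norm_nonneg _) (by positivity) two_ne_zero, h.norm_sq_eq, mul_pow,
    ← v.sum_sq_norm_inner_right x, Finset.mul_sum]
  refine Finset.sum_le_sum fun j _ => ?_
  rw [Real.norm_eq_abs, sq_abs]
  by_cases hj : (j : ℕ) < k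
  · have : inner ℝ (v j) x = 0 :=
      (Submodule.mem_orthogonal _ _).1 hx _ (Submodule.subset_span ⟨j, hj, rfl⟩)
    rw [this]; simp
  · exact mul_le_mul_of_nonneg_right (pow_le_pow_left₀ (h.nonneg j) (hσ j (by omega)) 2)
      (sq_nonneg _)

/-- No matrix with rows in a `k`-dimensional subspace approximates better than the next singular
value. -/
lemma le_norm_sub (h : IsSingularBasis A v σ) (C : Matrix (Fin n) (Fin d) ℝ)
    (W : Submodule ℝ (Pt d)) (hW : Module.finrank ℝ W ≤ k) (hC : ∀ i, row C i ∈ W) (j : Fin d)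
    (hj : k ≤ (j : ℕ)) : σ j ≤ ‖A - C‖ := by
  let ι : Fin (k + 1) → Fin d := fun i => ⟨i, by omega⟩
  have hι : Function.Injective ι := fun i i' hii => by
    simpa [ι, Fin.ext_iff] using hii
  obtain ⟨a, ha0, ha⟩ := exists_combination_mem_orthogonal (fun i => v (ι i)) W (by omega)
  set x := ∑ i, a i • v (ι i) with hx
  have hin : ∀ i, inner ℝ (v (ι i)) x = a i := fun i => by
    rw [hx, inner_sum]
    simp [real_inner_smul_right, v.inner_eq_ite, hι.eq_iff]
  have hx0 : 0 < ‖x‖ := by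
    refine norm_pos_iff.2 fun hx0 => ha0 (funext fun i => ?_)
    rw [← hin i, hx0]; simp
  have hzero : ∀ l : Fin d, k < (l : ℕ) → inner ℝ (v l) x = 0 := fun l hl => by
    rw [hx, inner_sum]
    refine Finset.sum_eq_zero fun i _ => ?_
    rw [real_inner_smul_right, v.inner_eq_ite, if_neg, mul_zero]
    intro e
    have := congrArg Fin.val e
    simp only [ι] at this
    omega
  have h1 : Matrix.toEuclideanLin (A - C) x = Matrix.toEuclideanLin A x := by
    ext i
    rw [toEuclideanLin_apply_eq_inner, toEuclideanLin_apply_eq_inner, row_sub, inner_sub_left,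
      (Submodule.mem_orthogonal _ _).1 ha _ (hC i), sub_zero]
  have h2 : σ j * ‖x‖ ≤ ‖Matrix.toEuclideanLin A x‖ := by
    rw [← pow_le_pow_iff_left₀ (mul_nonneg (h.nonneg j) (norm_nonneg _)) (norm_nonneg _)
      two_ne_zero, h.norm_sq_eq, mul_pow, ← v.sum_sq_norm_inner_right x, Finset.mul_sum]
    refine Finset.sum_le_sum fun l _ => ?_
    rw [Real.norm_eq_abs, sq_abs]
    by_cases hl : k < (l : ℕ)
    · rw [hzero l hl]; simp
    · exact mul_le_mul_of_nonneg_right (pow_le_pow_left₀ (h.nonneg j)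
        (h.antitone (Fin.le_def.2 (by omega))) 2) (sq_nonneg _)
  rw [← h1] at h2
  exact le_of_mul_le_mul_right (h2.trans (norm_toEuclideanLin_le _ x)) hx0

end IsSingularBasis

lemma finrank_span_clusterMean_le (A : Matrix (Fin n) (Fin d) ℝ) (T : Fin n → Fin k) :
    Module.finrank ℝ (Submodule.span ℝ (Set.range (clusterMean A T))) ≤ k := by
  have := finrank_range_le_card (R := ℝ) (clusterMean A T)
  rwa [Fintype.card_fin] at this

lemma row_centerMatrix_mem_span (A : Matrix (Fin n) (Fin d) ℝ) (T : Fin n → Fin k) (i : Fin n) :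
    row (centerMatrix A T) i ∈ Submodule.span ℝ (Set.range (clusterMean A T)) :=
  Submodule.subset_span ⟨T i, rfl⟩

lemma IsTopSingularSubspace.norm_residual_le {A : Matrix (Fin n) (Fin d) ℝ}
    {V : Submodule ℝ (Pt d)} (h : IsTopSingularSubspace k A V) (T : Fin n → Fin k) :
    ‖A - ofRows (projPts A V)‖ ≤ ‖A - centerMatrix A T‖ := by
  obtain ⟨v, σ, h', rfl⟩ := isTopSingularSubspace_iff.1 h
  exact h'.norm_residual_le (norm_nonneg _) fun j hj => h'.le_norm_sub _ _
    (finrank_span_clusterMean_le A T) (row_centerMatrix_mem_span A T) j hj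

lemma IsTopSingularSubspace.isNearTopSubspace {A : Matrix (Fin n) (Fin d) ℝ}
    {V : Submodule ℝ (Pt d)} (h : IsTopSingularSubspace k A V) : IsNearTopSubspace 1 k A V := by
  refine ⟨?_, V, h, by simp⟩
  obtain ⟨v, σ, h, rfl⟩ := isTopSingularSubspace_iff.1 h
  exact finrank_topSpan_le k v

/-! ### The initial centers -/

/-- A matrix of low rank has small Frobenius norm in terms of its spectral norm. -/
lemma sum_norm_row_sq_le (M : Matrix (Fin n) (Fin d) ℝ) (W : Submodule ℝ (Pt d))
    (hM : ∀ i, row M i ∈ W) : ∑ i, ‖row M i‖ ^ 2 ≤ Module.finrank ℝ W * ‖M‖ ^ 2 := by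
  let b := stdOrthonormalBasis ℝ W
  have h1 : ∀ i, ‖row M i‖ ^ 2 = ∑ j, (inner ℝ (row M i) (b j : Pt d)) ^ 2 := by
    intro i
    have := b.sum_sq_norm_inner_left ⟨row M i, hM i⟩
    simp only [Real.norm_eq_abs, sq_abs, Submodule.coe_inner, Submodule.coe_norm] at this
    exact this.symm
  simp only [h1]
  rw [Finset.sum_comm]
  have h2 : ∀ j ∈ Finset.univ, ∑ i, (inner ℝ (row M i) (b j : Pt d)) ^ 2 ≤ ‖M‖ ^ 2 := by
    intro j _
    have h3 := sum_inner_row_sq_le M (b j)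
    have h4 : ‖(b j : Pt d)‖ = 1 := b.norm_eq_one j
    rwa [h4, one_pow, mul_one] at h3
  refine (Finset.sum_le_card_nsmul _ _ _ h2).trans (le_of_eq ?_)
  simp

lemma kmeansCost_le_sum (p : Fin n → Pt d) (ν : Fin k → Pt d) (T : Fin n → Fin k) :
    kmeansCost p ν ≤ ∑ i, ‖p i - ν (T i)‖ ^ 2 :=
  Finset.sum_le_sum fun i _ => ciInf_le (Set.finite_range _).bddBelow (T i)

/-- The projected points have small `k`-means cost with respect to the cluster means. -/
lemma sum_norm_projPts_sub_le {θ : ℝ} {A : Matrix (Fin n) (Fin d) ℝ}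
    {V : Submodule ℝ (Pt d)} (hV : IsNearTopSubspace θ k A V) (hθ : 0 ≤ θ) (T : Fin n → Fin k) :
    ∑ i, ‖projPts A V i - clusterMean A T (T i)‖ ^ 2
      ≤ 2 * k * ((θ + 1) * ‖A - centerMatrix A T‖) ^ 2 := by
  obtain ⟨hk, V', hV', hle⟩ := hV
  set X := ‖A - centerMatrix A T‖
  have h1 : ‖ofRows (projPts A V) - centerMatrix A T‖ ≤ (θ + 1) * X := by
    have e : ofRows (projPts A V) - centerMatrix A T
        = (A - centerMatrix A T) - (A - ofRows (projPts A V)) := by abel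
    rw [e]
    have h2 := norm_sub_le (A - centerMatrix A T) (A - ofRows (projPts A V))
    have h3 := mul_le_mul_of_nonneg_left (hV'.norm_residual_le T) hθ
    linarith
  have h2 := sum_norm_row_sq_le (ofRows (projPts A V) - centerMatrix A T)
    (V ⊔ Submodule.span ℝ (Set.range (clusterMean A T))) (fun i => by
      rw [row_sub, row_ofRows]
      exact sub_mem (Submodule.mem_sup_left (Submodule.starProjection_apply_mem _ _))
        (Submodule.mem_sup_right (row_centerMatrix_mem_span A T i)))
  have h3 : (Module.finrank ℝ
      ↥(V ⊔ Submodule.span ℝ (Set.range (clusterMean A T))) : ℝ) ≤ 2 * k := by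
    have h4 := Submodule.finrank_add_le_finrank_add_finrank V
      (Submodule.span ℝ (Set.range (clusterMean A T)))
    have h5 := finrank_span_clusterMean_le A T
    have : Module.finrank ℝ ↥(V ⊔ Submodule.span ℝ (Set.range (clusterMean A T))) ≤ 2 * k := by
      omega
    exact_mod_cast this
  refine le_trans h2 (mul_le_mul h3 (pow_le_pow_left₀ (norm_nonneg _) h1 2) (by positivity)
    (by positivity))

/-- Every cluster mean has an initial center close to it: otherwise its cluster alone would cost
more than the approximation allows. -/
lemma exists_center_near {θ φ : ℝ} (hθ : 1 ≤ θ) (hφ : 1 ≤ φ) {A : Matrix (Fin n) (Fin d) ℝ}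
    {V : Submodule ℝ (Pt d)} (hV : IsNearTopSubspace θ k A V) {T : Fin n → Fin k}
    (hT : IsClustering A T) {ν : Fin k → Pt d} (hν : IsApproxKMeans φ (projPts A V) ν)
    (r : Fin k) :
    ∃ j, ‖ν j - clusterMean A T r‖
      ≤ 2 * (θ + 1) * √(φ + 1) * √k * ‖A - centerMatrix A T‖ * (sqrtSize T r)⁻¹ := by
  by_contra! hcon
  set X := ‖A - centerMatrix A T‖
  have hX : 0 ≤ X := norm_nonneg _
  have hw := hT.sqrtSize_pos r
  set D := 2 * (θ + 1) * √(φ + 1) * √k * X * (sqrtSize T r)⁻¹ with hD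
  have hD0 : 0 ≤ D := by positivity
  set F := ∑ i, ‖projPts A V i - clusterMean A T (T i)‖ ^ 2 with hF
  have h1 : kmeansCost (projPts A V) ν ≤ φ * F :=
    (hν (clusterMean A T)).trans
      (mul_le_mul_of_nonneg_left (kmeansCost_le_sum _ _ T) (by linarith))
  have hne : Nonempty (Fin k) := ⟨r⟩
  have h2 : ∀ i ∈ part T r, D ^ 2 / 2 < (⨅ j, ‖projPts A V i - ν j‖ ^ 2)
      + ‖projPts A V i - clusterMean A T (T i)‖ ^ 2 := by
    intro i hi
    rw [mem_part.1 hi]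
    obtain ⟨j, hj⟩ := exists_eq_ciInf_of_finite (f := fun j => ‖projPts A V i - ν j‖ ^ 2)
    rw [← hj]
    have h3 := pow_lt_pow_left₀ (hcon j) hD0 two_ne_zero
    have e : ν j - clusterMean A T r
        = (projPts A V i - clusterMean A T r) - (projPts A V i - ν j) := by abel
    rw [e] at h3
    have h4 := parallelogram_law_with_norm ℝ (projPts A V i - clusterMean A T r)
      (projPts A V i - ν j)
    have h5 : 0 ≤ ‖(projPts A V i - clusterMean A T r) + (projPts A V i - ν j)‖ ^ 2 := sq_nonneg _
    nlinarith
  have h3 := Finset.sum_lt_sum_of_nonempty (hT.nonempty r) h2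
  rw [Finset.sum_add_distrib, Finset.sum_const, nsmul_eq_mul, ← sqrtSize_sq] at h3
  have h4 : ∑ i ∈ part T r, (⨅ j, ‖projPts A V i - ν j‖ ^ 2) ≤ kmeansCost (projPts A V) ν :=
    Finset.sum_le_univ_sum_of_nonneg fun i => le_ciInf fun j => sq_nonneg _
  have h5 : ∑ i ∈ part T r, ‖projPts A V i - clusterMean A T (T i)‖ ^ 2 ≤ F :=
    Finset.sum_le_univ_sum_of_nonneg fun i => sq_nonneg _
  have h6 := sum_norm_projPts_sub_le hV (by linarith) T
  have h7 : sqrtSize T r ^ 2 * (D ^ 2 / 2) = (φ + 1) * (2 * k * ((θ + 1) * X) ^ 2) := by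
    have e1 : √(φ + 1) ^ 2 = φ + 1 := Real.sq_sqrt (by linarith)
    have e2 : √(k : ℝ) ^ 2 = k := Real.sq_sqrt (by positivity)
    have e3 : sqrtSize T r ^ 2 * ((sqrtSize T r)⁻¹) ^ 2 = 1 := by
      rw [← mul_pow, mul_inv_cancel₀ hw.ne', one_pow]
    calc sqrtSize T r ^ 2 * (D ^ 2 / 2) = 2 * (θ + 1) ^ 2 * √(φ + 1) ^ 2 * √(k : ℝ) ^ 2 * X ^ 2
          * (sqrtSize T r ^ 2 * ((sqrtSize T r)⁻¹) ^ 2) := by rw [hD]; ring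
      _ = _ := by rw [e1, e2, e3]; ring
  rw [h7] at h3
  have h8 := mul_le_mul_of_nonneg_left h6 (by linarith : 0 ≤ φ + 1)
  linarith

/-- After renaming the centers, the initial ones lie in the basin of attraction. -/
lemma exists_perm_inBasin {θ φ c : ℝ} (hθ : 1 ≤ θ) (hφ : 1 ≤ φ) (hc : 0 < c)
    (hcγ : 32 * (θ + 1) * √(φ + 1) ≤ c) {A : Matrix (Fin n) (Fin d) ℝ}
    {V : Submodule ℝ (Pt d)} (hV : IsNearTopSubspace θ k A V) {T : Fin n → Fin k}
    (hT : IsClustering A T) (hsep : MeansSeparated c A T) {ν : Fin k → Pt d}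
    (hν : IsApproxKMeans φ (projPts A V) ν) :
    ∃ π : Equiv.Perm (Fin k), InBasin c A T fun r => ν (π r) := by
  choose f hf using exists_center_near hθ hφ hV hT hν
  set X := ‖A - centerMatrix A T‖ with hX
  have hX0 : 0 ≤ X := norm_nonneg _
  have h1 : InBasin c A T fun r => ν (f r) := by
    intro r
    refine (hf r).trans ?_
    have hw := hT.sqrtSize_pos r
    refine mul_le_mul_of_nonneg_right (mul_le_mul_of_nonneg_right ?_ hX0) (by positivity)
    have hk : (1 : ℝ) ≤ k := by exact_mod_cast (Fin.pos r)
    have hs : √(k : ℝ) ≤ k := by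
      rw [Real.sqrt_le_left (by positivity)]; nlinarith
    have := mul_le_mul hcγ hs (Real.sqrt_nonneg _) hc.le
    linarith
  have hinj : Function.Injective f := by
    intro r s hrs
    by_contra hne
    have h2 := h1.le_separation hc.le r s
    have h3 := h1.le_separation hc.le s r
    rw [separation_comm] at h3
    have h4 := hsep r s hne
    simp only [hrs] at h2
    have h5 : 0 < dist (clusterMean A T r) (clusterMean A T s) :=
      dist_pos.2 fun h => hne (hT.means_injective h)
    have h6 := dist_triangle_left (clusterMean A T r) (clusterMean A T s) (ν (f s))
    rw [dist_eq_norm (ν (f s)), dist_eq_norm (ν (f s))] at h6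
    linarith
  exact ⟨Equiv.ofBijective f (Finite.injective_iff_bijective.1 hinj), h1⟩

lemma recenter_perm (p : Fin n → Pt d) (ν : Fin k → Pt d) (S : Fin n → Fin k)
    (π : Equiv.Perm (Fin k)) :
    (fun r => recenter p ν S (π r)) = recenter p (fun r => ν (π r)) (fun i => π.symm (S i)) := by
  funext r
  have : part S (π r) = part (fun i => π.symm (S i)) r := by
    ext i; simp [mem_part, Equiv.symm_apply_eq]
  simp only [recenter, this]

/-- The algorithm with an approximate projection recovers every clustering with constant `2`. -/
theorem recovers_of_isClusterOutput {θ φ c : ℝ} (hθ : 1 ≤ θ) (hφ : 1 ≤ φ) (hc : 40 ≤ c)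
    (hcγ : 32 * (θ + 1) * √(φ + 1) ≤ c) {A : Matrix (Fin n) (Fin d) ℝ}
    {V : Submodule ℝ (Pt d)} (hV : IsNearTopSubspace θ k A V) {ℓ : ℕ} (hℓ : (n : ℝ) ≤ 4 ^ ℓ)
    {label : Fin n → Fin k} (hout : IsClusterOutput φ ℓ A V label) {T : Fin n → Fin k}
    (hT : IsClustering A T) : Recovers 2 c A T label := by
  obtain ⟨ν, S, h0, hS, hν, rfl⟩ := hout
  have main : MeansSeparated c A T → CorrectUpTo (2 * numBad c A T) T (S ℓ) := by
    intro hsep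
    obtain ⟨π, hπ⟩ := exists_perm_inBasin hθ hφ (by linarith) hcγ hV hT hsep h0
    refine ⟨π, ?_⟩
    have := card_misclassified_lloyd_le hc hT hsep (fun t r => ν t (π r))
      (fun t i => π.symm (S t i)) hℓ hπ (fun t ht i r => by
        simpa using hS t ht i (π r)) (fun t ht => by
        simp only [hν t ht]
        exact recenter_perm _ _ _ _)
    have e : (Finset.univ.filter fun i => π (T i) ≠ S ℓ i)
        = Finset.univ.filter fun i => T i ≠ π.symm (S ℓ i) := by
      ext i; simp [Equiv.eq_symm_apply]
    rw [e]
    exact_mod_cast this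
  refine ⟨fun ε hsep hε => ?_, fun hall => ?_⟩
  · obtain ⟨π, hπ⟩ := main hsep
    refine ⟨π, hπ.trans ?_⟩
    have h1 : (numBad c A T : ℝ) = n - (good c A T).card := by
      rw [numBad, Finset.card_compl, Fintype.card_fin, Nat.cast_sub]
      simpa using Finset.card_le_univ (good c A T)
    have h2 : (numBad c A T : ℝ) ≤ ε * n := by linarith
    rcases Nat.eq_zero_or_pos k with hk | hk
    · subst hk
      have : n = 0 := by
        by_contra h
        exact (T ⟨0, Nat.pos_of_ne_zero h⟩).elim0
      subst this
      have : numBad c A T = 0 := by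
        have := Finset.card_le_univ (good c A T)ᶜ
        rw [Fintype.card_fin] at this
        exact Nat.le_zero.1 this
      simp [this]
    · have hk1 : (1 : ℝ) ≤ k := by exact_mod_cast hk
      have h3 : (0 : ℝ) ≤ numBad c A T := by positivity
      have h4 : 1 * (ε * n) ≤ (k : ℝ) ^ 2 * (ε * n) :=
        mul_le_mul_of_nonneg_right (one_le_pow₀ hk1) (h3.trans h2)
      linarith
  · have h1 := main (meansSeparated_of_proximity hT hall)
    have : numBad c A T = 0 := by
      rw [numBad, Finset.card_eq_zero, Finset.compl_eq_empty_iff]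
      ext i; simp [good, hall i]
    rwa [this, Nat.cast_zero, mul_zero] at h1

lemma le_four_pow_of_log_le {n ℓ : ℕ} (h : 1 * (1 + Real.log n) ≤ ℓ) : (n : ℝ) ≤ 4 ^ ℓ := by
  rcases Nat.eq_zero_or_pos n with h0 | h0
  · subst h0; simp
  · have hn : (0 : ℝ) < n := by exact_mod_cast h0
    calc (n : ℝ) = Real.exp (Real.log n) := (Real.exp_log hn).symm
      _ ≤ Real.exp ℓ := Real.exp_le_exp.2 (by linarith)
      _ = Real.exp 1 ^ ℓ := by rw [← Real.exp_nat_mul, mul_one]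
      _ ≤ 4 ^ ℓ := pow_le_pow_left₀ (Real.exp_pos 1).le (by linarith [Real.exp_one_lt_d9]) ℓ

/-! ### Pivoted Gram–Schmidt on the columns of a high matrix power -/

/-- The component of `x` orthogonal to `V`. -/
noncomputable def resid (V : Submodule ℝ (Pt d)) (x : Pt d) : Pt d := x - V.starProjection x

lemma resid_mem_orthogonal (V : Submodule ℝ (Pt d)) (x : Pt d) : resid V x ∈ Vᗮ :=
  V.sub_starProjection_mem_orthogonal x

lemma resid_eq_of_mem {V : Submodule ℝ (Pt d)} {x y : Pt d} (h1 : x - y ∈ V) (h2 : y ∈ Vᗮ) :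
    resid V x = y := by
  have := Submodule.eq_starProjection_of_mem_orthogonal (u := x) h1 (by rwa [sub_sub_cancel])
  rw [resid, this, sub_sub_cancel]

/-- The span of the first `s` vectors of a sequence. -/
def prefixSpan (w : ℕ → Pt d) (s : ℕ) : Submodule ℝ (Pt d) := Submodule.span ℝ (w '' Set.Iio s)

lemma prefixSpan_mono (w : ℕ → Pt d) {s t : ℕ} (h : s ≤ t) : prefixSpan w s ≤ prefixSpan w t :=
  Submodule.span_mono (Set.image_mono (Set.Iio_subset_Iio h))

lemma mem_prefixSpan (w : ℕ → Pt d) {s t : ℕ} (h : s < t) : w s ∈ prefixSpan w t :=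
  Submodule.subset_span ⟨s, h, rfl⟩

lemma finrank_prefixSpan_le (w : ℕ → Pt d) (s : ℕ) : Module.finrank ℝ (prefixSpan w s) ≤ s := by
  classical
  have : w '' Set.Iio s = ((Finset.range s).image w : Finset (Pt d)) := by
    ext; simp
  rw [prefixSpan, this]
  exact (finrank_span_finset_le_card _).trans (Finset.card_image_le.trans (by simp))

lemma prefixSpan_congr {w w' : ℕ → Pt d} {s : ℕ} (h : ∀ r < s, w r = w' r) :
    prefixSpan w s = prefixSpan w' s := by
  have : w '' Set.Iio s = w' '' Set.Iio s := Set.image_congr fun r hr => h r hr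
  rw [prefixSpan, prefixSpan, this]

@[simp] lemma resid_prefixSpan_zero (w : ℕ → Pt d) (x : Pt d) : resid (prefixSpan w 0) x = x :=
  resid_eq_of_mem (by simp) (by simp [prefixSpan])

/-- One elimination step. It also covers `w s = 0`, where division by zero gives `0`. -/
lemma resid_prefixSpan_succ (w : ℕ → Pt d) (s : ℕ) (hw : w s ∈ (prefixSpan w s)ᗮ) (x : Pt d) :
    resid (prefixSpan w (s + 1)) x = resid (prefixSpan w s) x
      - (inner ℝ (resid (prefixSpan w s) x) (w s) / inner ℝ (w s) (w s)) • w s := by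
  have h0 : prefixSpan w (s + 1) = prefixSpan w s ⊔ Submodule.span ℝ {w s} := by
    rw [prefixSpan, prefixSpan, ← Submodule.span_union]
    congr 1
    ext y
    simp only [Set.mem_image, Set.mem_Iio, Set.mem_union, Set.mem_singleton_iff,
      Nat.lt_succ_iff_lt_or_eq]
    constructor
    · rintro ⟨r, hr | rfl, rfl⟩
      · exact Or.inl ⟨r, hr, rfl⟩
      · exact Or.inr rfl
    · rintro (⟨r, hr, rfl⟩ | rfl)
      · exact ⟨r, Or.inl hr, rfl⟩
      · exact ⟨s, Or.inr rfl, rfl⟩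
  refine resid_eq_of_mem ?_ ?_
  · have e : ∀ a : ℝ, x - (resid (prefixSpan w s) x - a • w s)
        = (prefixSpan w s).starProjection x + a • w s := fun a => by
      rw [resid]; abel
    rw [e]
    exact add_mem (prefixSpan_mono w (Nat.le_succ s) (Submodule.starProjection_apply_mem _ _))
      (Submodule.smul_mem _ _ (mem_prefixSpan w (Nat.lt_succ_self s)))
  · rw [h0, ← Submodule.inf_orthogonal, Submodule.mem_inf]
    refine ⟨sub_mem (resid_mem_orthogonal _ _) (Submodule.smul_mem _ _ hw), ?_⟩
    rw [Submodule.mem_orthogonal_singleton_iff_inner_right, inner_sub_right,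
      real_inner_smul_right, real_inner_comm (w s)]
    by_cases h : w s = 0
    · simp [h]
    · rw [div_mul_cancel₀ _ (inner_self_ne_zero.2 h), real_inner_comm, sub_self]

lemma sum_le_of_le_add_sum_Ioi : ∀ {m : ℕ} (b : Fin m → ℝ) {H : ℝ},
    (∀ i, b i ≤ H + ∑ l ∈ Finset.Ioi i, b l) → ∑ i, b i ≤ (2 ^ m - 1) * H
  | 0, b, H, _ => by simp
  | m + 1, b, H, h => by
    have ih := sum_le_of_le_add_sum_Ioi (fun i => b i.succ) (H := H) fun i => by
      have := h i.succ
      rwa [Fin.sum_Ioi_succ] at this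
    have h0 := h 0
    rw [Fin.sum_Ioi_zero] at h0
    rw [Fin.sum_univ_succ, pow_succ]
    linarith

lemma norm_resid_antitone (w : ℕ → Pt d) {s t : ℕ} (h : s ≤ t) (x : Pt d) :
    ‖resid (prefixSpan w t) x‖ ≤ ‖resid (prefixSpan w s) x‖ := by
  have e : resid (prefixSpan w t) x = resid (prefixSpan w t) (resid (prefixSpan w s) x) := by
    symm
    refine resid_eq_of_mem ?_ (resid_mem_orthogonal _ _)
    have : resid (prefixSpan w s) x - resid (prefixSpan w t) x
        = (prefixSpan w t).starProjection x - (prefixSpan w s).starProjection x := by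
      rw [resid, resid]; abel
    rw [this]
    exact sub_mem (Submodule.starProjection_apply_mem _ _)
      (prefixSpan_mono w h (Submodule.starProjection_apply_mem _ _))
  rw [e]
  have e2 : ∀ y, resid (prefixSpan w t) y = (prefixSpan w t)ᗮ.starProjection y := fun y => by
    rw [Submodule.starProjection_orthogonal']; rfl
  rw [e2 (resid (prefixSpan w s) x)]
  exact Submodule.norm_starProjection_apply_le _ _

/-- The vectors `w s` arise from the vectors `y j` by Gram–Schmidt orthogonalization without
normalization, where the pivot in each of the first `k` steps is a longest residual vector. -/
structure IsPivotedGramSchmidt (k : ℕ) (y : ℕ → Pt d) (w : ℕ → Pt d) (p : ℕ → ℕ) : Prop where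
  eq_resid : ∀ s < k, w s = resid (prefixSpan w s) (y (p s))
  le_pivot : ∀ s < k, ∀ j, ‖resid (prefixSpan w s) (y j)‖ ≤ ‖w s‖

/-- Greedy pivoting leaves residuals that are at most `2 ^ (k + 1)` times the bound for `M` on the
orthogonal complement of any `k`-dimensional subspace `W`. A nontrivial combination of the `k + 1`
vectors `u` in question is orthogonal to `W`, so its image is short; reading off the coefficients
along the pivots, the last one first, bounds them all. -/
lemma IsPivotedGramSchmidt.norm_resid_le {M : Pt d →ₗ[ℝ] Pt d} {u : ℕ → Pt d}
    (hu : ∀ j, ‖u j‖ ≤ 1) {w : ℕ → Pt d} {p : ℕ → ℕ}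
    (h : IsPivotedGramSchmidt k (fun j => M (u j)) w p) {W : Submodule ℝ (Pt d)}
    (hW : Module.finrank ℝ W ≤ k) {t : ℝ} (ht : 0 ≤ t) (hM : ∀ x ∈ Wᗮ, ‖M x‖ ≤ t * ‖x‖) (j : ℕ) :
    ‖resid (prefixSpan w k) (M (u j))‖ ≤ 2 ^ (k + 1) * t := by
  set q : ℕ → ℕ := fun i => if i < k then p i else j with hq
  set V := prefixSpan w with hV
  set r : ℕ → Pt d := fun i => resid (V i) (M (u (q i))) with hr
  set ρ := ‖resid (V k) (M (u j))‖ with hρ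
  have hρ0 : 0 ≤ ρ := norm_nonneg _
  rcases hρ0.eq_or_lt with h0 | h0
  · rw [← h0]; positivity
  have hrw : ∀ i < k, r i = w i := fun i hi => by
    rw [h.eq_resid i hi, hr]; simp [hq, hi, hV]
  have hrρ : ∀ i ≤ k, ρ ≤ ‖r i‖ := by
    intro i hi
    rcases hi.lt_or_eq with hi | rfl
    · rw [hrw i hi]
      exact (norm_resid_antitone w hi.le _).trans (h.le_pivot i hi j)
    · simp [hr, hq, hρ]
  obtain ⟨a, ha0, ha⟩ := exists_combination_mem_orthogonal
    (fun i : Fin (k + 1) => u (q i)) W (by omega)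
  set z := ∑ i, a i • u (q i) with hz
  have hzn : ‖z‖ ≤ ∑ i, |a i| := by
    refine (norm_sum_le _ _).trans (Finset.sum_le_sum fun i _ => ?_)
    rw [norm_smul, Real.norm_eq_abs]
    exact mul_le_of_le_one_right (abs_nonneg _) (hu _)
  have hMz : ‖M z‖ ≤ t * ∑ i, |a i| := (hM z ha).trans (mul_le_mul_of_nonneg_left hzn ht)
  have hin : ∀ i : Fin (k + 1), |a i| ≤ ‖M z‖ / ρ + ∑ l ∈ Finset.Ioi i, |a l| := by
    intro i
    have hi : (i : ℕ) ≤ k := by omega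
    have hri := hrρ i hi
    have hri0 : 0 < ‖r i‖ := h0.trans_le hri
    have hrO : r i ∈ (V i)ᗮ := resid_mem_orthogonal _ _
    have hself : ∀ x, inner ℝ x (r i) = inner ℝ (resid (V i) x) (r i) := fun x => by
      rw [resid, inner_sub_left,
        (Submodule.mem_orthogonal _ _).1 hrO _ (Submodule.starProjection_apply_mem _ x), sub_zero]
    have hlt : ∀ l : Fin (k + 1), l < i → inner ℝ (M (u (q l))) (r i) = 0 := by
      intro l hl
      have hlk : (l : ℕ) < k := by omega
      refine (Submodule.mem_orthogonal _ _).1 hrO _ ?_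
      have e : M (u (q l)) = (V l).starProjection (M (u (q l))) + w l := by
        rw [← hrw l hlk, hr]; simp [resid]
      rw [e]
      exact add_mem (prefixSpan_mono w (by omega) (Submodule.starProjection_apply_mem _ _))
        (mem_prefixSpan w (by omega))
    have hgt : ∀ l : Fin (k + 1), i < l → |inner ℝ (M (u (q l))) (r i)| ≤ ‖r i‖ ^ 2 := by
      intro l hl
      have hik : (i : ℕ) < k := by omega
      rw [hself]
      refine (abs_real_inner_le_norm _ _).trans ?_
      rw [sq]
      refine mul_le_mul_of_nonneg_right ?_ (norm_nonneg _)
      rw [hrw i hik]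
      exact h.le_pivot i hik _
    have hsum : inner ℝ (M z) (r i)
        = a i * ‖r i‖ ^ 2 + ∑ l ∈ Finset.Ioi i, a l * inner ℝ (M (u (q l))) (r i) := by
      have e : (Finset.univ : Finset (Fin (k + 1))) = Finset.Iio i ∪ ({i} ∪ Finset.Ioi i) := by
        ext l; simp [lt_or_ge]
      rw [hz, map_sum, sum_inner, e, Finset.sum_union, Finset.sum_union, Finset.sum_singleton]
      · simp only [map_smul, real_inner_smul_left]
        rw [Finset.sum_eq_zero fun l hl => by rw [hlt l (Finset.mem_Iio.1 hl), mul_zero],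
          zero_add]
        have : inner ℝ (M (u (q i))) (r i) = ‖r i‖ ^ 2 := by
          rw [hself, ← real_inner_self_eq_norm_sq]
        rw [this]
      · rw [Finset.disjoint_left]; simp
      · rw [Finset.disjoint_left]
        intro l hl
        have := Finset.mem_Iio.1 hl
        simp only [Finset.mem_union, Finset.mem_singleton, Finset.mem_Ioi]
        omega
    have h1 : |a i| * ‖r i‖ ^ 2 ≤ ‖M z‖ * ‖r i‖ + (∑ l ∈ Finset.Ioi i, |a l|) * ‖r i‖ ^ 2 := by
      have h2 : a i * ‖r i‖ ^ 2
          = inner ℝ (M z) (r i) - ∑ l ∈ Finset.Ioi i, a l * inner ℝ (M (u (q l))) (r i) := by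
        linarith
      have h3 : |a i| * ‖r i‖ ^ 2 = |a i * ‖r i‖ ^ 2| := by
        rw [abs_mul, abs_of_nonneg (sq_nonneg ‖r i‖)]
      rw [h3, h2]
      refine (abs_sub _ _).trans (add_le_add (abs_real_inner_le_norm _ _) ?_)
      rw [Finset.sum_mul]
      refine (Finset.abs_sum_le_sum_abs _ _).trans (Finset.sum_le_sum fun l hl => ?_)
      rw [abs_mul]
      exact mul_le_mul_of_nonneg_left (hgt l (Finset.mem_Ioi.1 hl)) (abs_nonneg _)
    have h4 : |a i| * ‖r i‖ ≤ ‖M z‖ + (∑ l ∈ Finset.Ioi i, |a l|) * ‖r i‖ := by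
      refine le_of_mul_le_mul_right ?_ hri0
      linarith
    have h5 : ‖M z‖ ≤ ‖M z‖ / ρ * ‖r i‖ := by
      rw [div_mul_eq_mul_div, le_div_iff₀ h0]
      exact mul_le_mul_of_nonneg_left hri (norm_nonneg _)
    refine le_of_mul_le_mul_right ?_ hri0
    linarith
  have h1 := sum_le_of_le_add_sum_Ioi (fun i => |a i|) hin
  have hpos : 0 < ∑ i, |a i| := by
    obtain ⟨i, hi⟩ : ∃ i, a i ≠ 0 := by
      by_contra hcon; push Not at hcon; exact ha0 (funext hcon)
    exact lt_of_lt_of_le (abs_pos.2 hi)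
      (Finset.single_le_sum (f := fun i => |a i|) (fun _ _ => abs_nonneg _) (Finset.mem_univ i))
  rw [mul_div_assoc', le_div_iff₀ h0] at h1
  have h2 : ((2 : ℝ) ^ (k + 1) - 1) * ‖M z‖ ≤ 2 ^ (k + 1) * (t * ∑ i, |a i|) :=
    mul_le_mul (by linarith) hMz (norm_nonneg _) (by positivity)
  refine le_of_mul_le_mul_right ?_ hpos
  linarith

/-- The `j`-th row of a square matrix, with junk value `0` for `j ≥ d`. -/
noncomputable def rowNat (M : Matrix (Fin d) (Fin d) ℝ) (j : ℕ) : Pt d :=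
  if h : j < d then row M ⟨j, h⟩ else 0

/-- The matrix `(AᵀA) ^ (2 ^ d)`. The exponent is so large that the exponential loss of greedy
pivoting disappears in the corresponding root. -/
def gramPower (A : Matrix (Fin n) (Fin d) ℝ) : Matrix (Fin d) (Fin d) ℝ := (Aᵀ * A) ^ (2 ^ d)

lemma toEuclideanLin_pow_apply {B : Matrix (Fin d) (Fin d) ℝ} {x : Pt d} {a : ℝ}
    (h : Matrix.toEuclideanLin B x = a • x) (m : ℕ) :
    Matrix.toEuclideanLin (B ^ m) x = a ^ m • x := by
  induction m with
  | zero => simp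
  | succ m ih =>
    have : Matrix.toEuclideanLin (B ^ (m + 1)) x
        = Matrix.toEuclideanLin (B ^ m) (Matrix.toEuclideanLin B x) := by
      simp [Matrix.toLpLin_apply, pow_succ]
    rw [this, h, map_smul, ih, smul_smul, pow_succ, mul_comm]

lemma gramPower_transpose (A : Matrix (Fin n) (Fin d) ℝ) : (gramPower A)ᵀ = gramPower A := by
  rw [gramPower, Matrix.transpose_pow, Matrix.transpose_mul, Matrix.transpose_transpose]

lemma row_eq_toEuclideanLin {M : Matrix (Fin d) (Fin d) ℝ} (hM : Mᵀ = M) (j : Fin d) :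
    row M j = Matrix.toEuclideanLin M (EuclideanSpace.single j 1) := by
  ext i
  rw [toEuclideanLin_apply_eq_inner, EuclideanSpace.inner_single_right]
  simp only [row, one_mul]
  conv_lhs => rw [← hM]
  simp [Matrix.transpose_apply]

lemma norm_toEuclideanLin_sq_of_eigen {M : Matrix (Fin d) (Fin d) ℝ}
    {v : OrthonormalBasis (Fin d) ℝ (Pt d)} {e : Fin d → ℝ}
    (h : ∀ j, Matrix.toEuclideanLin M (v j) = e j • v j) (x : Pt d) :
    ‖Matrix.toEuclideanLin M x‖ ^ 2 = ∑ j, e j ^ 2 * (inner ℝ (v j) x) ^ 2 ∧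
      inner ℝ x (Matrix.toEuclideanLin M x) = ∑ j, (inner ℝ (v j) x) ^ 2 * e j := by
  have h1 : Matrix.toEuclideanLin M x = ∑ j, (e j * inner ℝ (v j) x) • v j := by
    conv_lhs => rw [← v.sum_repr' x]
    rw [map_sum]
    refine Finset.sum_congr rfl fun j _ => ?_
    rw [map_smul, h, smul_smul, mul_comm]
  constructor
  · rw [← v.sum_sq_norm_inner_right]
    refine Finset.sum_congr rfl fun j _ => ?_
    rw [h1, inner_sum]
    simp [real_inner_smul_right, v.inner_eq_ite, mul_pow]
  · rw [h1, inner_sum]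
    refine Finset.sum_congr rfl fun j _ => ?_
    rw [real_inner_smul_right, real_inner_comm]; ring

/-- Pivoted Gram–Schmidt on `gramPower A` finds a near optimal subspace: for `x` orthogonal to it,
`‖A x‖ ^ 2` to the power `2 ^ d` is at most `⟨x, gramPower A x⟩` by convexity, hence at most
`d 2 ^ (k + 1)` times the corresponding power of the singular value. -/
theorem IsPivotedGramSchmidt.isNearTopSubspace {A : Matrix (Fin n) (Fin d) ℝ} {w : ℕ → Pt d}
    {p : ℕ → ℕ} (h : IsPivotedGramSchmidt k (rowNat (gramPower A)) w p) :
    IsNearTopSubspace 2 k A (prefixSpan w k) := by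
  refine ⟨finrank_prefixSpan_le w k, ?_⟩
  obtain ⟨v, σ, hv⟩ := exists_isSingularBasis A
  refine ⟨topSpan k v, isTopSingularSubspace_iff.2 ⟨v, σ, hv, rfl⟩, ?_⟩
  set R := ‖A - ofRows (projPts A (topSpan k v))‖ with hR
  have hR0 : 0 ≤ R := norm_nonneg _
  have hσR : ∀ j : Fin d, k ≤ (j : ℕ) → σ j ≤ R := fun j hj =>
    hv.le_norm_sub _ _ (finrank_topSpan_le k v)
      (fun i => by rw [row_ofRows]; exact Submodule.starProjection_apply_mem _ _) j hj
  set M := gramPower A with hM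
  have heig : ∀ j, Matrix.toEuclideanLin M (v j) = (σ j ^ 2) ^ (2 ^ d) • v j := fun j =>
    toEuclideanLin_pow_apply (hv.apply_eq j) _
  refine norm_sub_projPts_le _ _ (by positivity) fun x hx => ?_
  rcases Nat.eq_zero_or_pos d with hd | hd
  · subst hd
    have : x = 0 := Subsingleton.elim _ _
    simp [this]
  rcases eq_or_ne x 0 with rfl | hx0
  · simp
  -- it suffices to treat unit vectors
  suffices hunit : ∀ x ∈ (prefixSpan w k)ᗮ, ‖x‖ = 1 → ‖Matrix.toEuclideanLin A x‖ ≤ 2 * R by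
    have hn : ‖x‖ ≠ 0 := norm_ne_zero_iff.2 hx0
    have h1 := hunit (‖x‖⁻¹ • x) (Submodule.smul_mem _ _ hx) (by
      rw [norm_smul, norm_inv, norm_norm, inv_mul_cancel₀ hn])
    rw [map_smul, norm_smul, norm_inv, norm_norm, inv_mul_le_iff₀ (by positivity)] at h1
    linarith
  clear hx0 hx x
  intro x hx hx1
  set u : ℕ → Pt d := fun j => if h : j < d then EuclideanSpace.single ⟨j, h⟩ 1 else 0 with hu
  have hrow : (rowNat M) = fun j => Matrix.toEuclideanLin M (u j) := by
    funext j
    by_cases hj : j < d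
    · simp only [rowNat, hj, hu, dif_pos]
      exact row_eq_toEuclideanLin (gramPower_transpose A) _
    · simp [rowNat, hj, hu]
  have hu1 : ∀ j, ‖u j‖ ≤ 1 := fun j => by
    by_cases hj : j < d <;> simp [hu, hj]
  rw [hrow] at h
  set t := (R ^ 2) ^ (2 ^ d) with ht
  have hMt : ∀ x ∈ (topSpan k v)ᗮ, ‖Matrix.toEuclideanLin M x‖ ≤ t * ‖x‖ := by
    intro x hx
    rw [← pow_le_pow_iff_left₀ (norm_nonneg _) (by positivity) two_ne_zero, mul_pow,
      (norm_toEuclideanLin_sq_of_eigen heig x).1, ← v.sum_sq_norm_inner_right x, Finset.mul_sum]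
    refine Finset.sum_le_sum fun j _ => ?_
    rw [Real.norm_eq_abs, sq_abs]
    by_cases hj : (j : ℕ) < k
    · have : inner ℝ (v j) x = 0 :=
        (Submodule.mem_orthogonal _ _).1 hx _ (Submodule.subset_span ⟨j, hj, rfl⟩)
      rw [this]; simp
    · refine mul_le_mul_of_nonneg_right (pow_le_pow_left₀ (by positivity) ?_ 2) (sq_nonneg _)
      exact pow_le_pow_left₀ (sq_nonneg _)
        (pow_le_pow_left₀ (hv.nonneg j) (hσR j (by omega)) 2) _
  -- if `d ≤ k` the top subspace is everything and the bound for `M` is `0`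
  obtain ⟨t', ht'0, hMt', hnum⟩ : ∃ t' : ℝ, 0 ≤ t' ∧
      (∀ x ∈ (topSpan k v)ᗮ, ‖Matrix.toEuclideanLin M x‖ ≤ t' * ‖x‖) ∧
      d * (2 ^ (k + 1) * t') ≤ ((2 * R) ^ 2) ^ (2 ^ d) := by
    rcases lt_or_ge k d with hkd | hkd
    · refine ⟨t, by positivity, hMt, ?_⟩
      have e : ((2 * R) ^ 2) ^ (2 ^ d) = 4 ^ (2 ^ d) * t := by
        rw [ht, mul_pow, mul_pow]; norm_num
      rw [e, ← mul_assoc]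
      refine mul_le_mul_of_nonneg_right ?_ (by positivity)
      have h1 : d ≤ 2 ^ d := Nat.lt_two_pow_self.le
      have h2 : (2 : ℕ) ^ (k + 1) ≤ 2 ^ d := Nat.pow_le_pow_right (by norm_num) hkd
      have h3 : d * 2 ^ (k + 1) ≤ 4 ^ (2 ^ d) := by
        calc d * 2 ^ (k + 1) ≤ 2 ^ d * 2 ^ d := Nat.mul_le_mul h1 h2
          _ = 4 ^ d := by rw [← mul_pow]; norm_num
          _ ≤ 4 ^ (2 ^ d) := Nat.pow_le_pow_right (by norm_num) h1
      exact_mod_cast h3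
    · refine ⟨0, le_rfl, fun x hx => ?_, by simp only [mul_zero]; positivity⟩
      have : x = 0 := by
        rw [← v.sum_repr' x]
        refine Finset.sum_eq_zero fun j _ => ?_
        rw [(Submodule.mem_orthogonal _ _).1 hx _
          (Submodule.subset_span ⟨j, j.2.trans_le hkd, rfl⟩), zero_smul]
      simp [this]
  have hres := h.norm_resid_le hu1 (finrank_topSpan_le k v) ht'0 hMt'
  set ρ := 2 ^ (k + 1) * t' with hρ
  have hρ0 : 0 ≤ ρ := by positivity
  have h1 : inner ℝ x (Matrix.toEuclideanLin M x) ≤ d * ρ := by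
    have e : inner ℝ x (Matrix.toEuclideanLin M x)
        = ∑ j : Fin d, x j * inner ℝ x (Matrix.toEuclideanLin M (u j)) := by
      have hx' : x = ∑ j : Fin d, x j • u j := by
        ext i
        simp [hu, Finset.sum_apply, Pi.single_apply]
      have hMx : Matrix.toEuclideanLin M x
          = ∑ j : Fin d, Matrix.toEuclideanLin M (x j • u j) := by
        rw [← map_sum, ← hx']
      rw [hMx, inner_sum]
      exact Finset.sum_congr rfl fun j _ => by rw [map_smul, real_inner_smul_right]
    rw [e]
    have h2 : ∀ j ∈ (Finset.univ : Finset (Fin d)),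
        x j * inner ℝ x (Matrix.toEuclideanLin M (u j)) ≤ ρ := by
      intro j _
      have h3 : inner ℝ x (Matrix.toEuclideanLin M (u j))
          = inner ℝ x (resid (prefixSpan w k) (Matrix.toEuclideanLin M (u j))) := by
        rw [resid, inner_sub_right, real_inner_comm _ x, real_inner_comm _ x,
          (Submodule.mem_orthogonal _ _).1 hx _ (Submodule.starProjection_apply_mem _ _), sub_zero]
      rw [h3]
      have h4 : |x j| ≤ 1 := by rw [← hx1]; exact PiLp.norm_apply_le x j
      have h5 := abs_real_inner_le_norm x
        (resid (prefixSpan w k) (Matrix.toEuclideanLin M (u j)))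
      rw [hx1, one_mul] at h5
      refine (le_abs_self _).trans ?_
      rw [abs_mul]
      calc _ ≤ 1 * ρ := mul_le_mul h4 (h5.trans (hres j)) (abs_nonneg _) zero_le_one
        _ = ρ := one_mul _
    refine (Finset.sum_le_card_nsmul _ _ _ h2).trans (le_of_eq ?_)
    simp
  have h2 : (‖Matrix.toEuclideanLin A x‖ ^ 2) ^ (2 ^ d)
      ≤ inner ℝ x (Matrix.toEuclideanLin M x) := by
    rw [hv.norm_sq_eq, (norm_toEuclideanLin_sq_of_eigen heig x).2]
    have := Real.pow_arith_mean_le_arith_mean_pow Finset.univ (fun j => (inner ℝ (v j) x) ^ 2)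
      (fun j => σ j ^ 2) (fun _ _ => sq_nonneg _) (by
        have := v.sum_sq_norm_inner_right x
        simpa [hx1] using this) (fun _ _ => sq_nonneg _) (2 ^ d)
    simpa only [mul_comm] using this
  have h3 := (h2.trans h1).trans hnum
  have h4 := (pow_le_pow_iff_left₀ (sq_nonneg _) (sq_nonneg _) (by positivity)).1 h3
  exact (pow_le_pow_iff_left₀ (norm_nonneg _) (by positivity) two_ne_zero).1 h4

/-! ### Local search for the `k`-means problem -/

/-- Swap partners: if `π r` is the current center closest to the optimal center `r`, then every
optimal center `r` can be assigned a current center `τ r` that is closest to no other optimal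
center, such that no current center is used more than twice. -/
lemma exists_swap_partners (π : Fin k → Fin k) :
    ∃ τ : Fin k → Fin k, (∀ r r', r' ≠ r → π r' ≠ τ r) ∧
      ∀ s, (Finset.univ.filter fun r => τ r = s).card ≤ 2 := by
  classical
  set U := Finset.univ.filter fun r => ∃ r', r' ≠ r ∧ π r' = π r with hU
  set E := (Finset.univ.image π)ᶜ with hE
  have hnot : ∀ r, r ∉ U → ∀ r', r' ≠ r → π r' ≠ π r := by
    intro r hr r' hne h
    exact hr (by simp only [hU, Finset.mem_filter, Finset.mem_univ, true_and]; exact ⟨r', hne, h⟩)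
  have hcard : U.card ≤ 2 * E.card := by
    have h1 : 2 * (U.image π).card ≤ U.card := by
      rw [Finset.card_eq_sum_card_image π U, mul_comm, ← smul_eq_mul, ← Finset.sum_const]
      refine Finset.sum_le_sum fun s hs => ?_
      obtain ⟨r, hr, rfl⟩ := Finset.mem_image.1 hs
      have hr' := hr
      simp only [hU, Finset.mem_filter, Finset.mem_univ, true_and] at hr'
      obtain ⟨r', hne, he⟩ := hr'
      refine Finset.one_lt_card.2 ⟨r, by simp [hr], r', ?_, hne.symm⟩
      simp only [hU, Finset.mem_filter, Finset.mem_univ, true_and]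
      exact ⟨⟨r, hne.symm, he.symm⟩, he⟩
    have h2 : (Finset.univ.image π).card ≤ (U.image π).card + Uᶜ.card := by
      rw [← Finset.union_compl U, Finset.image_union]
      exact (Finset.card_union_le _ _).trans (Nat.add_le_add_left Finset.card_image_le _)
    have h3 : E.card = k - (Finset.univ.image π).card := by
      rw [hE, Finset.card_compl, Fintype.card_fin]
    have h4 : (Finset.univ.image π).card ≤ k := by
      simpa using Finset.card_le_univ (Finset.univ.image π)
    have h5 : Uᶜ.card = k - U.card := by rw [Finset.card_compl, Fintype.card_fin]
    have h6 : U.card ≤ k := by simpa using Finset.card_le_univ U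
    omega
  have hidx : ∀ r : U, (U.equivFin r : ℕ) / 2 < E.card := fun r => by
    have := (U.equivFin r).2
    omega
  refine ⟨fun r => if h : r ∈ U then E.equivFin.symm ⟨_, hidx ⟨r, h⟩⟩ else π r, ?_, ?_⟩
  · intro r r' hne
    by_cases h : r ∈ U
    · simp only [h, dif_pos]
      intro heq
      have := (E.equivFin.symm ⟨_, hidx ⟨r, h⟩⟩).2
      rw [← heq] at this
      simp [hE] at this
    · simp only [h, dif_neg, not_false_eq_true]
      exact hnot r h r' hne
  · intro s
    by_contra! hcon
    obtain ⟨a, ha, b, hb, c, hc, hab, hac, hbc⟩ := Finset.two_lt_card.1 hcon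
    simp only [Finset.mem_filter, Finset.mem_univ, true_and] at ha hb hc
    by_cases hs : s ∈ E
    · have hin : ∀ r, (if h : r ∈ U then ((E.equivFin.symm ⟨_, hidx ⟨r, h⟩⟩ : E) : Fin k)
          else π r) = s → ∃ h : r ∈ U, (U.equivFin ⟨r, h⟩ : ℕ) / 2 = E.equivFin ⟨s, hs⟩ := by
        intro r hr
        by_cases h : r ∈ U
        · refine ⟨h, ?_⟩
          simp only [h, dif_pos] at hr
          have : E.equivFin.symm ⟨_, hidx ⟨r, h⟩⟩ = ⟨s, hs⟩ := Subtype.ext hr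
          rw [← this]; simp
        · simp only [h, dif_neg, not_false_eq_true] at hr
          rw [← hr] at hs
          simp [hE] at hs
      obtain ⟨ha', ea⟩ := hin a ha
      obtain ⟨hb', eb⟩ := hin b hb
      obtain ⟨hc', ec⟩ := hin c hc
      have hinj : ∀ x y : U, (U.equivFin x : ℕ) = U.equivFin y → (x : Fin k) = y := fun x y h =>
        congrArg Subtype.val (U.equivFin.injective (Fin.ext h))
      have h1 : (U.equivFin ⟨a, ha'⟩ : ℕ) ≠ U.equivFin ⟨b, hb'⟩ := fun h => hab (hinj _ _ h)
      have h2 : (U.equivFin ⟨a, ha'⟩ : ℕ) ≠ U.equivFin ⟨c, hc'⟩ := fun h => hac (hinj _ _ h)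
      have h3 : (U.equivFin ⟨b, hb'⟩ : ℕ) ≠ U.equivFin ⟨c, hc'⟩ := fun h => hbc (hinj _ _ h)
      omega
    · have hin : ∀ r, (if h : r ∈ U then ((E.equivFin.symm ⟨_, hidx ⟨r, h⟩⟩ : E) : Fin k)
          else π r) = s → r ∉ U ∧ π r = s := by
        intro r hr
        by_cases h : r ∈ U
        · simp only [h, dif_pos] at hr
          exact absurd (hr ▸ (E.equivFin.symm ⟨_, hidx ⟨r, h⟩⟩).2) hs
        · simp only [h, dif_neg, not_false_eq_true] at hr
          exact ⟨h, hr⟩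
      obtain ⟨ha', ea⟩ := hin a ha
      obtain ⟨hb', eb⟩ := hin b hb
      exact hnot a ha' b hab.symm (eb.trans ea.symm)

lemma exists_nearest (hk : 1 ≤ k) (ν : Fin k → Pt d) (x : Pt d) :
    ∃ r, (∀ s, ‖x - ν r‖ ≤ ‖x - ν s‖) ∧ ⨅ s, ‖x - ν s‖ ^ 2 = ‖x - ν r‖ ^ 2 := by
  have : Nonempty (Fin k) := ⟨⟨0, hk⟩⟩
  obtain ⟨r, hr⟩ := Finite.exists_min fun r => ‖x - ν r‖
  refine ⟨r, hr, le_antisymm (ciInf_le (Set.finite_range _).bddBelow r) (le_ciInf fun s => ?_)⟩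
  exact pow_le_pow_left₀ (norm_nonneg _) (hr s) 2

lemma kmeansCost_nonneg (p : Fin n → Pt d) (ν : Fin k → Pt d) : 0 ≤ kmeansCost p ν :=
  Finset.sum_nonneg fun _ _ => Real.iInf_nonneg fun _ => sq_nonneg _

/-- The swap argument: replacing, for each center `O r` of a competing solution, the partner of `r`
by `O r` changes the cost by little in total. Points of the cluster of `O r` move to `O r`; other
points that lose their center move to the center closest to their center in `O`. -/
lemma exists_swap_le (hk : 1 ≤ k) (p : Fin n → Pt d) (S O : Fin k → Pt d) :
    ∃ s r, k * (kmeansCost p (Function.update S s (O r)) - kmeansCost p S)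
      ≤ 41 * kmeansCost p O - kmeansCost p S / 2 := by
  classical
  choose a ha ha' using fun i => exists_nearest hk S (p i)
  choose b hb hb' using fun i => exists_nearest hk O (p i)
  choose π hπ _ using fun r => exists_nearest hk S (O r)
  obtain ⟨τ, hτ1, hτ2⟩ := exists_swap_partners π
  have hcS : kmeansCost p S = ∑ i, ‖p i - S (a i)‖ ^ 2 := Finset.sum_congr rfl fun i _ => ha' i
  have hcO : kmeansCost p O = ∑ i, ‖p i - O (b i)‖ ^ 2 := Finset.sum_congr rfl fun i _ => hb' i
  have hre : ∀ i, ‖p i - S (π (b i))‖ ^ 2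
      ≤ ‖p i - S (a i)‖ ^ 2 + (20 * ‖p i - O (b i)‖ ^ 2 + ‖p i - S (a i)‖ ^ 2 / 4) := by
    intro i
    have h1 : ‖p i - S (π (b i))‖ ≤ ‖p i - O (b i)‖ + ‖O (b i) - S (π (b i))‖ :=
      norm_sub_le_norm_sub_add_norm_sub _ _ _
    have h2 := hπ (b i) (a i)
    have h3 : ‖O (b i) - S (a i)‖ ≤ ‖O (b i) - p i‖ + ‖p i - S (a i)‖ :=
      norm_sub_le_norm_sub_add_norm_sub _ _ _
    rw [norm_sub_rev (O (b i)) (p i)] at h3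
    have h4 : ‖p i - S (π (b i))‖ ^ 2 ≤ (2 * ‖p i - O (b i)‖ + ‖p i - S (a i)‖) ^ 2 :=
      pow_le_pow_left₀ (norm_nonneg _) (by linarith) 2
    nlinarith [sq_nonneg (8 * ‖p i - O (b i)‖ - ‖p i - S (a i)‖)]
  have hswap : ∀ r, kmeansCost p (Function.update S (τ r) (O r)) - kmeansCost p S
      ≤ ∑ i, ((if b i = r then ‖p i - O (b i)‖ ^ 2 - ‖p i - S (a i)‖ ^ 2 else 0)
        + if τ r = a i then 20 * ‖p i - O (b i)‖ ^ 2 + ‖p i - S (a i)‖ ^ 2 / 4 else 0) := by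
    intro r
    rw [hcS, kmeansCost, ← Finset.sum_sub_distrib]
    refine Finset.sum_le_sum fun i _ => ?_
    have hle : ∀ s, ⨅ s, ‖p i - Function.update S (τ r) (O r) s‖ ^ 2
        ≤ ‖p i - Function.update S (τ r) (O r) s‖ ^ 2 := fun s =>
      ciInf_le (Set.finite_range _).bddBelow s
    have hpos : 0 ≤ 20 * ‖p i - O (b i)‖ ^ 2 + ‖p i - S (a i)‖ ^ 2 / 4 := by positivity
    by_cases h1 : b i = r
    · have := hle (τ r)
      rw [Function.update_self] at this
      rw [if_pos h1, h1]
      rw [h1] at hpos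
      split_ifs <;> linarith
    · rw [if_neg h1, zero_add]
      by_cases h2 : τ r = a i
      · rw [if_pos h2]
        have := hle (π (b i))
        rw [Function.update_of_ne (hτ1 r (b i) h1)] at this
        linarith [hre i]
      · rw [if_neg h2]
        have := hle (a i)
        rw [Function.update_of_ne (Ne.symm h2)] at this
        linarith
  have htotal : ∑ r, (kmeansCost p (Function.update S (τ r) (O r)) - kmeansCost p S)
      ≤ 41 * kmeansCost p O - kmeansCost p S / 2 := by
    refine (Finset.sum_le_sum fun r _ => hswap r).trans ?_
    rw [Finset.sum_comm, hcO, hcS, Finset.mul_sum, Finset.sum_div, ← Finset.sum_sub_distrib]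
    refine Finset.sum_le_sum fun i _ => ?_
    rw [Finset.sum_add_distrib, Finset.sum_ite_eq, if_pos (Finset.mem_univ _), ← Finset.sum_filter,
      Finset.sum_const, nsmul_eq_mul]
    have h1 : ((Finset.univ.filter fun r => τ r = a i).card : ℝ) ≤ 2 := by exact_mod_cast hτ2 (a i)
    have h2 := mul_le_mul_of_nonneg_right h1
      (by positivity : 0 ≤ 20 * ‖p i - O (b i)‖ ^ 2 + ‖p i - S (a i)‖ ^ 2 / 4)
    linarith
  by_contra! hcon
  have : Nonempty (Fin k) := ⟨⟨0, hk⟩⟩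
  have h1 := Finset.sum_lt_sum_of_nonempty (s := (Finset.univ : Finset (Fin k)))
    Finset.univ_nonempty fun r _ => hcon (τ r) r
  rw [Finset.sum_const, Finset.card_univ, Fintype.card_fin, nsmul_eq_mul, ← Finset.mul_sum] at h1
  have hk' : (0 : ℝ) < k := by exact_mod_cast hk
  exact absurd (le_of_mul_le_mul_left h1.le hk') (by
    intro h
    have := lt_of_mul_lt_mul_left h1 hk'.le
    linarith)

/-- Restricting the centers to data points costs a factor of at most `4`. -/
lemma exists_data_centers (hk : 1 ≤ k) (hn : 1 ≤ n) (p : Fin n → Pt d) (ν : Fin k → Pt d) :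
    ∃ o : Fin k → Fin n, kmeansCost p (fun r => p (o r)) ≤ 4 * kmeansCost p ν := by
  have : Nonempty (Fin n) := ⟨⟨0, hn⟩⟩
  choose o ho using fun r => Finite.exists_min fun i => ‖p i - ν r‖
  refine ⟨o, ?_⟩
  rw [kmeansCost, kmeansCost, Finset.mul_sum]
  refine Finset.sum_le_sum fun i _ => ?_
  obtain ⟨r, _, hr⟩ := exists_nearest hk ν (p i)
  rw [hr]
  refine (ciInf_le (Set.finite_range _).bddBelow r).trans ?_
  have h1 : ‖p i - p (o r)‖ ≤ ‖p i - ν r‖ + ‖ν r - p (o r)‖ :=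
    norm_sub_le_norm_sub_add_norm_sub _ _ _
  rw [norm_sub_rev (ν r)] at h1
  have h2 := ho r i
  have h3 : ‖p i - p (o r)‖ ^ 2 ≤ (2 * ‖p i - ν r‖) ^ 2 :=
    pow_le_pow_left₀ (norm_nonneg _) (by linarith) 2
  linarith

/-- A best swap reduces the excess of the cost over `328` times any competing cost by the factor
`1 - 1 / (2 k)`. -/
lemma best_swap_le (hk : 1 ≤ k) (hn : 1 ≤ n) (p : Fin n → Pt d) {S S' : Fin k → Pt d}
    (h : ∀ s i, kmeansCost p S' ≤ kmeansCost p (Function.update S s (p i))) (ν : Fin k → Pt d) :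
    kmeansCost p S' - 328 * kmeansCost p ν
      ≤ (1 - 1 / (2 * k)) * (kmeansCost p S - 328 * kmeansCost p ν) := by
  obtain ⟨o, ho⟩ := exists_data_centers hk hn p ν
  obtain ⟨s, r, hsr⟩ := exists_swap_le hk p S fun r => p (o r)
  have h1 := h s (o r)
  have hk' : (0 : ℝ) < k := by exact_mod_cast hk
  have h2 : k * (kmeansCost p S' - kmeansCost p S) ≤ 164 * kmeansCost p ν - kmeansCost p S / 2 := by
    have := mul_le_mul_of_nonneg_left (sub_le_sub_right h1 (kmeansCost p S)) hk'.le
    linarith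
  have h3 : kmeansCost p S' - kmeansCost p S
      ≤ (164 * kmeansCost p ν - kmeansCost p S / 2) / k := by
    rw [le_div_iff₀ hk', mul_comm]; exact h2
  have e : (1 - 1 / (2 * k)) * (kmeansCost p S - 328 * kmeansCost p ν)
      = kmeansCost p S - 328 * kmeansCost p ν
        + (164 * kmeansCost p ν - kmeansCost p S / 2) / k := by
    field_simp; ring
  rw [e]; linarith

/-- The centers are data points chosen by farthest-first traversal: each one, from the second on, is
a data point at maximal distance from the previous ones. -/
def IsFarthestFirst (p : Fin n → Pt d) (c : Fin k → Fin n) : Prop :=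
  ∀ r : Fin k, 0 < (r : ℕ) → ∀ i, ∃ q < r, ∀ q' < r, ‖p i - p (c q)‖ ≤ ‖p (c r) - p (c q')‖

/-- Farthest-first traversal is within a factor `4 n` of the optimum: a point far from all centers
would give `k + 1` points far from each other, two of which share a center. -/
lemma IsFarthestFirst.kmeansCost_le (hk : 1 ≤ k) {p : Fin n → Pt d} {c : Fin k → Fin n}
    (h : IsFarthestFirst p c) (ν : Fin k → Pt d) :
    kmeansCost p (fun r => p (c r)) ≤ 4 * n * kmeansCost p ν := by
  have key : ∀ i ∈ Finset.univ, (⨅ r, ‖p i - p (c r)‖ ^ 2) ≤ 4 * kmeansCost p ν := by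
    intro i _
    obtain ⟨r₀, h1, h2⟩ := exists_nearest hk (fun r => p (c r)) (p i)
    rw [h2]
    set R := ‖p i - p (c r₀)‖ with hR
    let y : Option (Fin k) → Fin n := fun z => z.elim i c
    have hlt : ∀ q r : Fin k, q < r → R ≤ ‖p (c r) - p (c q)‖ := by
      intro q r hqr
      obtain ⟨q', _, hq'⟩ := h r (by have : (q : ℕ) < r := hqr
                                     omega) i
      exact (h1 q').trans (hq' q hqr)
    have hy : ∀ z z', z ≠ z' → R ≤ ‖p (y z) - p (y z')‖ := by
      rintro (_ | q) (_ | r) hne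
      · exact absurd rfl hne
      · exact h1 r
      · rw [norm_sub_rev]; exact h1 q
      · rcases lt_trichotomy q r with hqr | rfl | hqr
        · rw [norm_sub_rev]; exact hlt q r hqr
        · exact absurd rfl hne
        · exact hlt r q hqr
    choose b hb hb' using fun i => exists_nearest hk ν (p i)
    obtain ⟨z, z', hne, hzz⟩ := Fintype.exists_ne_map_eq_of_card_lt (fun z => b (y z)) (by simp)
    have h3 := hy z z' hne
    have hle : ∀ i, ‖p i - ν (b i)‖ ^ 2 ≤ kmeansCost p ν := fun i => by
      rw [← hb' i]
      exact Finset.single_le_sum (f := fun i => ⨅ r, ‖p i - ν r‖ ^ 2)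
        (fun i _ => Real.iInf_nonneg fun _ => sq_nonneg _) (Finset.mem_univ i)
    have h4 := hle (y z)
    have h5 := hle (y z')
    rw [← hzz] at h5
    have h6 : R ^ 2 ≤ ‖p (y z) - p (y z')‖ ^ 2 := pow_le_pow_left₀ (norm_nonneg _) h3 2
    have e : p (y z) - p (y z') = (p (y z) - ν (b (y z))) - (p (y z') - ν (b (y z))) := by abel
    have h7 := parallelogram_law_with_norm ℝ (p (y z) - ν (b (y z))) (p (y z') - ν (b (y z)))
    rw [← e] at h7
    have h8 : 0 ≤ ‖(p (y z) - ν (b (y z))) + (p (y z') - ν (b (y z)))‖ ^ 2 := sq_nonneg _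
    nlinarith
  refine (Finset.sum_le_card_nsmul _ _ _ key).trans (le_of_eq ?_)
  rw [Finset.card_univ, Fintype.card_fin, nsmul_eq_mul]; ring

/-- Farthest-first traversal followed by `n k` best swaps gives a constant factor approximation. -/
theorem isApproxKMeans_of_localSearch (hk : 1 ≤ k) (hn : 1 ≤ n) {p : Fin n → Pt d}
    {c : Fin k → Fin n} (hc : IsFarthestFirst p c) {S : Fin k → Pt d}
    (hS : ∀ ν : Fin k → Pt d, kmeansCost p S - 328 * kmeansCost p ν
      ≤ (1 - 1 / (2 * k)) ^ (n * k)
        * (kmeansCost p (fun r => p (c r)) - 328 * kmeansCost p ν)) :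
    IsApproxKMeans 336 p S := by
  intro ν
  have h1 := hc.kmeansCost_le hk ν
  have h2 := hS ν
  have h0 := kmeansCost_nonneg p ν
  have hk' : (1 : ℝ) ≤ k := by exact_mod_cast hk
  set x := (1 - 1 / (2 * k) : ℝ) with hx
  have hx0 : 0 ≤ x := by
    have : 1 / (2 * (k : ℝ)) ≤ 1 := by rw [div_le_one (by positivity)]; linarith
    linarith
  have hx1 : x ≤ Real.exp (-(1 / (2 * k))) := by
    have := Real.add_one_le_exp (-(1 / (2 * (k : ℝ))))
    linarith
  have hx2 : x ^ (n * k) ≤ Real.exp (-(n / 2)) := by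
    refine (pow_le_pow_left₀ hx0 hx1 _).trans (le_of_eq ?_)
    rw [← Real.exp_nat_mul]
    congr 1
    push_cast
    field_simp
  have hx3 : x ^ (n * k) * n ≤ 2 := by
    have h3 : (n : ℝ) ≤ 2 * Real.exp (n / 2) := by
      have := Real.add_one_le_exp ((n : ℝ) / 2)
      linarith
    calc x ^ (n * k) * n ≤ Real.exp (-(n / 2)) * (2 * Real.exp (n / 2)) :=
          mul_le_mul hx2 h3 (by positivity) (Real.exp_pos _).le
      _ = 2 := by rw [mul_left_comm, ← Real.exp_add]; simp
  have hx4 : 0 ≤ x ^ (n * k) := pow_nonneg hx0 _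
  have h4 : x ^ (n * k) * (kmeansCost p (fun r => p (c r)) - 328 * kmeansCost p ν)
      ≤ x ^ (n * k) * (4 * n * kmeansCost p ν) :=
    mul_le_mul_of_nonneg_left (by linarith) hx4
  have h5 := mul_le_mul_of_nonneg_right hx3 h0
  linarith

end SpectralClustering

namespace RealRAM

open SpectralClustering

/-! ### Running time of programs with loops bounded by the input dimensions -/

/-- The expression for the `j`-th input dimension: `n`, `d`, `k` for `j = 0, 1, 2`. -/
abbrev dim (j : ℕ) : NExp := .get 0 (.const 0) (.const j)

/-- All loops are bounded by input dimensions, which the program does not overwrite. -/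
def Prog.dimBounded : Prog → Bool
  | .skip => true
  | .setN a _ _ _ => a != 0
  | .setR _ _ _ _ => true
  | .seq c c' => c.dimBounded && c'.dimBounded
  | .ite _ c c' => c.dimBounded && c'.dimBounded
  | .loop a (.get 0 (.const 0) (.const j)) c => a != 0 && decide (j < 3) && c.dimBounded
  | .loop _ _ _ => false

open Polynomial in
/-- A bound for the running time of a program with loops bounded by the indeterminate. -/
noncomputable def Prog.timePoly : Prog → ℕ[X]
  | .skip => 1
  | .setN _ i j e => C (i.cost + j.cost + e.cost + 1)
  | .setR _ i j e => C (i.cost + j.cost + e.cost + 1)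
  | .seq c c' => c.timePoly + c'.timePoly
  | .ite b c c' => C (b.cost + 1) + (c.timePoly + c'.timePoly)
  | .loop _ e c => C (e.cost + 1) + X * (c.timePoly + C 2)

lemma Prog.dimBounded_loop {a : ℕ} {e : NExp} {c : Prog}
    (h : (Prog.loop a e c).dimBounded = true) :
    a ≠ 0 ∧ c.dimBounded = true ∧ ∃ j < 3, e = dim j := by
  unfold Prog.dimBounded at h
  split at h <;> simp_all

lemma rounds_induct {a : ℕ} {f : State → State} {s : State} (Inv : ℕ → State → Prop)
    (h0 : Inv 0 s) : ∀ M, (∀ m < M, ∀ s', Inv m s' → Inv (m + 1) (f (s'.writeN a 0 0 m))) →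
    Inv M (rounds a f s M)
  | 0, _ => h0
  | M + 1, h => h M (Nat.lt_succ_self M) _
      (rounds_induct Inv h0 M fun m hm => h m (hm.trans (Nat.lt_succ_self M)))

lemma writeN_N_of_ne (s : State) {a b : ℕ} (h : b ≠ a) (i j v : ℕ) :
    (s.writeN a i j v).N b = s.N b := by
  funext i' j'; simp [State.writeN, h]

lemma writeR_R_of_ne (s : State) {a b : ℕ} (h : b ≠ a) (i j : ℕ) (v : ℝ) :
    (s.writeR a i j v).R b = s.R b := by
  funext i' j'; simp [State.writeR, h]

@[simp] lemma writeN_N_self (s : State) (a i j v : ℕ) : (s.writeN a i j v).N a i j = v := by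
  simp [State.writeN]

@[simp] lemma writeR_R_self (s : State) (a i j : ℕ) (v : ℝ) :
    (s.writeR a i j v).R a i j = v := by
  simp [State.writeR]

@[simp] lemma writeN_R (s : State) (a i j v : ℕ) : (s.writeN a i j v).R = s.R := rfl

@[simp] lemma writeR_N (s : State) (a i j : ℕ) (v : ℝ) : (s.writeR a i j v).N = s.N := rfl

lemma Prog.dims_exec : ∀ (c : Prog), c.dimBounded = true → ∀ s, (c.exec s).N 0 = s.N 0
  | .skip, _, s => rfl
  | .setN a _ _ _, h, s => writeN_N_of_ne s (by
      simp only [Prog.dimBounded, bne_iff_ne] at h; exact h.symm) _ _ _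
  | .setR _ _ _ _, _, s => rfl
  | .seq c c', h, s => by
    simp only [Prog.dimBounded, Bool.and_eq_true] at h
    rw [Prog.exec, dims_exec c' h.2, dims_exec c h.1]
  | .ite b c c', h, s => by
    simp only [Prog.dimBounded, Bool.and_eq_true] at h
    rw [Prog.exec]
    split_ifs
    · exact dims_exec c h.1 s
    · exact dims_exec c' h.2 s
  | .loop a e c, h, s => by
    obtain ⟨ha, hc, -⟩ := Prog.dimBounded_loop h
    rw [Prog.exec]
    refine rounds_induct (fun _ s' => s'.N 0 = s.N 0) rfl _ fun m _ s' hs' => ?_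
    rw [dims_exec c hc, writeN_N_of_ne _ ha.symm, hs']

lemma Prog.time_le {v : ℕ} : ∀ (c : Prog), c.dimBounded = true → ∀ s : State,
    (∀ j < 3, s.N 0 0 j ≤ v) → c.time s ≤ c.timePoly.eval v
  | .skip, _, s, _ => by simp [Prog.time, Prog.timePoly]
  | .setN _ _ _ _, _, s, _ => by simp [Prog.time, Prog.timePoly]
  | .setR _ _ _ _, _, s, _ => by simp [Prog.time, Prog.timePoly]
  | .seq c c', h, s, hs => by
    simp only [Prog.dimBounded, Bool.and_eq_true] at h
    rw [Prog.time, Prog.timePoly, Polynomial.eval_add]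
    exact Nat.add_le_add (time_le c h.1 s hs) (time_le c' h.2 _ (by rwa [c.dims_exec h.1]))
  | .ite b c c', h, s, hs => by
    simp only [Prog.dimBounded, Bool.and_eq_true] at h
    rw [Prog.time, Prog.timePoly, Polynomial.eval_add, Polynomial.eval_add, Polynomial.eval_C]
    have h1 := time_le c h.1 s hs
    have h2 := time_le c' h.2 s hs
    split_ifs <;> omega
  | .loop a e c, h, s, hs => by
    obtain ⟨ha, hc, j, hj, rfl⟩ := Prog.dimBounded_loop h
    rw [Prog.time, Prog.timePoly, Polynomial.eval_add, Polynomial.eval_C, Polynomial.eval_mul,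
      Polynomial.eval_X, Polynomial.eval_add, Polynomial.eval_C]
    refine Nat.add_le_add_left ?_ _
    have hr : ∀ m, (rounds a c.exec s m).N 0 = s.N 0 := fun m =>
      rounds_induct (fun _ s' => s'.N 0 = s.N 0) rfl _ fun m _ s' hs' => by
        rw [c.dims_exec hc, writeN_N_of_ne _ ha.symm, hs']
    refine (Finset.sum_le_card_nsmul _ _ (c.timePoly.eval v + 2) fun m _ =>
      Nat.add_le_add_right (time_le c hc _ ?_) 2).trans ?_
    · rw [writeN_N_of_ne _ ha.symm, hr]; exact hs
    · rw [Finset.card_range, smul_eq_mul]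
      exact Nat.mul_le_mul_right _ (hs j hj)

/-! ### Reasoning about programs -/

/-- The program contains an assignment to the array `N a`. -/
def Prog.writesN (a : ℕ) : Prog → Bool
  | .skip => false
  | .setN b _ _ _ => a == b
  | .setR _ _ _ _ => false
  | .seq c c' => c.writesN a || c'.writesN a
  | .ite _ c c' => c.writesN a || c'.writesN a
  | .loop b _ c => a == b || c.writesN a

/-- The program contains an assignment to the array `R a`. -/
def Prog.writesR (a : ℕ) : Prog → Bool
  | .skip => false
  | .setN _ _ _ _ => false
  | .setR b _ _ _ => a == b
  | .seq c c' => c.writesR a || c'.writesR a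
  | .ite _ c c' => c.writesR a || c'.writesR a
  | .loop _ _ c => c.writesR a

lemma Prog.exec_N {a : ℕ} : ∀ (c : Prog), c.writesN a = false → ∀ s, (c.exec s).N a = s.N a
  | .skip, _, s => rfl
  | .setN b _ _ _, h, s => writeN_N_of_ne s (by simpa [Prog.writesN] using h) _ _ _
  | .setR _ _ _ _, _, s => rfl
  | .seq c c', h, s => by
    simp only [Prog.writesN, Bool.or_eq_false_iff] at h
    rw [Prog.exec, exec_N c' h.2, exec_N c h.1]
  | .ite b c c', h, s => by
    simp only [Prog.writesN, Bool.or_eq_false_iff] at h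
    rw [Prog.exec]
    split_ifs
    · exact exec_N c h.1 s
    · exact exec_N c' h.2 s
  | .loop b e c, h, s => by
    simp only [Prog.writesN, Bool.or_eq_false_iff, beq_eq_false_iff_ne] at h
    rw [Prog.exec]
    refine rounds_induct (fun _ s' => s'.N a = s.N a) rfl _ fun m _ s' hs' => ?_
    rw [exec_N c h.2, writeN_N_of_ne _ h.1, hs']

lemma Prog.exec_R {a : ℕ} : ∀ (c : Prog), c.writesR a = false → ∀ s, (c.exec s).R a = s.R a
  | .skip, _, s => rfl
  | .setN _ _ _ _, _, s => rfl
  | .setR b _ _ _, h, s => writeR_R_of_ne s (by simpa [Prog.writesR] using h) _ _ _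
  | .seq c c', h, s => by
    simp only [Prog.writesR, Bool.or_eq_false_iff] at h
    rw [Prog.exec, exec_R c' h.2, exec_R c h.1]
  | .ite b c c', h, s => by
    simp only [Prog.writesR, Bool.or_eq_false_iff] at h
    rw [Prog.exec]
    split_ifs
    · exact exec_R c h.1 s
    · exact exec_R c' h.2 s
  | .loop b e c, h, s => by
    simp only [Prog.writesR] at h
    rw [Prog.exec]
    refine rounds_induct (fun _ s' => s'.R a = s.R a) rfl _ fun m _ s' hs' => ?_
    rw [exec_R c h, writeN_R, hs']

/-- The state `s'` differs from `s` at most in the arrays assigned by the program `c`. -/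
def Frame (c : Prog) (s s' : State) : Prop :=
  (∀ a, c.writesN a = false → s'.N a = s.N a) ∧ ∀ a, c.writesR a = false → s'.R a = s.R a

lemma Frame.refl (c : Prog) (s : State) : Frame c s s := ⟨fun _ _ => rfl, fun _ _ => rfl⟩

lemma Frame.trans_exec {c c' : Prog} {s s' : State} (h : Frame c s s')
    (hN : ∀ a, c.writesN a = false → c'.writesN a = false)
    (hR : ∀ a, c.writesR a = false → c'.writesR a = false) : Frame c s (c'.exec s') :=
  ⟨fun a ha => (c'.exec_N (hN a ha) s').trans (h.1 a ha),
    fun a ha => (c'.exec_R (hR a ha) s').trans (h.2 a ha)⟩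

lemma Frame.loop_writeN {b : ℕ} {e : NExp} {c : Prog} {s s' : State}
    (h : Frame (.loop b e c) s s') (m : ℕ) : Frame (.loop b e c) s (s'.writeN b 0 0 m) :=
  ⟨fun a ha => by
    have hab : a ≠ b := by
      simp only [Prog.writesN, Bool.or_eq_false_iff, beq_eq_false_iff_ne] at ha; exact ha.1
    rw [writeN_N_of_ne _ hab, h.1 a ha], fun a ha => h.2 a ha⟩

/-- Loop invariants, with the frame condition for free. -/
lemma loop_induct {b j : ℕ} {c : Prog} {s : State} (Inv : ℕ → State → Prop) (h0 : Inv 0 s)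
    (hstep : ∀ m < s.N 0 0 j, ∀ s', Frame (.loop b (dim j) c) s s' → Inv m s' →
      Inv (m + 1) (c.exec (s'.writeN b 0 0 m))) :
    Inv (s.N 0 0 j) ((Prog.loop b (dim j) c).exec s) := by
  have := rounds_induct (a := b) (f := c.exec) (s := s)
    (fun m s' => Frame (.loop b (dim j) c) s s' ∧ Inv m s') ⟨Frame.refl _ _, h0⟩ (s.N 0 0 j)
    fun m hm s' hs' => ⟨(hs'.1.loop_writeN m).trans_exec
      (fun a ha => by simp only [Prog.writesN, Bool.or_eq_false_iff] at ha; exact ha.2)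
      (fun a ha => ha), hstep m hm s' hs'.1 hs'.2⟩
  exact this.2

/-- The scalar variable `N a 0 0`. -/
abbrev nv (a : ℕ) : NExp := .get a (.const 0) (.const 0)

/-- The scalar variable `R a 0 0`. -/
abbrev rv (a : ℕ) : RExp := .get a (.const 0) (.const 0)

/-- `R t 0 0 := ∑ x` over the values of the counter `c` below the `j`-th dimension. -/
def sumP (c j t : ℕ) (x : RExp) : Prog :=
  .seq (.setR t (.const 0) (.const 0) (.const 0))
    (.loop c (dim j) (.setR t (.const 0) (.const 0) (.add (rv t) x)))

lemma sumP_spec {c j t : ℕ} {x : RExp} {s : State} (f : ℕ → ℝ)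
    (h : ∀ l < s.N 0 0 j, ∀ s' : State, (∀ a ≠ c, s'.N a = s.N a) → (∀ a ≠ t, s'.R a = s.R a) →
      s'.N c 0 0 = l → x.eval s' = f l) :
    ((sumP c j t x).exec s).R t 0 0 = ∑ l ∈ Finset.range (s.N 0 0 j), f l := by
  rw [sumP, Prog.exec]
  set s1 := (Prog.setR t (.const 0) (.const 0) (.const 0)).exec s with hs1
  have h1 : s1.R t 0 0 = 0 := by simp [hs1, Prog.exec, NExp.eval, RExp.eval]
  have h2 : ∀ a ≠ t, s1.R a = s.R a := fun a ha => writeR_R_of_ne _ ha _ _ _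
  have h3 : s1.N = s.N := rfl
  refine loop_induct (s := s1) (fun m s' => s'.R t 0 0 = ∑ l ∈ Finset.range m, f l)
    (by simpa using h1) fun m hm s' hF hs' => ?_
  rw [Prog.exec]
  simp only [NExp.eval, RExp.eval, writeR_R_self, writeN_R]
  rw [hs', Finset.sum_range_succ]
  congr 1
  refine h m hm _ (fun a ha => ?_) (fun a ha => ?_) (writeN_N_self _ _ _ _ _)
  · rw [writeN_N_of_ne _ ha, hF.1 a (by simp [Prog.writesN, ha]), h3]
  · rw [writeN_R, hF.2 a (by simp [Prog.writesR, ha]), h2 a ha]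

/-- `N b 0 0` becomes an index below the `j`-th dimension that minimizes `x`, where the counter `c`
plays the role of the index, and `R v 0 0` the minimum. -/
def minP (c j b v : ℕ) (x : RExp) : Prog :=
  .seq (.setN b (.const 0) (.const 0) (.const 0))
    (.seq (.setN c (.const 0) (.const 0) (.const 0))
      (.seq (.setR v (.const 0) (.const 0) x)
        (.loop c (dim j) (.ite (.rlt x (rv v))
          (.seq (.setR v (.const 0) (.const 0) x) (.setN b (.const 0) (.const 0) (nv c))) .skip))))

lemma minP_spec {c j b v : ℕ} {x : RExp} {s : State} (f : ℕ → ℝ) (hcb : c ≠ b) (hc : c ≠ 0)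
    (hb : b ≠ 0) (h : ∀ l, l = 0 ∨ l < s.N 0 0 j → ∀ s' : State,
      (∀ a, a ≠ c → a ≠ b → s'.N a = s.N a) →
      (∀ a ≠ v, s'.R a = s.R a) → s'.N c 0 0 = l → x.eval s' = f l) :
    let s' := (minP c j b v x).exec s
    s'.R v 0 0 = f (s'.N b 0 0) ∧ (∀ l < s.N 0 0 j, f (s'.N b 0 0) ≤ f l) ∧
      (s'.N b 0 0 = 0 ∨ s'.N b 0 0 < s.N 0 0 j) := by
  simp only [minP, Prog.exec]
  set s1 := ((s.writeN b 0 0 0).writeN c 0 0 0) with hs1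
  have e1 : ((s.writeN b ((NExp.const 0).eval s) ((NExp.const 0).eval s)
      ((NExp.const 0).eval s)).writeN c 0 0 0) = s1 := rfl
  have hN1 : ∀ a, a ≠ c → a ≠ b → s1.N a = s.N a := fun a h1 h2 => by
    rw [hs1, writeN_N_of_ne _ h1, writeN_N_of_ne _ h2]
  set s2 := s1.writeR v 0 0 (x.eval s1) with hs2
  have hx1 : x.eval s1 = f 0 := h 0 (Or.inl rfl) s1 hN1 (fun a _ => rfl) (writeN_N_self _ _ _ _ _)
  have hR2 : ∀ a ≠ v, s2.R a = s.R a := fun a ha => by rw [hs2, writeR_R_of_ne _ ha]; rfl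
  have hdim : s2.N 0 0 j = s.N 0 0 j := by
    change s1.N 0 0 j = _
    rw [hN1 0 hc.symm hb.symm]
  have key := loop_induct (s := s2) (b := c) (j := j)
    (c := .ite (.rlt x (rv v))
          (.seq (.setR v (.const 0) (.const 0) x) (.setN b (.const 0) (.const 0) (nv c))) .skip)
    (fun m s' => s'.R v 0 0 = f (s'.N b 0 0) ∧ (∀ l < m, f (s'.N b 0 0) ≤ f l) ∧
      (s'.N b 0 0 = 0 ∨ s'.N b 0 0 < s.N 0 0 j)) ?_ ?_
  · rw [hdim] at key
    exact key
  · have hb0 : s2.N b 0 0 = 0 := by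
      change s1.N b 0 0 = 0
      rw [hs1, writeN_N_of_ne _ hcb.symm, writeN_N_self]
    refine ⟨?_, by simp, Or.inl hb0⟩
    rw [hb0, hs2, writeR_R_self, hx1]
  · intro m hm s' hF ⟨i1, i2, i3⟩
    have hxm : x.eval (s'.writeN c 0 0 m) = f m := by
      refine h m (Or.inr (hdim ▸ hm)) _ (fun a ha hab => ?_) (fun a ha => ?_)
        (writeN_N_self _ _ _ _ _)
      · rw [writeN_N_of_ne _ ha, hF.1 a (by simp [Prog.writesN, ha, hab])]
        exact hN1 a ha hab
      · rw [writeN_R, hF.2 a (by simp [Prog.writesR, ha]), hR2 a ha]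
    have hbv : (s'.writeN c 0 0 m).N b = s'.N b := writeN_N_of_ne _ hcb.symm _ _ _
    rw [Prog.exec]
    simp only [BExp.eval, RExp.eval, NExp.eval, hxm, writeN_R]
    split_ifs with hlt
    · simp only [Prog.exec, NExp.eval, hxm, writeN_R, writeR_R_self, writeN_N_self, writeR_N]
      refine ⟨trivial, fun l hl => ?_, Or.inr (hdim ▸ hm)⟩
      rcases Nat.lt_succ_iff_lt_or_eq.1 hl with hl | rfl
      · exact hlt.le.trans (i1 ▸ i2 l hl)
      · exact le_rfl
    · simp only [Prog.exec, writeN_R, hbv]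
      refine ⟨i1, fun l hl => ?_, i3⟩
      rcases Nat.lt_succ_iff_lt_or_eq.1 hl with hl | rfl
      · exact i2 l hl
      · rw [← i1]; exact not_lt.1 hlt

/-- `R t row i := x`, computed after running `body`, for the values `i` of the counter `c` below the
`j`-th dimension. -/
def mapR1 (c j t : ℕ) (row : NExp) (body : Prog) (x : RExp) : Prog :=
  .loop c (dim j) (.seq body (.setR t row (nv c) x))

lemma mapR1_spec {c j t : ℕ} {row : NExp} {body : Prog} {x : RExp} {s : State} (ρ : ℕ)
    (val : ℕ → ℝ) (hbc : body.writesN c = false) (hbt : body.writesR t = false)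
    (h : ∀ i < s.N 0 0 j, ∀ s' : State, Frame (mapR1 c j t row body x) s s' → s'.N c 0 0 = i →
      s'.R t ρ i = s.R t ρ i → row.eval (body.exec s') = ρ ∧ x.eval (body.exec s') = val i) :
    let s' := (mapR1 c j t row body x).exec s
    (∀ i < s.N 0 0 j, s'.R t ρ i = val i) ∧ ∀ r ≠ ρ, ∀ i, s'.R t r i = s.R t r i := by
  have key := loop_induct (s := s) (b := c) (j := j) (c := .seq body (.setR t row (nv c) x))
    (fun m s' => (∀ i < m, s'.R t ρ i = val i) ∧ (∀ i, m ≤ i → s'.R t ρ i = s.R t ρ i) ∧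
      ∀ r ≠ ρ, ∀ i, s'.R t r i = s.R t r i)
    ⟨by simp, fun _ _ => rfl, fun _ _ _ => rfl⟩ ?_
  · exact ⟨key.1, key.2.2⟩
  · intro m hm s' hF ⟨i1, i2, i3⟩
    set s1 := s'.writeN c 0 0 m with hs1
    have hRt : (body.exec s1).R t = s'.R t := body.exec_R hbt s1
    have hNc : (body.exec s1).N c 0 0 = m := by rw [body.exec_N hbc, hs1, writeN_N_self]
    obtain ⟨hrow, hx⟩ := h m hm s1 (hF.loop_writeN m) (writeN_N_self _ _ _ _ _) (i2 m le_rfl)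
    rw [Prog.exec, Prog.exec, hrow, hx]
    simp only [NExp.eval, hNc]
    have hval : ∀ r i, ((body.exec s1).writeR t ρ m (val m)).R t r i
        = if r = ρ ∧ i = m then val m else s'.R t r i := fun r i => by
      rw [← hRt]; simp [State.writeR]
    refine ⟨fun i hi => ?_, fun i hi => ?_, fun r hr i => ?_⟩
    · rw [hval]
      split_ifs with hc
      · rw [hc.2]
      · exact i1 i (by omega)
    · rw [hval, if_neg (by omega)]
      exact i2 i (by omega)
    · rw [hval, if_neg (by tauto)]
      exact i3 r hr i

/-- `R t i i' := x`, computed after running `body`, for all values `i`, `i'` of the counters `c`,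
`c'` below the `j`-th and the `j'`-th dimension. -/
def mapR2 (c j c' j' t : ℕ) (body : Prog) (x : RExp) : Prog :=
  .loop c (dim j) (mapR1 c' j' t (nv c) body x)

lemma mapR2_spec {c j c' j' t : ℕ} {body : Prog} {x : RExp} {s : State} (val : ℕ → ℕ → ℝ)
    (hc0 : c ≠ 0) (hc0' : c' ≠ 0) (hcc : c ≠ c') (hb0 : body.writesN 0 = false)
    (hbc : body.writesN c = false) (hbc' : body.writesN c' = false) (hbt : body.writesR t = false)
    (h : ∀ i < s.N 0 0 j, ∀ i' < s.N 0 0 j', ∀ s' : State, Frame (mapR2 c j c' j' t body x) s s' →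
      s'.N c 0 0 = i → s'.N c' 0 0 = i' → s'.R t i i' = s.R t i i' →
      x.eval (body.exec s') = val i i') :
    ∀ i < s.N 0 0 j, ∀ i' < s.N 0 0 j',
      ((mapR2 c j c' j' t body x).exec s).R t i i' = val i i' := by
  have key := loop_induct (s := s) (b := c) (j := j) (c := mapR1 c' j' t (nv c) body x)
    (fun m s' => (∀ i < m, ∀ i' < s.N 0 0 j', s'.R t i i' = val i i') ∧
      ∀ i, m ≤ i → ∀ i', s'.R t i i' = s.R t i i')
    ⟨by simp, fun _ _ _ => rfl⟩ ?_
  · exact key.1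
  · intro m hm s' hF ⟨i1, i2⟩
    set s1 := s'.writeN c 0 0 m with hs1
    have hF1 : Frame (mapR2 c j c' j' t body x) s s1 := hF.loop_writeN m
    have hd : s1.N 0 0 j' = s.N 0 0 j' := by
      rw [hF1.1 0 (by simp [mapR2, mapR1, Prog.writesN, hc0.symm, hc0'.symm, hb0])]
    have hcw : (mapR1 c' j' t (nv c) body x).writesN c = false := by
      simp [mapR1, Prog.writesN, hcc, hbc]
    obtain ⟨k1, k2⟩ := mapR1_spec (s := s1) (row := nv c) (x := x) m (val m) hbc' hbt (by
      intro i hi s2 hF2 hi2 ho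
      have hc2 : s2.N c 0 0 = m := by rw [hF2.1 c hcw, hs1, writeN_N_self]
      refine ⟨by simp only [NExp.eval]; rw [body.exec_N hbc, hc2], ?_⟩
      refine h m hm i (hd ▸ hi) s2 ⟨fun a ha => ?_, fun a ha => ?_⟩ hc2 hi2 ?_
      · rw [hF2.1 a (by
          simp only [mapR2, Prog.writesN, Bool.or_eq_false_iff] at ha; exact ha.2), hF1.1 a ha]
      · rw [hF2.2 a ha, hF1.2 a ha]
      · rw [ho]; exact i2 m le_rfl i)
    rw [hd] at k1
    refine ⟨fun i hi i' hi' => ?_, fun i hi i' => ?_⟩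
    · rcases Nat.lt_succ_iff_lt_or_eq.1 hi with hi | rfl
      · rw [k2 i (by omega)]; exact i1 i hi i' hi'
      · exact k1 i' hi'
    · rw [k2 i (by omega)]; exact i2 i (by omega) i'

/-- `N t 0 i := x`, computed after running `body`, for the values `i` of the counter `c` below the
`j`-th dimension. -/
def mapN1 (c j t : ℕ) (body : Prog) (x : NExp) : Prog :=
  .loop c (dim j) (.seq body (.setN t (.const 0) (nv c) x))

lemma mapN1_spec {c j t : ℕ} {body : Prog} {x : NExp} {s : State} (Q : ℕ → ℕ → Prop)
    (hct : c ≠ t) (hbc : body.writesN c = false) (hbt : body.writesN t = false)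
    (h : ∀ i < s.N 0 0 j, ∀ s' : State, Frame (mapN1 c j t body x) s s' → s'.N c 0 0 = i →
      Q i (x.eval (body.exec s'))) :
    ∀ i < s.N 0 0 j, Q i (((mapN1 c j t body x).exec s).N t 0 i) := by
  refine loop_induct (s := s) (b := c) (j := j) (fun m s' => ∀ i < m, Q i (s'.N t 0 i))
    (by simp) ?_
  intro m hm s' hF i1 i hi
  set s1 := s'.writeN c 0 0 m with hs1
  have hNt : (body.exec s1).N t = s'.N t := by
    rw [body.exec_N hbt, hs1, writeN_N_of_ne _ hct.symm]
  have hNc : (body.exec s1).N c 0 0 = m := by rw [body.exec_N hbc, hs1, writeN_N_self]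
  have hx := h m hm s1 (hF.loop_writeN m) (writeN_N_self _ _ _ _ _)
  rw [Prog.exec, Prog.exec]
  simp only [NExp.eval, hNc]
  have hval : ((body.exec s1).writeN t 0 m (x.eval (body.exec s1))).N t 0 i
      = if i = m then x.eval (body.exec s1) else s'.N t 0 i := by
    rw [← hNt]; simp [State.writeN]
  rw [hval]
  split_ifs with hc
  · rw [hc]; exact hx
  · exact i1 i (by omega)

variable {n d k : ℕ}

/-! ### Program: the projection -/

/-- The memory holds the dimensions `n`, `d`, `k`. -/
def Dims (n d k : ℕ) (s : State) : Prop := s.N 0 0 0 = n ∧ s.N 0 0 1 = d ∧ s.N 0 0 2 = k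

lemma Dims.congr {s s' : State} (h : Dims n d k s) (h' : s'.N 0 = s.N 0) : Dims n d k s' := by
  unfold Dims at *; rwa [h']

/-- The two-dimensional array `f` holds the matrix `M`. -/
def Stores {a b : ℕ} (f : ℕ → ℕ → ℝ) (M : Matrix (Fin a) (Fin b) ℝ) : Prop :=
  ∀ (i : Fin a) (j : Fin b), f i j = M i j

/-- The point of `ℝ^d` with the coordinates `f 0, …, f (d - 1)`. -/
def vec (d : ℕ) (f : ℕ → ℝ) : Pt d := WithLp.toLp 2 fun l : Fin d => f l

lemma inner_vec (f g : ℕ → ℝ) :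
    inner ℝ (vec d f) (vec d g) = ∑ l ∈ Finset.range d, f l * g l := by
  rw [Finset.sum_range]
  simp [vec, PiLp.inner_apply, mul_comm]

lemma norm_vec_sub_sq (f g : ℕ → ℝ) :
    ‖vec d f - vec d g‖ ^ 2 = ∑ l ∈ Finset.range d, (f l - g l) * (f l - g l) := by
  rw [Finset.sum_range, EuclideanSpace.norm_sq_eq]
  simp [vec, sq]

lemma norm_vec_sq (f : ℕ → ℝ) : ‖vec d f‖ ^ 2 = ∑ l ∈ Finset.range d, f l * f l := by
  rw [← real_inner_self_eq_norm_sq, inner_vec]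

lemma Stores.vec_eq {f : ℕ → ℕ → ℝ} {M : Matrix (Fin n) (Fin d) ℝ} (h : Stores f M) (i : Fin n) :
    vec d (f i) = row M i := by
  ext l; exact h i l

/-- `R 1 := AᵀA`. -/
def gramP : Prog :=
  mapR2 10 1 11 1 1
    (sumP 12 0 8 (.mul (.get 0 (nv 12) (nv 10)) (.get 0 (nv 12) (nv 11)))) (rv 8)

lemma gramP_spec {s : State} (hs : Dims n d k s) {A : Matrix (Fin n) (Fin d) ℝ}
    (hA : Stores (s.R 0) A) : Stores ((gramP.exec s).R 1) (Aᵀ * A) := by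
  intro i j
  rw [gramP, mapR2_spec (fun i j => ∑ l ∈ Finset.range n, s.R 0 l i * s.R 0 l j) (by decide)
    (by decide) (by decide) rfl rfl rfl rfl ?_ i (by rw [hs.2.1]; exact i.2) j
    (by rw [hs.2.1]; exact j.2)]
  · rw [Finset.sum_range, Matrix.mul_apply]
    exact Finset.sum_congr rfl fun l _ => by rw [hA l i, hA l j, Matrix.transpose_apply]
  · intro i _ j _ s' hF hi hj _
    have h0 : s'.N 0 0 0 = n := by rw [hF.1 0 rfl]; exact hs.1
    have h1 := hF.2 0 rfl
    refine (sumP_spec (fun l => s.R 0 l i * s.R 0 l j) ?_).trans (by rw [h0])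
    intro l _ s'' hN hR hl
    simp only [RExp.eval, NExp.eval, hl, hN 10 (by decide), hN 11 (by decide),
      hR 0 (by decide), hi, hj, h1]

/-- `R 1 := R 1 * R 1`. -/
def squareP : Prog :=
  .seq (mapR2 10 1 11 1 2
    (sumP 12 1 8 (.mul (.get 1 (nv 10) (nv 12)) (.get 1 (nv 12) (nv 11)))) (rv 8))
    (mapR2 10 1 11 1 1 .skip (.get 2 (nv 10) (nv 11)))

lemma squareP_spec {s : State} (hs : Dims n d k s) {M : Matrix (Fin d) (Fin d) ℝ}
    (hM : Stores (s.R 1) M) : Stores ((squareP.exec s).R 1) (M * M) := by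
  intro i j
  rw [squareP, Prog.exec]
  set P := mapR2 10 1 11 1 2
    (sumP 12 1 8 (.mul (.get 1 (nv 10) (nv 12)) (.get 1 (nv 12) (nv 11)))) (rv 8) with hP
  have h1 : ∀ i < s.N 0 0 1, ∀ j < s.N 0 0 1,
      (P.exec s).R 2 i j = ∑ l ∈ Finset.range d, s.R 1 i l * s.R 1 l j := by
    refine mapR2_spec (fun i j => ∑ l ∈ Finset.range d, s.R 1 i l * s.R 1 l j) (by decide)
      (by decide) (by decide) rfl rfl rfl rfl ?_
    intro i _ j _ s' hF hi hj _
    have h0 : s'.N 0 0 1 = d := by rw [hF.1 0 rfl]; exact hs.2.1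
    have h1 := hF.2 1 rfl
    refine (sumP_spec (fun l => s.R 1 i l * s.R 1 l j) ?_).trans (by rw [h0])
    intro l _ s'' hN hR hl
    simp only [RExp.eval, NExp.eval, hl, hN 10 (by decide), hN 11 (by decide),
      hR 1 (by decide), hi, hj, h1]
  have hs1 : Dims n d k (P.exec s) := hs.congr (P.exec_N rfl s)
  rw [mapR2_spec (s := P.exec s) (fun i j => (P.exec s).R 2 i j) (by decide)
    (by decide) (by decide) rfl rfl rfl rfl ?_ i (by rw [hs1.2.1]; exact i.2) j
    (by rw [hs1.2.1]; exact j.2)]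
  · rw [h1 i (by rw [hs.2.1]; exact i.2) j (by rw [hs.2.1]; exact j.2), Finset.sum_range,
      Matrix.mul_apply]
    exact Finset.sum_congr rfl fun l _ => by rw [hM i l, hM l j]
  · intro i _ j _ s' hF hi hj _
    simp only [Prog.exec, RExp.eval, NExp.eval, hi, hj, hF.2 2 rfl]

/-- `R 1 := gramPower A` by repeated squaring. -/
def powerP : Prog := .seq gramP (.loop 13 (dim 1) squareP)

lemma powerP_spec {s : State} (hs : Dims n d k s) {A : Matrix (Fin n) (Fin d) ℝ}
    (hA : Stores (s.R 0) A) : Stores ((powerP.exec s).R 1) (gramPower A) := by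
  rw [powerP, Prog.exec]
  have hs1 : Dims n d k (gramP.exec s) := hs.congr (gramP.exec_N rfl s)
  have key := loop_induct (s := gramP.exec s) (b := 13) (j := 1) (c := squareP)
    (fun m s' => Stores (s'.R 1) ((Aᵀ * A) ^ (2 ^ m))) ?_ ?_
  · rw [hs1.2.1] at key
    exact key
  · simpa using gramP_spec hs hA
  · intro m _ s' hF hI
    have hs2 : Dims n d k (s'.writeN 13 0 0 m) :=
      hs1.congr (by rw [writeN_N_of_ne _ (by decide), hF.1 0 rfl])
    have := squareP_spec hs2 (M := (Aᵀ * A) ^ (2 ^ m)) hI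
    rwa [← pow_add, ← two_mul, ← pow_succ'] at this

/-- Subtract from each of the first `j`-th dimension many rows of `R t` its component along the
vector in `R 3 0`. -/
def eliminateP (t j : ℕ) : Prog :=
  .seq (mapR1 10 j 9 (.const 0)
    (.seq (sumP 11 1 8 (.mul (.get t (nv 10) (nv 11)) (.get 3 (.const 0) (nv 11))))
      (sumP 11 1 12 (.mul (.get 3 (.const 0) (nv 11)) (.get 3 (.const 0) (nv 11)))))
    (.div (rv 8) (rv 12)))
    (mapR2 10 j 11 1 t .skip
      (.sub (.get t (nv 10) (nv 11)) (.mul (.get 9 (.const 0) (nv 10)) (.get 3 (.const 0) (nv 11)))))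

lemma eliminateP_spec {t j : ℕ} (ht : t = 1 ∨ t = 4) {s : State} (hs : Dims n d k s) :
    ∀ i < s.N 0 0 j, vec d (((eliminateP t j).exec s).R t i) = vec d (s.R t i)
      - (inner ℝ (vec d (s.R t i)) (vec d (s.R 3 0)) /
          inner ℝ (vec d (s.R 3 0)) (vec d (s.R 3 0))) • vec d (s.R 3 0) := by
  rw [eliminateP, Prog.exec]
  set P := mapR1 10 j 9 (.const 0)
    (.seq (sumP 11 1 8 (.mul (.get t (nv 10) (nv 11)) (.get 3 (.const 0) (nv 11))))
      (sumP 11 1 12 (.mul (.get 3 (.const 0) (nv 11)) (.get 3 (.const 0) (nv 11)))))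
    (.div (rv 8) (rv 12)) with hP
  have ht8 : t ≠ 8 := by omega
  have hPt : P.writesR t = false := by rcases ht with rfl | rfl <;> rfl
  have h9 := (mapR1_spec (c := 10) (j := j) (t := 9) (row := .const 0) (s := s)
    (body := .seq (sumP 11 1 8 (.mul (.get t (nv 10) (nv 11)) (.get 3 (.const 0) (nv 11))))
      (sumP 11 1 12 (.mul (.get 3 (.const 0) (nv 11)) (.get 3 (.const 0) (nv 11)))))
    (x := .div (rv 8) (rv 12)) 0
    (fun i => inner ℝ (vec d (s.R t i)) (vec d (s.R 3 0)) /
          inner ℝ (vec d (s.R 3 0)) (vec d (s.R 3 0))) rfl rfl (by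
      intro i _ s' hF hi _
      have h0 : s'.N 0 0 1 = d := by rw [hF.1 0 rfl]; exact hs.2.1
      have h3 := hF.2 3 rfl
      have ht' : s'.R t = s.R t := hF.2 t hPt
      refine ⟨rfl, ?_⟩
      rw [Prog.exec]
      set Q := sumP 11 1 8 (.mul (.get t (nv 10) (nv 11)) (.get 3 (.const 0) (nv 11))) with hQ
      have e1 : (Q.exec s').R 8 0 0 = inner ℝ (vec d (s.R t i)) (vec d (s.R 3 0)) := by
        rw [inner_vec, hQ, sumP_spec (fun l => s.R t i l * s.R 3 0 l), h0]
        intro l _ s'' hN hR hl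
        simp only [RExp.eval, NExp.eval, hl, hN 10 (by decide), hR t ht8, hR 3 (by decide), hi,
          h3, ht']
      have h0' : (Q.exec s').N 0 0 1 = d := by rw [Q.exec_N rfl, h0]
      have h3' : (Q.exec s').R 3 = s.R 3 := by rw [Q.exec_R rfl, h3]
      set Q' := sumP 11 1 12 (.mul (.get 3 (.const 0) (nv 11)) (.get 3 (.const 0) (nv 11))) with hQ'
      have e2 : (Q'.exec (Q.exec s')).R 12 0 0
          = inner ℝ (vec d (s.R 3 0)) (vec d (s.R 3 0)) := by
        rw [inner_vec, hQ', sumP_spec (fun l => s.R 3 0 l * s.R 3 0 l), h0']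
        intro l _ s'' hN hR hl
        simp only [RExp.eval, NExp.eval, hl, hR 3 (by decide), h3']
      have e3 : (Q'.exec (Q.exec s')).R 8 = (Q.exec s').R 8 := Q'.exec_R rfl _
      simp only [RExp.eval, NExp.eval, e2, e3, e1])).1
  have hs1 : Dims n d k (P.exec s) := hs.congr (P.exec_N rfl s)
  have ht1 : (P.exec s).R t = s.R t := P.exec_R hPt s
  have h31 : (P.exec s).R 3 = s.R 3 := P.exec_R rfl s
  intro i hi
  ext l
  refine (mapR2_spec (s := P.exec s) (c := 10) (j := j) (c' := 11) (j' := 1)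
    (fun i l => s.R t i l - (P.exec s).R 9 0 i * s.R 3 0 l) (by decide)
    (by decide) (by decide) rfl rfl rfl rfl ?_ i (by rwa [P.exec_N rfl]) l
    (by rw [hs1.2.1]; exact l.2)).trans ?_
  · intro i _ l _ s' hF hi hl ho
    have h9' : s'.R 9 = (P.exec s).R 9 := hF.2 9 (by rcases ht with rfl | rfl <;> rfl)
    have h3' : s'.R 3 = (P.exec s).R 3 := hF.2 3 (by rcases ht with rfl | rfl <;> rfl)
    simp only [Prog.exec, RExp.eval, NExp.eval, hi, hl, ho, h9', h3', h31, ht1]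
  · rw [h9 i hi]
    rfl

/-- One step of pivoted Gram–Schmidt on the rows of `R 1`, applied to the rows of `R 4`, too. -/
def gramSchmidtStepP : Prog :=
  .seq (mapR1 10 1 9 (.const 0)
      (sumP 11 1 8 (.mul (.get 1 (nv 10) (nv 11)) (.get 1 (nv 10) (nv 11))))
      (.sub (.const 0) (rv 8)))
    (.seq (minP 10 1 20 12 (.get 9 (.const 0) (nv 10)))
      (.seq (mapR1 10 1 3 (.const 0) .skip (.get 1 (nv 20) (nv 10)))
        (.seq (eliminateP 1 1) (eliminateP 4 0))))

lemma gramSchmidtStepP_spec {s : State} (hs : Dims n d k s) :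
    let s' := gramSchmidtStepP.exec s
    ∃ p, (p = 0 ∨ p < d) ∧ (∀ j < d, ‖vec d (s.R 1 j)‖ ≤ ‖vec d (s.R 1 p)‖) ∧
      (∀ j < d, vec d (s'.R 1 j) = vec d (s.R 1 j)
        - (inner ℝ (vec d (s.R 1 j)) (vec d (s.R 1 p)) /
          inner ℝ (vec d (s.R 1 p)) (vec d (s.R 1 p))) • vec d (s.R 1 p)) ∧
      (∀ i < n, vec d (s'.R 4 i) = vec d (s.R 4 i)
        - (inner ℝ (vec d (s.R 4 i)) (vec d (s.R 1 p)) /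
          inner ℝ (vec d (s.R 1 p)) (vec d (s.R 1 p))) • vec d (s.R 1 p)) := by
  rw [gramSchmidtStepP]
  simp only [Prog.exec]
  set P1 := mapR1 10 1 9 (.const 0)
      (sumP 11 1 8 (.mul (.get 1 (nv 10) (nv 11)) (.get 1 (nv 10) (nv 11))))
      (.sub (.const 0) (rv 8)) with hP1
  set P2 := minP 10 1 20 12 (.get 9 (.const 0) (nv 10)) with hP2
  set P3 := mapR1 10 1 3 (.const 0) .skip (.get 1 (nv 20) (nv 10)) with hP3
  set s1 := P1.exec s with hs1
  set s2 := P2.exec s1 with hs2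
  set s3 := P3.exec s2 with hs3
  set s4 := (eliminateP 1 1).exec s3 with hs4
  have d1 : Dims n d k s1 := hs.congr (P1.exec_N rfl s)
  have d2 : Dims n d k s2 := d1.congr (P2.exec_N rfl s1)
  have d3 : Dims n d k s3 := d2.congr (P3.exec_N rfl s2)
  have d4 : Dims n d k s4 := d3.congr ((eliminateP 1 1).exec_N rfl s3)
  have h9 : ∀ j < d, s1.R 9 0 j = - ‖vec d (s.R 1 j)‖ ^ 2 := by
    have := (mapR1_spec (c := 10) (j := 1) (t := 9) (row := .const 0) (s := s)
      (body := sumP 11 1 8 (.mul (.get 1 (nv 10) (nv 11)) (.get 1 (nv 10) (nv 11))))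
      (x := .sub (.const 0) (rv 8)) 0 (fun j => - ‖vec d (s.R 1 j)‖ ^ 2) rfl rfl (by
        intro i _ s' hF hi _
        have h0 : s'.N 0 0 1 = d := by rw [hF.1 0 rfl]; exact hs.2.1
        have h1 := hF.2 1 rfl
        refine ⟨rfl, ?_⟩
        simp only [RExp.eval, NExp.eval]
        rw [norm_vec_sq, sumP_spec (fun l => s.R 1 i l * s.R 1 i l), h0]
        · simp
        · intro l _ s'' hN hR hl
          simp only [RExp.eval, NExp.eval, hl, hN 10 (by decide), hR 1 (by decide), hi, h1])).1
    rwa [hs.2.1] at this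
  obtain ⟨-, m2, m3⟩ := minP_spec (c := 10) (j := 1) (b := 20) (v := 12)
    (x := .get 9 (.const 0) (nv 10)) (s := s1) (fun l => s1.R 9 0 l) (by decide) (by decide)
    (by decide) (by
      intro l _ s' _ hR hl
      simp only [RExp.eval, NExp.eval, hl, hR 9 (by decide)])
  rw [d1.2.1] at m2 m3
  change ∀ l < d, s1.R 9 0 (s2.N 20 0 0) ≤ s1.R 9 0 l at m2
  change s2.N 20 0 0 = 0 ∨ s2.N 20 0 0 < d at m3
  set p := s2.N 20 0 0 with hp
  have h3 : ∀ l < d, s3.R 3 0 l = s2.R 1 p l := by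
    have := (mapR1_spec (c := 10) (j := 1) (t := 3) (row := .const 0) (s := s2)
      (body := .skip) (x := .get 1 (nv 20) (nv 10)) 0 (fun l => s2.R 1 p l) rfl rfl (by
        intro i _ s' hF hi _
        refine ⟨rfl, ?_⟩
        simp only [Prog.exec, RExp.eval, NExp.eval, hi, hF.2 1 rfl, hF.1 20 rfl, hp])).1
    rwa [d2.2.1] at this
  have r2 : s2.R 1 = s.R 1 := by rw [hs2, P2.exec_R rfl, hs1, P1.exec_R rfl]
  have r3 : s3.R 1 = s.R 1 := by rw [hs3, P3.exec_R rfl, r2]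
  have r3' : s3.R 4 = s.R 4 := by
    rw [hs3, P3.exec_R rfl, hs2, P2.exec_R rfl, hs1, P1.exec_R rfl]
  have r4 : s4.R 4 = s.R 4 := by rw [hs4, (eliminateP 1 1).exec_R rfl, r3']
  have r43 : s4.R 3 = s3.R 3 := by rw [hs4, (eliminateP 1 1).exec_R rfl]
  have hw : vec d (s3.R 3 0) = vec d (s.R 1 p) := by
    ext l
    change s3.R 3 0 l = s.R 1 p l
    rw [h3 l l.2, r2]
  refine ⟨p, m3, fun j hj => ?_, fun j hj => ?_, fun i hi => ?_⟩
  · have hd : 0 < d := by omega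
    have h4 := m2 j hj
    rw [h9 j hj, h9 p (by omega), neg_le_neg_iff] at h4
    exact (pow_le_pow_iff_left₀ (norm_nonneg _) (norm_nonneg _) two_ne_zero).1 h4
  · rw [(eliminateP 4 0).exec_R rfl, ← hw, ← r3]
    exact eliminateP_spec (Or.inl rfl) d3 j (by rwa [d3.2.1])
  · have := eliminateP_spec (t := 4) (j := 0) (Or.inr rfl) d4 i (by rwa [d4.1])
    rwa [r43, hw, r4] at this

/-- `R 5 := Â`, by way of the residual `R 4 = A - Â`. -/
def projectP : Prog :=
  .seq powerP (.seq (mapR2 10 0 11 1 4 .skip (.get 0 (nv 10) (nv 11)))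
    (.seq (.loop 14 (dim 2) gramSchmidtStepP)
      (mapR2 10 0 11 1 5 .skip (.sub (.get 0 (nv 10) (nv 11)) (.get 4 (nv 10) (nv 11))))))

lemma projectP_spec {s : State} (hs : Dims n d k s) {A : Matrix (Fin n) (Fin d) ℝ}
    (hA : Stores (s.R 0) A) :
    ∃ V : Submodule ℝ (Pt d), IsNearTopSubspace 2 k A V ∧
      ∀ i : Fin n, vec d ((projectP.exec s).R 5 i) = projPts A V i := by
  rw [projectP]
  simp only [Prog.exec]
  set s1 := powerP.exec s with hs1
  set P2 := mapR2 10 0 11 1 4 .skip (.get 0 (nv 10) (nv 11)) with hP2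
  set s2 := P2.exec s1 with hs2
  have d1 : Dims n d k s1 := hs.congr (powerP.exec_N rfl s)
  have d2 : Dims n d k s2 := d1.congr (P2.exec_N rfl s1)
  have hM : Stores (s2.R 1) (gramPower A) := by
    rw [hs2, P2.exec_R rfl]; exact powerP_spec hs hA
  have hA1 : Stores (s1.R 0) A := by rw [hs1, powerP.exec_R rfl]; exact hA
  have hA2 : Stores (s2.R 0) A := by rw [hs2, P2.exec_R rfl]; exact hA1
  have h4 : Stores (s2.R 4) A := by
    intro i j
    refine (mapR2_spec (s := s1) (fun i j => s1.R 0 i j) (by decide) (by decide) (by decide) rfl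
      rfl rfl rfl ?_ i (by rw [d1.1]; exact i.2) j (by rw [d1.2.1]; exact j.2)).trans (hA1 i j)
    intro i _ j _ s' hF hi hj _
    simp only [Prog.exec, RExp.eval, NExp.eval, hi, hj, hF.2 0 rfl]
  set y := rowNat (gramPower A) with hy
  have hrowNat : ∀ j (hj : j < d), y j = row (gramPower A) ⟨j, hj⟩ := fun j hj => by
    simp [hy, rowNat, hj]
  have hloop := loop_induct (s := s2) (b := 14) (j := 2) (c := gramSchmidtStepP)
    (fun m s' => ∃ (w : ℕ → Pt d) (p : ℕ → ℕ), IsPivotedGramSchmidt m y w p ∧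
      (∀ j < d, vec d (s'.R 1 j) = resid (prefixSpan w m) (y j)) ∧
      ∀ i : Fin n, vec d (s'.R 4 i) = resid (prefixSpan w m) (row A i)) ?_ ?_
  · rw [d2.2.2] at hloop
    obtain ⟨w, p, hgs, -, hE⟩ := hloop
    refine ⟨prefixSpan w k, hgs.isNearTopSubspace, fun i => ?_⟩
    set s3 := (Prog.loop 14 (dim 2) gramSchmidtStepP).exec s2 with hs3
    have d3 : Dims n d k s3 := d2.congr ((Prog.loop 14 (dim 2) gramSchmidtStepP).exec_N rfl s2)
    have hA3 : Stores (s3.R 0) A := by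
      rw [hs3, (Prog.loop 14 (dim 2) gramSchmidtStepP).exec_R rfl]; exact hA2
    have e : projPts A (prefixSpan w k) i = vec d (s3.R 0 i) - vec d (s3.R 4 i) := by
      rw [hE i, hA3.vec_eq, resid, sub_sub_cancel]; rfl
    rw [e]
    ext j
    refine (mapR2_spec (s := s3) (fun i j => s3.R 0 i j - s3.R 4 i j) (by decide) (by decide)
      (by decide) rfl rfl rfl rfl ?_ i (by rw [d3.1]; exact i.2) j (by rw [d3.2.1]; exact j.2))
    intro i _ j _ s' hF hi hj _
    simp only [Prog.exec, RExp.eval, NExp.eval, hi, hj, hF.2 0 rfl, hF.2 4 rfl]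
  · refine ⟨fun _ => 0, fun _ => 0, ⟨by simp, by simp⟩, fun j hj => ?_, fun i => ?_⟩
    · rw [resid_prefixSpan_zero, hrowNat j hj]
      exact hM.vec_eq ⟨j, hj⟩
    · rw [resid_prefixSpan_zero]; exact h4.vec_eq i
  · rintro m hm s' hF ⟨w, p, hgs, hR, hE⟩
    have hs' : Dims n d k (s'.writeN 14 0 0 m) :=
      d2.congr (by rw [writeN_N_of_ne _ (by decide), hF.1 0 rfl])
    obtain ⟨q, hq, hmax, hR', hE'⟩ := gramSchmidtStepP_spec hs'
    simp only [writeN_R] at hmax hR' hE'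
    set v := vec d (s'.R 1 q) with hv
    have hvres : v = resid (prefixSpan w m) (y q) := by
      rcases Nat.eq_zero_or_pos d with hd | hd
      · subst hd; exact Subsingleton.elim _ _
      · exact hR q (by omega)
    set w' := Function.update w m v with hw'
    have hspan : ∀ r ≤ m, prefixSpan w' r = prefixSpan w r := fun r hr =>
      prefixSpan_congr fun t ht => Function.update_of_ne (by omega) _ _
    have hw'm : w' m = v := Function.update_self _ _ _
    have hstep : ∀ x, resid (prefixSpan w' (m + 1)) x = resid (prefixSpan w m) x
        - (inner ℝ (resid (prefixSpan w m) x) v / inner ℝ v v) • v := by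
      intro x
      rw [resid_prefixSpan_succ, hspan m le_rfl, hw'm]
      rw [hspan m le_rfl, hw'm, hvres]
      exact resid_mem_orthogonal _ _
    refine ⟨w', Function.update p m q, ⟨fun r hr => ?_, fun r hr j => ?_⟩, fun j hj => ?_,
      fun i => ?_⟩
    · rw [hspan r (by omega)]
      rcases Nat.lt_succ_iff_lt_or_eq.1 hr with hr | rfl
      · rw [hw', Function.update_of_ne (by omega), Function.update_of_ne (by omega)]
        exact hgs.eq_resid r hr
      · rw [hw'm, Function.update_self, hvres]
    · rw [hspan r (by omega)]
      rcases Nat.lt_succ_iff_lt_or_eq.1 hr with hr | rfl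
      · rw [hw', Function.update_of_ne (by omega)]
        exact hgs.le_pivot r hr j
      · rw [hw'm]
        by_cases hj : j < d
        · rw [← hR j hj]; exact hmax j hj
        · have : y j = 0 := by simp [hy, rowNat, hj]
          rw [this]; simp [resid]
    · rw [hstep, hR' j hj, hR j hj]
    · rw [hstep, hE' i i.2, hE i]

/-! ### Program: the `k`-means approximation -/

/-- `R 6 i j` is the squared distance of the points `q i` and `q j`. -/
def StoresDist (n : ℕ) (q : ℕ → Pt d) (s : State) : Prop :=
  ∀ i < n, ∀ j < n, s.R 6 i j = ‖q i - q j‖ ^ 2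

/-- Squared distances of the rows of `R 5`. -/
def distP : Prog :=
  mapR2 10 0 11 0 6 (sumP 12 1 8
    (.mul (.sub (.get 5 (nv 10) (nv 12)) (.get 5 (nv 11) (nv 12)))
      (.sub (.get 5 (nv 10) (nv 12)) (.get 5 (nv 11) (nv 12))))) (rv 8)

lemma distP_spec {s : State} (hs : Dims n d k s) :
    StoresDist n (fun i => vec d (s.R 5 i)) (distP.exec s) := by
  intro i hi j hj
  rw [norm_vec_sub_sq]
  refine mapR2_spec
    (fun i j => ∑ l ∈ Finset.range d, (s.R 5 i l - s.R 5 j l) * (s.R 5 i l - s.R 5 j l))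
    (by decide) (by decide) (by decide) rfl rfl rfl rfl ?_ i (by rwa [hs.1]) j (by rwa [hs.1])
  intro i _ j _ s' hF hi hj _
  have h0 : s'.N 0 0 1 = d := by rw [hF.1 0 rfl]; exact hs.2.1
  refine (sumP_spec (fun l => (s.R 5 i l - s.R 5 j l) * (s.R 5 i l - s.R 5 j l)) ?_).trans
    (by rw [h0])
  intro l _ s'' hN hR hl
  simp only [RExp.eval, NExp.eval, hl, hN 10 (by decide), hN 11 (by decide), hR 5 (by decide),
    hi, hj, hF.2 5 rfl]

lemma eq_iInf_of_forall_le {f : ℕ → ℝ} {m : ℕ} (hm : m < k) (h : ∀ l < k, f m ≤ f l) :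
    f m = ⨅ r : Fin k, f r := by
  have : Nonempty (Fin k) := ⟨⟨m, hm⟩⟩
  exact le_antisymm (le_ciInf fun r => h r r.2)
    (ciInf_le (f := fun r : Fin k => f r) (Set.finite_range _).bddBelow ⟨m, hm⟩)

/-- `R 7 0 i` becomes the squared distance of point `i` to the nearest of the centers listed in the
array `N t 0`. -/
def nearP (t : ℕ) : Prog :=
  mapR1 10 0 7 (.const 0) (minP 11 2 21 8 (.get 6 (nv 10) (.get t (.const 0) (nv 11)))) (rv 8)

lemma nearP_spec {t : ℕ} (ht : t = 3 ∨ t = 4) {s : State} (hs : Dims n d k s) (hk : 1 ≤ k) :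
    ∀ i < n, ((nearP t).exec s).R 7 0 i = ⨅ r : Fin k, s.R 6 i (s.N t 0 r) := by
  have htN : (nearP t).writesN t = false := by rcases ht with rfl | rfl <;> rfl
  have := (mapR1_spec (c := 10) (j := 0) (t := 7) (row := .const 0) (s := s)
    (body := minP 11 2 21 8 (.get 6 (nv 10) (.get t (.const 0) (nv 11)))) (x := rv 8) 0
    (fun i => ⨅ r : Fin k, s.R 6 i (s.N t 0 r)) rfl rfl (by
      intro i _ s' hF hi _
      have h0 : s'.N 0 0 2 = k := by rw [hF.1 0 rfl]; exact hs.2.2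
      refine ⟨rfl, ?_⟩
      obtain ⟨m1, m2, m3⟩ := minP_spec (c := 11) (j := 2) (b := 21) (v := 8)
        (x := .get 6 (nv 10) (.get t (.const 0) (nv 11))) (s := s')
        (fun l => s.R 6 i (s.N t 0 l)) (by decide) (by decide) (by decide) (by
          intro l _ s'' hN hR hl
          simp only [RExp.eval, NExp.eval, hl, hN 10 (by decide) (by decide),
            hN t (by omega) (by omega), hR 6 (by decide), hi, hF.2 6 rfl, hF.1 t htN])
      rw [h0] at m2 m3
      exact m1.trans (eq_iInf_of_forall_le (f := fun l => s.R 6 i (s.N t 0 l)) (by omega) m2))).1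
  rwa [hs.1] at this

/-- One step of farthest-first traversal, on the list of centers `N 3 0`: as the list is initially
constant, the slots that have not been filled yet do not matter. -/
def farthestStepP : Prog :=
  .seq (nearP 3) (.seq (minP 10 0 20 12 (.sub (.const 0) (.get 7 (.const 0) (nv 10))))
    (.ite (.nlt (.const 0) (nv 14)) (.setN 3 (.const 0) (nv 14) (nv 20)) .skip))

lemma farthestStepP_spec {s : State} (hs : Dims n d k s) (hk : 1 ≤ k) (hn : 1 ≤ n) {m : ℕ}
    (hm : s.N 14 0 0 = m) :
    ∃ p < n, (∀ i < n, (⨅ r : Fin k, s.R 6 i (s.N 3 0 r)) ≤ ⨅ r : Fin k, s.R 6 p (s.N 3 0 r)) ∧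
      ∀ r, (farthestStepP.exec s).N 3 0 r = if 0 < m ∧ r = m then p else s.N 3 0 r := by
  simp only [farthestStepP, Prog.exec]
  set s1 := (nearP 3).exec s with hs1
  have d1 : Dims n d k s1 := hs.congr ((nearP 3).exec_N rfl s)
  have h7 := nearP_spec (Or.inl rfl) hs hk
  obtain ⟨-, m2, m3⟩ := minP_spec (c := 10) (j := 0) (b := 20) (v := 12)
    (x := .sub (.const 0) (.get 7 (.const 0) (nv 10))) (s := s1) (fun l => 0 - s1.R 7 0 l)
    (by decide) (by decide) (by decide) (by
      intro l _ s' _ hR hl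
      simp only [RExp.eval, NExp.eval, hl, hR 7 (by decide), Rat.cast_zero])
  set P := minP 10 0 20 12 (.sub (.const 0) (.get 7 (.const 0) (nv 10))) with hP
  set s2 := P.exec s1 with hs2
  rw [d1.1] at m2 m3
  have hp : s2.N 20 0 0 < n := by omega
  refine ⟨s2.N 20 0 0, hp, fun i hi => ?_, fun r => ?_⟩
  · rw [← h7 i hi, ← h7 _ hp]
    have := m2 i hi
    linarith
  · have h14 : s2.N 14 0 0 = m := by
      rw [hs2, P.exec_N rfl, hs1, (nearP 3).exec_N rfl, hm]
    have h3 : s2.N 3 = s.N 3 := by rw [hs2, P.exec_N rfl, hs1, (nearP 3).exec_N rfl]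
    simp only [BExp.eval, NExp.eval, h14]
    split_ifs with h1 h2 h2
    · simp [State.writeN, h2.2]
    · have : r ≠ m := fun h => h2 ⟨h1, h⟩
      simp [State.writeN, this, h3]
    · exact absurd h2.1 h1
    · rw [h3]

/-- Farthest-first traversal. -/
def farthestP : Prog := .loop 14 (dim 2) farthestStepP

lemma farthestP_spec {s : State} (hs : Dims n d k s) (hk : 1 ≤ k) (hn : 1 ≤ n) {q : ℕ → Pt d}
    (hq : StoresDist n q s) (h3 : ∀ r, s.N 3 0 r = 0) :
    ∃ c : Fin k → Fin n, (∀ r : Fin k, (farthestP.exec s).N 3 0 r = c r) ∧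
      IsFarthestFirst (fun i : Fin n => q i) c := by
  have key := loop_induct (s := s) (b := 14) (j := 2) (c := farthestStepP)
    (fun m s' => (∀ r, s'.N 3 0 r < n) ∧ s'.N 3 0 0 = 0 ∧ (∀ r, m ≤ r → s'.N 3 0 r = 0) ∧
      ∀ r < m, 0 < r → ∀ i < n, ∃ t < r, ∀ t' < r,
        s.R 6 i (s'.N 3 0 t) ≤ s.R 6 (s'.N 3 0 r) (s'.N 3 0 t')) ?_ ?_
  · rw [hs.2.2] at key
    obtain ⟨k1, -, -, k4⟩ := key
    refine ⟨fun r => ⟨_, k1 r⟩, fun r => rfl, fun r hr i => ?_⟩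
    obtain ⟨t, ht, h⟩ := k4 r r.2 hr i i.2
    refine ⟨⟨t, ht.trans r.2⟩, ht, fun t' ht' => ?_⟩
    have := h t' ht'
    rw [hq _ i.2 _ (k1 t), hq _ (k1 r) _ (k1 t')] at this
    exact (pow_le_pow_iff_left₀ (norm_nonneg _) (norm_nonneg _) two_ne_zero).1 this
  · exact ⟨fun r => by rw [h3]; omega, h3 0, fun r _ => h3 r, fun r hr => absurd hr (by omega)⟩
  · rintro m hm s' hF ⟨i1, i2, i3, i4⟩
    have h6 : s'.R 6 = s.R 6 := hF.2 6 rfl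
    set s1 := s'.writeN 14 0 0 m with hs1
    have d1 : Dims n d k s1 := hs.congr (by rw [hs1, writeN_N_of_ne _ (by decide), hF.1 0 rfl])
    have h31 : s1.N 3 = s'.N 3 := writeN_N_of_ne _ (by decide) _ _ _
    have h61 : s1.R 6 = s.R 6 := h6
    obtain ⟨p, hp, hmax, hN⟩ := farthestStepP_spec d1 hk hn (m := m) (writeN_N_self _ _ _ _ _)
    rw [h31, h61] at hmax
    rw [h31] at hN
    rw [hs.2.2] at hm
    set s2 := farthestStepP.exec s1 with hs2
    have hold : ∀ r, r ≠ m → s2.N 3 0 r = s'.N 3 0 r := fun r hr => by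
      rw [hN, if_neg (by tauto)]
    refine ⟨fun r => ?_, ?_, fun r hr => ?_, fun r hr hr0 i hi => ?_⟩
    · rw [hN]; split_ifs
      · exact hp
      · exact i1 r
    · rw [hN, if_neg (by omega)]; exact i2
    · rw [hold r (by omega)]; exact i3 r (by omega)
    · rcases Nat.lt_succ_iff_lt_or_eq.1 hr with hr | rfl
      · obtain ⟨t, ht, h⟩ := i4 r hr hr0 i hi
        refine ⟨t, ht, fun t' ht' => ?_⟩
        rw [hold t (by omega), hold r (by omega), hold t' (by omega)]
        exact h t' ht'
      · have hne : Nonempty (Fin k) := ⟨⟨0, hk⟩⟩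
        obtain ⟨t₀, ht₀⟩ := exists_eq_ciInf_of_finite
          (f := fun t : Fin k => s.R 6 i (s'.N 3 0 t))
        -- slots that are not filled yet hold the first center
        obtain ⟨t, ht, hte⟩ : ∃ t < r, s'.N 3 0 t = s'.N 3 0 t₀ := by
          rcases lt_or_ge (t₀ : ℕ) r with h | h
          · exact ⟨t₀, h, rfl⟩
          · exact ⟨0, hr0, by rw [i2, i3 t₀ h]⟩
        refine ⟨t, ht, fun t' ht' => ?_⟩
        rw [hold t (by omega), hold t' (by omega), hN r, if_pos ⟨hr0, rfl⟩, hte, ht₀]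
        exact (hmax i hi).trans (ciInf_le (f := fun t : Fin k => s.R 6 p (s'.N 3 0 t))
          (Set.finite_range _).bddBelow ⟨t', ht'.trans hm⟩)

/-- The `k`-means cost in terms of the array of squared distances. -/
noncomputable def listCost (n k : ℕ) (D : ℕ → ℕ → ℝ) (c : ℕ → ℕ) : ℝ :=
  ∑ i ∈ Finset.range n, ⨅ r : Fin k, D i (c r)

lemma listCost_eq {q : ℕ → Pt d} {s : State} (hq : StoresDist n q s) {c : ℕ → ℕ}
    (hc : ∀ r < k, c r < n) :
    listCost n k (s.R 6) c = kmeansCost (fun i : Fin n => q i) fun r : Fin k => q (c r) := by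
  rw [listCost, Finset.sum_range, kmeansCost]
  exact Finset.sum_congr rfl fun i _ => iInf_congr fun r => hq i i.2 _ (hc r r.2)

/-- The cost after replacing the center in slot `N 14 0 0` by the point `N 13 0 0`. -/
def swapCostP : Prog :=
  .seq (mapN1 10 2 4 .skip (.get 3 (.const 0) (nv 10)))
    (.seq (.setN 4 (.const 0) (nv 14) (nv 13))
      (.seq (nearP 4) (sumP 10 0 17 (.get 7 (.const 0) (nv 10)))))

lemma swapCostP_spec {s : State} (hs : Dims n d k s) (hk : 1 ≤ k) {σ o : ℕ}
    (hσ : s.N 14 0 0 = σ) (ho : s.N 13 0 0 = o) :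
    (swapCostP.exec s).R 17 0 0 = listCost n k (s.R 6) (Function.update (s.N 3 0) σ o) := by
  simp only [swapCostP, Prog.exec]
  set P1 := mapN1 10 2 4 .skip (.get 3 (.const 0) (nv 10)) with hP1
  set s1 := P1.exec s with hs1
  have h4 : ∀ r < k, s1.N 4 0 r = s.N 3 0 r := by
    have := mapN1_spec (c := 10) (j := 2) (t := 4) (body := .skip)
      (x := .get 3 (.const 0) (nv 10)) (s := s) (fun r v => v = s.N 3 0 r) (by decide) rfl rfl (by
        intro i _ s' hF hi
        simp only [Prog.exec, NExp.eval, hi, hF.1 3 rfl])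
    rwa [hs.2.2] at this
  have h14 : s1.N 14 0 0 = σ := by rw [hs1, P1.exec_N rfl, hσ]
  have h13 : s1.N 13 0 0 = o := by rw [hs1, P1.exec_N rfl, ho]
  simp only [NExp.eval, h14, h13]
  set s2 := s1.writeN 4 0 σ o with hs2
  have d2 : Dims n d k s2 := hs.congr (by
    rw [hs2, writeN_N_of_ne _ (by decide), hs1, P1.exec_N rfl])
  have h42 : ∀ r < k, s2.N 4 0 r = Function.update (s.N 3 0) σ o r := fun r hr => by
    rw [Function.update_apply, ← h4 r hr]
    simp [hs2, State.writeN]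
  have h62 : s2.R 6 = s.R 6 := by rw [hs2, writeN_R, hs1, P1.exec_R rfl]
  set s3 := (nearP 4).exec s2 with hs3
  have d3 : Dims n d k s3 := d2.congr ((nearP 4).exec_N rfl s2)
  have h7 := nearP_spec (Or.inr rfl) d2 hk
  rw [sumP_spec (fun i => s3.R 7 0 i), d3.1, listCost]
  · refine Finset.sum_congr rfl fun i hi => ?_
    rw [h7 i (Finset.mem_range.1 hi), h62]
    exact iInf_congr fun r => by rw [h42 r r.2]
  · intro l _ s' hN hR hl
    simp only [RExp.eval, NExp.eval, hl, hR 7 (by decide)]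

/-- A best swap: tabulate the costs of all swaps in `R 10`, find the best point for each slot, then
the best slot. -/
def swapStepP : Prog :=
  .seq (mapR2 14 2 13 0 10 swapCostP (rv 17))
    (.seq (mapN1 14 2 5 (minP 13 0 20 12 (.get 10 (nv 14) (nv 13))) (nv 20))
      (.seq (minP 14 2 22 12 (.get 10 (nv 14) (.get 5 (.const 0) (nv 14))))
        (.setN 3 (.const 0) (nv 22) (.get 5 (.const 0) (nv 22)))))

lemma swapStepP_spec {s : State} (hs : Dims n d k s) (hk : 1 ≤ k) (hn : 1 ≤ n) :
    ∃ σ < k, ∃ o < n, (swapStepP.exec s).N 3 0 = Function.update (s.N 3 0) σ o ∧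
      ∀ σ' < k, ∀ o' < n, listCost n k (s.R 6) (Function.update (s.N 3 0) σ o)
        ≤ listCost n k (s.R 6) (Function.update (s.N 3 0) σ' o') := by
  simp only [swapStepP, Prog.exec]
  set f : ℕ → ℕ → ℝ := fun σ o => listCost n k (s.R 6) (Function.update (s.N 3 0) σ o) with hf
  set P1 := mapR2 14 2 13 0 10 swapCostP (rv 17) with hP1
  set s1 := P1.exec s with hs1
  have h10 : ∀ σ < k, ∀ o < n, s1.R 10 σ o = f σ o := by
    have := mapR2_spec (s := s) (c := 14) (j := 2) (c' := 13) (j' := 0) (t := 10)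
      (body := swapCostP) (x := rv 17) f (by decide) (by decide) (by decide) rfl rfl rfl rfl (by
        intro i _ j _ s' hF hi hj _
        have d' : Dims n d k s' := hs.congr (hF.1 0 rfl)
        refine (swapCostP_spec d' hk hi hj).trans ?_
        rw [hF.2 6 rfl, hF.1 3 rfl])
    rwa [hs.2.2, hs.1] at this
  have d1 : Dims n d k s1 := hs.congr (P1.exec_N rfl s)
  set P2 := mapN1 14 2 5 (minP 13 0 20 12 (.get 10 (nv 14) (nv 13))) (nv 20) with hP2
  set s2 := P2.exec s1 with hs2
  have h5 : ∀ σ < k, s2.N 5 0 σ < n ∧ ∀ o < n, s1.R 10 σ (s2.N 5 0 σ) ≤ s1.R 10 σ o := by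
    have := mapN1_spec (s := s1) (c := 14) (j := 2) (t := 5)
      (body := minP 13 0 20 12 (.get 10 (nv 14) (nv 13))) (x := nv 20)
      (fun σ v => v < n ∧ ∀ o < n, s1.R 10 σ v ≤ s1.R 10 σ o) (by decide) rfl rfl (by
        intro i _ s' hF hi
        have h0 : s'.N 0 0 0 = n := by rw [hF.1 0 rfl]; exact d1.1
        obtain ⟨-, m2, m3⟩ := minP_spec (c := 13) (j := 0) (b := 20) (v := 12)
          (x := .get 10 (nv 14) (nv 13)) (s := s') (fun l => s1.R 10 i l) (by decide) (by decide)
          (by decide) (by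
            intro l _ s'' hN hR hl
            simp only [RExp.eval, NExp.eval, hl, hN 14 (by decide) (by decide),
              hR 10 (by decide), hi, hF.2 10 rfl])
        rw [h0] at m2 m3
        exact ⟨by change State.N _ 20 0 0 < n; omega, m2⟩)
    rwa [d1.2.2] at this
  have d2 : Dims n d k s2 := d1.congr (P2.exec_N rfl s1)
  have h102 : s2.R 10 = s1.R 10 := P2.exec_R rfl s1
  obtain ⟨-, m2, m3⟩ := minP_spec (c := 14) (j := 2) (b := 22) (v := 12)
    (x := .get 10 (nv 14) (.get 5 (.const 0) (nv 14))) (s := s2)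
    (fun l => s1.R 10 l (s2.N 5 0 l)) (by decide) (by decide) (by decide) (by
      intro l _ s' hN hR hl
      simp only [RExp.eval, NExp.eval, hl, hN 5 (by decide) (by decide), hR 10 (by decide), h102])
  set P3 := minP 14 2 22 12 (.get 10 (nv 14) (.get 5 (.const 0) (nv 14))) with hP3
  set s3 := P3.exec s2 with hs3
  rw [d2.2.2] at m2 m3
  have hσ : s3.N 22 0 0 < k := by omega
  set σ := s3.N 22 0 0 with hσd
  have h53 : s3.N 5 = s2.N 5 := P3.exec_N rfl s2
  have h33 : s3.N 3 = s.N 3 := by rw [hs3, P3.exec_N rfl, hs2, P2.exec_N rfl, hs1, P1.exec_N rfl]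
  obtain ⟨ho, -⟩ := h5 σ hσ
  refine ⟨σ, hσ, s2.N 5 0 σ, ho, ?_, fun σ' hσ' o' ho' => ?_⟩
  · funext r
    rw [Function.update_apply]
    simp only [NExp.eval, ← hσd, h53, ← h33]
    simp [State.writeN]
  · have e1 := m2 σ' hσ'
    have e2 := (h5 σ' hσ').2 o' ho'
    change s1.R 10 σ (s2.N 5 0 σ) ≤ _ at e1
    rw [h10 σ hσ _ ho] at e1
    rw [h10 σ' hσ' o' ho'] at e2
    exact e1.trans e2

/-- Local search with `n k` best swaps. -/
def localSearchP : Prog := .loop 15 (dim 0) (.loop 16 (dim 2) swapStepP)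

/-- The program for approximate `k`-means centers of the rows of `R 5`. The centers are chosen among
the points; their indices are listed in `N 3 0`. -/
def kmeansP : Prog := .seq distP (.seq farthestP localSearchP)

lemma kmeansP_spec {s : State} (hs : Dims n d k s) (hk : 1 ≤ k) (hn : 1 ≤ n)
    (h3 : ∀ r, s.N 3 0 r = 0) :
    (∀ r < k, (kmeansP.exec s).N 3 0 r < n) ∧
      IsApproxKMeans 336 (fun i : Fin n => vec d (s.R 5 i))
        fun r : Fin k => vec d (s.R 5 ((kmeansP.exec s).N 3 0 r)) := by
  simp only [kmeansP, Prog.exec]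
  set q : ℕ → Pt d := fun i => vec d (s.R 5 i) with hq
  set s1 := distP.exec s with hs1
  have d1 : Dims n d k s1 := hs.congr (distP.exec_N rfl s)
  have hD1 : StoresDist n q s1 := distP_spec hs
  obtain ⟨c, hc, hff⟩ := farthestP_spec d1 hk hn hD1 (fun r => by
    rw [hs1, distP.exec_N rfl]; exact h3 r)
  set s2 := farthestP.exec s1 with hs2
  have d2 : Dims n d k s2 := d1.congr (farthestP.exec_N rfl s1)
  have hD2 : StoresDist n q s2 := by
    intro i hi j hj; rw [hs2, farthestP.exec_R rfl]; exact hD1 i hi j hj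
  set p : Fin n → Pt d := fun i => q i with hp
  set x : ℝ := 1 - 1 / (2 * k) with hx
  have hx0 : 0 ≤ x := by
    have hk' : (1 : ℝ) ≤ k := by exact_mod_cast hk
    have : 1 / (2 * (k : ℝ)) ≤ 1 := by rw [div_le_one (by positivity)]; linarith
    linarith
  let Good : ℕ → State → Prop := fun m s' => (∀ r < k, s'.N 3 0 r < n) ∧
    ∀ ν : Fin k → Pt d, kmeansCost p (fun r : Fin k => q (s'.N 3 0 r)) - 328 * kmeansCost p ν
      ≤ x ^ m * (kmeansCost p (fun r => p (c r)) - 328 * kmeansCost p ν)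
  have key := loop_induct (s := s2) (b := 15) (j := 0) (c := .loop 16 (dim 2) swapStepP)
    (fun m s' => Good (m * k) s') ?_ ?_
  · rw [d2.1] at key
    exact ⟨key.1, isApproxKMeans_of_localSearch hk hn hff key.2⟩
  · refine ⟨fun r hr => by rw [hc ⟨r, hr⟩]; exact (c ⟨r, hr⟩).2, fun ν => le_of_eq ?_⟩
    simp only [hc, Nat.zero_mul, pow_zero, one_mul]
    rfl
  · intro m _ s' hF hI
    set s3 := s'.writeN 15 0 0 m with hs3
    have d3 : Dims n d k s3 := d2.congr (by rw [hs3, writeN_N_of_ne _ (by decide), hF.1 0 rfl])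
    have h63 : s3.R 6 = s2.R 6 := hF.2 6 rfl
    have key' := loop_induct (s := s3) (b := 16) (j := 2) (c := swapStepP)
      (fun m' s' => Good (m * k + m') s') ?_ ?_
    · rw [d3.2.2] at key'
      rw [Nat.succ_mul]
      exact key'
    · have h33 : s3.N 3 = s'.N 3 := writeN_N_of_ne _ (by decide) _ _ _
      simp only [Good, h33, Nat.add_zero]
      exact hI
    · rintro m' _ s4 hF' ⟨i1, i2⟩
      set s5 := s4.writeN 16 0 0 m' with hs5
      have d5 : Dims n d k s5 := d3.congr (by
        rw [hs5, writeN_N_of_ne _ (by decide), hF'.1 0 rfl])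
      have h35 : s5.N 3 = s4.N 3 := writeN_N_of_ne _ (by decide) _ _ _
      have hD5 : StoresDist n q s5 := by
        intro i hi j hj
        rw [hs5, writeN_R, hF'.2 6 rfl, h63]; exact hD2 i hi j hj
      obtain ⟨σ, hσ, o, ho, hN, hbest⟩ := swapStepP_spec d5 hk hn
      rw [h35] at hN hbest
      have hlt : ∀ σ o, o < n → ∀ r < k, Function.update (s4.N 3 0) σ o r < n := by
        intro σ o ho r hr
        rw [Function.update_apply]; split_ifs
        · exact ho
        · exact i1 r hr
      refine ⟨fun r hr => by rw [hN]; exact hlt σ o ho r hr, fun ν => ?_⟩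
      have hstep := best_swap_le hk hn p (S := fun r : Fin k => q (s4.N 3 0 r))
        (S' := fun r : Fin k => q ((swapStepP.exec s5).N 3 0 r)) (fun t i => by
          have h1 := hbest t t.2 i i.2
          rw [listCost_eq hD5 (hlt σ o ho), listCost_eq hD5 (hlt t i i.2)] at h1
          rw [hN]
          refine h1.trans (le_of_eq ?_)
          congr 1
          funext r
          rw [Function.update_apply, Function.update_apply]
          by_cases hr : r = t
          · rw [if_pos hr, if_pos (by rw [hr])]
          · rw [if_neg hr, if_neg fun h => hr (Fin.ext h)]) ν
      refine hstep.trans ?_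
      rw [← Nat.add_assoc, pow_succ', mul_assoc]
      exact mul_le_mul_of_nonneg_left (i2 ν) hx0

/-! ### Program: the Lloyd iteration -/

/-- Label the points (rows of `R 0`) in `N 1 0` by closest centers (rows of `R 13`). -/
def assignP : Prog :=
  .seq (mapR2 10 0 11 2 16 (sumP 12 1 8
      (.mul (.sub (.get 0 (nv 10) (nv 12)) (.get 13 (nv 11) (nv 12)))
        (.sub (.get 0 (nv 10) (nv 12)) (.get 13 (nv 11) (nv 12))))) (rv 8))
    (mapN1 10 0 1 (minP 11 2 20 12 (.get 16 (nv 10) (nv 11))) (nv 20))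

lemma assignP_spec {s : State} (hs : Dims n d k s) (hk : 1 ≤ k) {A : Matrix (Fin n) (Fin d) ℝ}
    (hA : Stores (s.R 0) A) :
    ∃ S : Fin n → Fin k, (∀ i : Fin n, (assignP.exec s).N 1 0 i = S i) ∧
      IsNearestAssignment (row A) (fun r : Fin k => vec d (s.R 13 r)) S := by
  simp only [assignP, Prog.exec]
  set P1 := mapR2 10 0 11 2 16 (sumP 12 1 8
      (.mul (.sub (.get 0 (nv 10) (nv 12)) (.get 13 (nv 11) (nv 12)))
        (.sub (.get 0 (nv 10) (nv 12)) (.get 13 (nv 11) (nv 12))))) (rv 8) with hP1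
  set s1 := P1.exec s with hs1
  have h16 : ∀ i < n, ∀ r < k, s1.R 16 i r = ‖vec d (s.R 0 i) - vec d (s.R 13 r)‖ ^ 2 := by
    have := mapR2_spec (s := s) (c := 10) (j := 0) (c' := 11) (j' := 2) (t := 16)
      (body := sumP 12 1 8
        (.mul (.sub (.get 0 (nv 10) (nv 12)) (.get 13 (nv 11) (nv 12)))
          (.sub (.get 0 (nv 10) (nv 12)) (.get 13 (nv 11) (nv 12))))) (x := rv 8)
      (fun i r => ‖vec d (s.R 0 i) - vec d (s.R 13 r)‖ ^ 2) (by decide) (by decide) (by decide)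
      rfl rfl rfl rfl (by
        intro i _ j _ s' hF hi hj _
        have h0 : s'.N 0 0 1 = d := by rw [hF.1 0 rfl]; exact hs.2.1
        rw [norm_vec_sub_sq]
        refine (sumP_spec (fun l => (s.R 0 i l - s.R 13 j l) * (s.R 0 i l - s.R 13 j l)) ?_).trans
          (by rw [h0])
        intro l _ s'' hN hR hl
        simp only [RExp.eval, NExp.eval, hl, hN 10 (by decide), hN 11 (by decide),
          hR 0 (by decide), hR 13 (by decide), hi, hj, hF.2 0 rfl, hF.2 13 rfl])
    rwa [hs.1, hs.2.2] at this
  have d1 : Dims n d k s1 := hs.congr (P1.exec_N rfl s)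
  have h1 := mapN1_spec (s := s1) (c := 10) (j := 0) (t := 1)
    (body := minP 11 2 20 12 (.get 16 (nv 10) (nv 11))) (x := nv 20)
    (fun i v => v < k ∧ ∀ r < k, s1.R 16 i v ≤ s1.R 16 i r) (by decide) rfl rfl (by
      intro i _ s' hF hi
      have h0 : s'.N 0 0 2 = k := by rw [hF.1 0 rfl]; exact d1.2.2
      obtain ⟨-, m2, m3⟩ := minP_spec (c := 11) (j := 2) (b := 20) (v := 12)
        (x := .get 16 (nv 10) (nv 11)) (s := s') (fun l => s1.R 16 i l) (by decide) (by decide)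
        (by decide) (by
          intro l _ s'' hN hR hl
          simp only [RExp.eval, NExp.eval, hl, hN 10 (by decide) (by decide),
            hR 16 (by decide), hi, hF.2 16 rfl])
      rw [h0] at m2 m3
      exact ⟨by change State.N _ 20 0 0 < k; omega, m2⟩)
  rw [d1.1] at h1
  refine ⟨fun i => ⟨_, (h1 i i.2).1⟩, fun i => rfl, fun i r => ?_⟩
  have h2 := (h1 i i.2).2 r r.2
  rw [h16 i i.2 _ (h1 i i.2).1, h16 i i.2 r r.2, hA.vec_eq] at h2
  exact (pow_le_pow_iff_left₀ (norm_nonneg _) (norm_nonneg _) two_ne_zero).1 h2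

/-- The indicator of equality, by truncated subtraction. -/
def eqExp (x y : NExp) : RExp := .ofNat (.sub (.const 1) (.add (.sub x y) (.sub y x)))

lemma eqExp_eval (x y : NExp) (s : State) :
    (eqExp x y).eval s = if x.eval s = y.eval s then 1 else 0 := by
  simp only [eqExp, RExp.eval, NExp.eval]
  split_ifs with h
  · simp [h]
  · have : 1 - (x.eval s - y.eval s + (y.eval s - x.eval s)) = 0 := by omega
    rw [this, Nat.cast_zero]

/-- Replace the centers in `R 13` by the means of the points with their label. -/
def recenterP : Prog :=
  .seq (mapR1 10 2 19 (.const 0)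
      (sumP 11 0 8 (eqExp (.get 1 (.const 0) (nv 11)) (nv 10))) (rv 8))
    (mapR2 10 2 11 1 13
      (.seq (sumP 12 0 8
          (.mul (eqExp (.get 1 (.const 0) (nv 12)) (nv 10)) (.get 0 (nv 12) (nv 11))))
        (.ite (.rlt (.const 0) (.get 19 (.const 0) (nv 10)))
          (.setR 8 (.const 0) (.const 0) (.div (rv 8) (.get 19 (.const 0) (nv 10))))
          (.setR 8 (.const 0) (.const 0) (.get 13 (nv 10) (nv 11)))))
      (rv 8))

lemma recenterP_spec {s : State} (hs : Dims n d k s) {A : Matrix (Fin n) (Fin d) ℝ}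
    (hA : Stores (s.R 0) A) {S : Fin n → Fin k} (hS : ∀ i : Fin n, s.N 1 0 i = S i) (r : Fin k) :
    vec d ((recenterP.exec s).R 13 r)
      = recenter (row A) (fun r : Fin k => vec d (s.R 13 r)) S r := by
  simp only [recenterP, Prog.exec]
  set P1 := mapR1 10 2 19 (.const 0)
      (sumP 11 0 8 (eqExp (.get 1 (.const 0) (nv 11)) (nv 10))) (rv 8) with hP1
  set s1 := P1.exec s with hs1
  have hind : ∀ (r : Fin k) (g : Fin n → ℝ),
      ∑ i : Fin n, (if s.N 1 0 i = r then 1 else 0) * g i = ∑ i ∈ part S r, g i := by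
    intro r g
    rw [part, Finset.sum_filter]
    refine Finset.sum_congr rfl fun i _ => ?_
    rw [hS i]
    by_cases h : S i = r
    · simp [h]
    · have : (S i : ℕ) ≠ r := fun h' => h (Fin.ext h')
      simp [h, this]
  have h19 : ∀ r : Fin k, s1.R 19 0 r = (part S r).card := by
    have := (mapR1_spec (c := 10) (j := 2) (t := 19) (row := .const 0) (s := s)
      (body := sumP 11 0 8 (eqExp (.get 1 (.const 0) (nv 11)) (nv 10))) (x := rv 8) 0
      (fun r => ∑ i ∈ Finset.range n, if s.N 1 0 i = r then (1 : ℝ) else 0) rfl rfl (by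
        intro i _ s' hF hi _
        have h0 : s'.N 0 0 0 = n := by rw [hF.1 0 rfl]; exact hs.1
        refine ⟨rfl, (sumP_spec (fun l => if s.N 1 0 l = i then (1 : ℝ) else 0) ?_).trans
          (by rw [h0])⟩
        intro l _ s'' hN hR hl
        rw [eqExp_eval]
        simp only [NExp.eval, hl, hN 1 (by decide), hN 10 (by decide), hi, hF.1 1 rfl])).1
    intro r
    rw [this r (by rw [hs.2.2]; exact r.2), Finset.sum_range]
    have := hind r fun _ => 1
    simpa using this
  have d1 : Dims n d k s1 := hs.congr (P1.exec_N rfl s)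
  have hA1 : Stores (s1.R 0) A := by rw [hs1, P1.exec_R rfl]; exact hA
  have h1 : s1.N 1 = s.N 1 := P1.exec_N rfl s
  have h13 : s1.R 13 = s.R 13 := P1.exec_R rfl s
  ext l
  refine (mapR2_spec (s := s1) (c := 10) (j := 2) (c' := 11) (j' := 1) (t := 13)
    (fun r l => if 0 < s1.R 19 0 r then
        (∑ i ∈ Finset.range n, (if s.N 1 0 i = r then 1 else 0) * s1.R 0 i l) / s1.R 19 0 r
      else s.R 13 r l) (by decide) (by decide) (by decide) rfl rfl rfl rfl ?_ r
    (by rw [d1.2.2]; exact r.2) l (by rw [d1.2.1]; exact l.2)).trans ?_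
  · intro r _ l _ s' hF hr hl ho
    rw [Prog.exec]
    set Q := sumP 12 0 8
      (.mul (eqExp (.get 1 (.const 0) (nv 12)) (nv 10)) (.get 0 (nv 12) (nv 11))) with hQ
    have h0 : s'.N 0 0 0 = n := by rw [hF.1 0 rfl]; exact d1.1
    have e8 : (Q.exec s').R 8 0 0
        = ∑ i ∈ Finset.range n, (if s.N 1 0 i = r then 1 else 0) * s1.R 0 i l := by
      rw [hQ, sumP_spec (fun i => (if s.N 1 0 i = r then 1 else 0) * s1.R 0 i l), h0]
      intro i _ s'' hN hR hi
      rw [RExp.eval, eqExp_eval]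
      simp only [RExp.eval, NExp.eval, hi, hN 1 (by decide), hN 10 (by decide),
        hN 11 (by decide), hR 0 (by decide), hr, hl, hF.1 1 rfl, hF.2 0 rfl, h1]
    have e19 : (Q.exec s').R 19 = s1.R 19 := by rw [Q.exec_R rfl, hF.2 19 rfl]
    have e13 : (Q.exec s').R 13 r l = s.R 13 r l := by rw [Q.exec_R rfl, ho, h13]
    have e10 : (Q.exec s').N 10 0 0 = r := by rw [Q.exec_N rfl, hr]
    have e11 : (Q.exec s').N 11 0 0 = l := by rw [Q.exec_N rfl, hl]
    simp only [Prog.exec, BExp.eval, RExp.eval, NExp.eval, e10, e11, e19, e13, e8, Rat.cast_zero]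
    split_ifs <;> simp
  · simp only [h19]
    unfold recenter
    by_cases hr : (part S r).Nonempty
    · have hpos : (0 : ℝ) < (part S r).card := by exact_mod_cast hr.card_pos
      rw [if_pos hpos, if_pos hr, Finset.sum_range, hind r fun i => s1.R 0 i l, mean, div_eq_inv_mul]
      simp only [PiLp.smul_apply, smul_eq_mul, WithLp.ofLp_sum, Finset.sum_apply]
      congr 1
      exact Finset.sum_congr rfl fun i _ => hA1 i l
    · rw [if_neg hr, if_neg]
      · rfl
      · rw [Finset.not_nonempty_iff_eq_empty.1 hr]; simp

/-- Copy the points (rows of `R 5`) listed in `N 3` to the centers in `R 13`. -/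
def initCentersP : Prog :=
  mapR2 10 2 11 1 13 .skip (.get 5 (.get 3 (.const 0) (nv 10)) (nv 11))

lemma initCentersP_spec {s : State} (hs : Dims n d k s) (r : Fin k) :
    vec d ((initCentersP.exec s).R 13 r) = vec d (s.R 5 (s.N 3 0 r)) := by
  ext l
  refine mapR2_spec (s := s) (c := 10) (j := 2) (c' := 11) (j' := 1) (t := 13) (body := .skip)
    (x := .get 5 (.get 3 (.const 0) (nv 10)) (nv 11))
    (fun r l => s.R 5 (s.N 3 0 r) l) (by decide) (by decide) (by decide) rfl rfl rfl rfl ?_ r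
    (by rw [hs.2.2]; exact r.2) l (by rw [hs.2.1]; exact l.2)
  intro r _ l _ s' hF hr hl _
  simp only [Prog.exec, RExp.eval, NExp.eval, hr, hl, hF.2 5 rfl, hF.1 3 rfl]

/-- `n` Lloyd steps. -/
def lloydP : Prog := .loop 15 (dim 0) (.seq assignP recenterP)

lemma lloydP_spec {s : State} (hs : Dims n d k s) (hk : 1 ≤ k) {A : Matrix (Fin n) (Fin d) ℝ}
    (hA : Stores (s.R 0) A) :
    ∃ (ν : ℕ → Fin k → Pt d) (S : ℕ → Fin n → Fin k),
      ν 0 = (fun r : Fin k => vec d (s.R 13 r)) ∧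
      (∀ t < n, IsNearestAssignment (row A) (ν t) (S t)) ∧
      (∀ t < n, ν (t + 1) = recenter (row A) (ν t) (S t)) ∧
      (fun r : Fin k => vec d ((lloydP.exec s).R 13 r)) = ν n := by
  have key := loop_induct (s := s) (b := 15) (j := 0) (c := .seq assignP recenterP)
    (fun m s' => ∃ (ν : ℕ → Fin k → Pt d) (S : ℕ → Fin n → Fin k),
      ν 0 = (fun r : Fin k => vec d (s.R 13 r)) ∧
      (∀ t < m, IsNearestAssignment (row A) (ν t) (S t)) ∧
      (∀ t < m, ν (t + 1) = recenter (row A) (ν t) (S t)) ∧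
      (fun r : Fin k => vec d (s'.R 13 r)) = ν m) ?_ ?_
  · rw [hs.1] at key
    exact key
  · exact ⟨fun _ r => vec d (s.R 13 r), fun _ _ => ⟨0, hk⟩, rfl, by simp, by simp, rfl⟩
  · rintro m _ s' hF ⟨ν, S, h0, hS, hν, hcur⟩
    set s5 := s'.writeN 15 0 0 m with hs5
    have d5 : Dims n d k s5 := hs.congr (by rw [hs5, writeN_N_of_ne _ (by decide), hF.1 0 rfl])
    have hA5 : Stores (s5.R 0) A := by rw [hs5, writeN_R, hF.2 0 rfl]; exact hA
    have hcur5 : (fun r : Fin k => vec d (s5.R 13 r)) = ν m := hcur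
    obtain ⟨S', hS', hnear⟩ := assignP_spec d5 hk hA5
    rw [Prog.exec]
    set s6 := assignP.exec s5 with hs6
    have d6 : Dims n d k s6 := d5.congr (assignP.exec_N rfl s5)
    have hA6 : Stores (s6.R 0) A := by rw [hs6, assignP.exec_R rfl]; exact hA5
    have hnew := recenterP_spec d6 hA6 hS'
    have h136 : s6.R 13 = s5.R 13 := assignP.exec_R rfl s5
    rw [h136, hcur5] at hnew
    rw [hcur5] at hnear
    refine ⟨Function.update ν (m + 1) (recenter (row A) (ν m) S'), Function.update S m S', ?_,
      fun t ht => ?_, fun t ht => ?_, ?_⟩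
    · rw [Function.update_of_ne (by omega)]; exact h0
    · rw [Function.update_of_ne (by omega : t ≠ m + 1)]
      rcases Nat.lt_succ_iff_lt_or_eq.1 ht with ht | rfl
      · rw [Function.update_of_ne ht.ne]; exact hS t ht
      · rw [Function.update_self]; exact hnear
    · rw [Function.update_of_ne (by omega : t ≠ m + 1)]
      rcases Nat.lt_succ_iff_lt_or_eq.1 ht with ht | rfl
      · rw [Function.update_of_ne (by omega), Function.update_of_ne ht.ne]; exact hν t ht
      · rw [Function.update_self, Function.update_self]
    · rw [Function.update_self]; exact funext hnew

/-- The algorithm Cluster with `n` Lloyd steps. -/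
def clusterP : Prog :=
  .seq projectP (.seq kmeansP (.seq initCentersP (.seq lloydP assignP)))

lemma clusterP_spec {s : State} (hs : Dims n d k s) (hk : 1 ≤ k) (hn : 1 ≤ n)
    {A : Matrix (Fin n) (Fin d) ℝ} (hA : Stores (s.R 0) A) (h3 : ∀ r, s.N 3 0 r = 0) :
    ∃ label : Fin n → Fin k, HoldsOutput (clusterP.exec s) label ∧
      ∃ V, IsNearTopSubspace 2 k A V ∧ IsClusterOutput 336 n A V label := by
  have hN1 : ∀ a, a = 0 ∨ a = 3 → (projectP.exec s).N a = s.N a := by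
    rintro a (rfl | rfl) <;> exact projectP.exec_N rfl s
  have hR1 : (projectP.exec s).R 0 = s.R 0 := projectP.exec_R rfl s
  obtain ⟨V, hV, h5⟩ := projectP_spec hs hA
  have e : clusterP.exec s
      = assignP.exec (lloydP.exec (initCentersP.exec (kmeansP.exec (projectP.exec s)))) := rfl
  rw [e]
  generalize projectP.exec s = s1 at hN1 hR1 h5 ⊢
  have d1 : Dims n d k s1 := hs.congr (hN1 0 (.inl rfl))
  obtain ⟨-, happ⟩ := kmeansP_spec d1 hk hn fun r => by rw [hN1 3 (.inr rfl)]; exact h3 r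
  rw [show (fun i : Fin n => vec d (s1.R 5 i)) = projPts A V from funext h5] at happ
  have hN2 : (kmeansP.exec s1).N 0 = s1.N 0 := kmeansP.exec_N rfl s1
  have hR2 : (kmeansP.exec s1).R 0 = s1.R 0 := kmeansP.exec_R rfl s1
  have hR25 : (kmeansP.exec s1).R 5 = s1.R 5 := kmeansP.exec_R rfl s1
  generalize kmeansP.exec s1 = s2 at happ hN2 hR2 hR25 ⊢
  have d2 : Dims n d k s2 := d1.congr hN2
  have hN3 : (initCentersP.exec s2).N 0 = s2.N 0 := initCentersP.exec_N rfl s2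
  have hR3 : (initCentersP.exec s2).R 0 = s2.R 0 := initCentersP.exec_R rfl s2
  have h13 := initCentersP_spec d2
  rw [hR25] at h13
  generalize initCentersP.exec s2 = s3 at hN3 hR3 h13 ⊢
  have d3 : Dims n d k s3 := d2.congr hN3
  have hA3 : Stores (s3.R 0) A := by rw [hR3, hR2, hR1]; exact hA
  have hN4 : (lloydP.exec s3).N 0 = s3.N 0 := lloydP.exec_N rfl s3
  have hR4 : (lloydP.exec s3).R 0 = s3.R 0 := lloydP.exec_R rfl s3
  obtain ⟨ν, S, h0, hS, hν, hcur⟩ := lloydP_spec d3 hk hA3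
  generalize lloydP.exec s3 = s4 at hN4 hR4 hcur ⊢
  have d4 : Dims n d k s4 := d3.congr hN4
  have hA4 : Stores (s4.R 0) A := by rw [hR4]; exact hA3
  obtain ⟨S', hS', hnear⟩ := assignP_spec d4 hk hA4
  rw [hcur] at hnear
  simp only [h13] at h0
  refine ⟨S', hS', V, hV, ν, Function.update S n S', by rw [h0]; exact happ, fun t ht => ?_,
    fun t ht => ?_, ?_⟩
  · rcases ht.lt_or_eq with ht | rfl
    · rw [Function.update_of_ne ht.ne]; exact hS t ht
    · rw [Function.update_self]; exact hnear
  · rw [Function.update_of_ne ht.ne]; exact hν t ht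
  · rw [Function.update_self]

lemma dims_input (A : Matrix (Fin n) (Fin d) ℝ) : Dims n d k (input A k) := by
  simp [Dims, input]

lemma stores_input (A : Matrix (Fin n) (Fin d) ℝ) : Stores ((input A k).R 0) A := by
  intro i j; simp [input]

end RealRAM

open SpectralClustering RealRAM in
theorem theorem1 :
    ∃ K : ℝ, 0 < K ∧
      (∀ φ : ℝ, 1 ≤ φ → ∃ c₀ L : ℝ, 0 < c₀ ∧ 0 < L ∧
        ∀ (n d k : ℕ) (A : Matrix (Fin n) (Fin d) ℝ) (V : Submodule ℝ (Pt d)) (ℓ : ℕ)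
          (label : Fin n → Fin k),
          IsTopSingularSubspace k A V → L * (1 + Real.log n) ≤ ℓ →
          IsClusterOutput φ ℓ A V label →
          ∀ c : ℝ, c₀ ≤ c → ∀ T : Fin n → Fin k, IsClustering A T → Recovers K c A T label) ∧
      (∃ (θ φ c₀ : ℝ) (P : Prog) (p : Polynomial ℕ), 1 ≤ θ ∧ 1 ≤ φ ∧ 0 < c₀ ∧
        ∀ (n d k : ℕ) (A : Matrix (Fin n) (Fin d) ℝ), 1 ≤ k → k ≤ n →
          P.time (input A k) ≤ p.eval (n + d + k) ∧
          ∃ label : Fin n → Fin k, HoldsOutput (P.exec (input A k)) label ∧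
            (∃ (V : Submodule ℝ (Pt d)) (ℓ : ℕ),
              IsNearTopSubspace θ k A V ∧ IsClusterOutput φ ℓ A V label) ∧
            ∀ c : ℝ, c₀ ≤ c → ∀ T : Fin n → Fin k, IsClustering A T →
              Recovers K c A T label) := by
  refine ⟨2, two_pos, fun φ hφ => ?_, ?_⟩
  · refine ⟨40 + 64 * √(φ + 1), 1, by positivity, one_pos, ?_⟩
    intro n d k A V ℓ label hV hℓ hout c hc T hT
    have h0 : 0 ≤ √(φ + 1) := Real.sqrt_nonneg _
    exact recovers_of_isClusterOutput le_rfl hφ (by linarith) (by linarith)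
      hV.isNearTopSubspace (le_four_pow_of_log_le hℓ) hout hT
  · refine ⟨2, 336, 2000, clusterP, clusterP.timePoly, by norm_num, by norm_num, by norm_num, ?_⟩
    intro n d k A hk hkn
    have hs : Dims n d k (input A k) := dims_input A
    refine ⟨clusterP.time_le rfl _ fun j hj => ?_, ?_⟩
    · obtain ⟨h0, h1, h2⟩ := hs
      interval_cases j <;> omega
    · obtain ⟨label, hlabel, V, hV, hout⟩ := clusterP_spec hs hk (hk.trans hkn) (stores_input A)
        fun r => by simp [input]
      refine ⟨label, hlabel, ⟨V, n, hV, hout⟩, fun c hc T hT => ?_⟩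
      have h1 : √((336 : ℝ) + 1) ≤ 19 := by
        rw [Real.sqrt_le_left (by norm_num)]; norm_num
      refine recovers_of_isClusterOutput (by norm_num) (by norm_num) (by linarith) (by linarith)
        hV ?_ hout hT
      exact_mod_cast (Nat.lt_pow_self (by norm_num : 1 < 4)).le
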